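/- **Conventions.** Let $N\ge 0$ be an integer. Let $(A,\alpha)$ be either $(\mathbb{Q}[a],a)$ or $(\mathbb{Q},1)$; the potential is $\alpha x^{N+1}$. Polynomial rings over $A$ are bigraded by $\deg a=(2,0)$ (when $A=\mathbb{Q}[a]$) and $\deg x=(0,2)$ for every variable $x$. The first degree is the $a$-degree, the second the $x$-degree; for $A=\mathbb{Q}$ only the $x$-degree is used. For $\deg u+\deg v=(2,2N+2)$, $(u,v)_R$ denotes the matrix factorization $R\xrightarrow{u}R\{1-\deg_a u,\,N+1-\deg_x u\}\xrightarrow{v}R$ (with $\deg_a a=2$ used also for the formal shifts when $\alpha=1$); several rows mean the tensor product; $\langle 1\rangle$ shifts the $\mathbb{Z}_2$-degree and $\{p,q\}$ raises the bidegree by $(p,q)$. **Complexes.** Let $B$ be a closed braid, given as the closure of a word in $\sigma_i^{\pm1}$ with all strands oriented upwards. Cut $B$ into horizontal slices, one for each letter and a last one without a crossing that closes up the braid. Mark every strand at the bottom of every slice by its own variable, so that every arc is marked, and cut $B$ at the marked points (another marking with a mark on every arc leads to isomorphic homologies). * An arc from a point marked $y$ to a point marked $x$ gets $\left(\alpha\frac{x^{N+1}-y^{N+1}}{x-y},\,x-y\right)$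 in homological degree $0$. * Consider a crossing with top end points $x_1$ (left), $y_1$ (right) and bottom end points $y_2$ (left), $x_2$ (right). Let $\Gamma_0$ be the tensor product of the factorizations of the arcs $y_2\to x_1$ and $x_2\to y_1$. Let $\Gamma_1=\begin{pmatrix}\alpha U_1 & X_1-Y_1\\ \alpha U_2& X_2-Y_2\end{pmatrix}\{0,-1\}$, where $X_1=x_1+y_1$, $X_2=x_1y_1$, $Y_1=x_2+y_2$, $Y_2=x_2y_2$, $p(x+y,xy)=x^{N+1}+y^{N+1}$, $U_1=\frac{p(X_1,X_2)-p(Y_1,X_2)}{X_1-Y_1}$ and $U_2=\frac{p(Y_1,X_2)-p(Y_1,Y_2)}{X_2-Y_2}$. There are morphisms $\chi^0:\Gamma_0\to\Gamma_1$ and $\chi^1:\Gamma_1\to\Gamma_0$ of bidegree $(0,1)$ with $\chi^1\chi^0=x_2-x_1$ and $\chi^0\chi^1=x_2-x_1$: with bases $1,e,f,ef$ of the two Koszul factorizations and $\kappa=\left(\frac{y_1^{N+1}-x_2^{N+1}}{y_1-x_2}-U_1-x_1U_2\right)/(x_1-y_2)$, they are $\chi^0:\ 1\mapsto (x_2-x_1)-\alpha\kappa\,ef,\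 e\mapsto f-x_1e,\ f\mapsto x_2e-f,\ ef\mapsto -ef$ and $\chi^1:\ 1\mapsto 1-\alpha\kappa\,ef,\ e\mapsto e+f,\ f\mapsto x_2e+x_1f,\ ef\mapsto (x_1-x_2)ef$. A positive crossing $\sigma_i$ gets $\Gamma_1\langle1\rangle\{1,N\}\xrightarrow{\chi^1}\Gamma_0\langle1\rangle\{1,N-1\}$ in homological degrees $-1,0$. A negative crossing gets $\Gamma_0\langle1\rangle\{-1,-N+1\}\xrightarrow{\chi^0}\Gamma_1\langle1\rangle\{-1,-N\}$ in degrees $0,1$. The tensor product of all pieces over the common end points is a complex with commuting differentials $d_{mf}$ (of the matrix factorization, of potential $0$) and $d_\chi$. Its homology $H(H(\,\cdot\,,d_{mf}),d_\chi)$ is denoted $\mathcal{H}_N(B)$ for $(A,\alpha)=(\mathbb{Q}[a],a)$, and $H_N(B)$, the $\mathfrak{sl}(N)$ Khovanov–Rozansky homology, for $(A,\alpha)=(\mathbb{Q},1)$. Write $\mathcal{H}_N^{\varepsilon,i,j,k}(B)$ for the component of $\mathbb{Z}_2$-degree $\varepsilon$, homological degree $i$, $a$-degree $j$ and $x$-degree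 $k$, write $\mathcal{H}_N^{\varepsilon,i,\star,k}(B)=\bigoplus_j\mathcal{H}_N^{\varepsilon,i,j,k}(B)$, and write $H_N^{\varepsilon,i,k}(B)$ for the component of $\mathbb{Z}_2$-degree $\varepsilon$, homological degree $i$ and $x$-degree $k$. **Theorem 1.8.** Let $N\ge0$, let $B$ be a closed braid and $(\varepsilon,i,k)\in\mathbb{Z}_2\oplus\mathbb{Z}^{\oplus2}$. 1. $H_N^{\varepsilon,i,k}(B)\cong\mathcal{H}_N^{\varepsilon,i,\star,k}(B)/(a-1)\mathcal{H}_N^{\varepsilon,i,\star,k}(B)$ as $\mathbb{Q}$-vector spaces. 2. As a $\mathbb{Z}$-graded $\mathbb{Q}[a]$-module (graded by the $a$-degree), $$\mathcal{H}_N^{\varepsilon,i,\star,k}(B)\cong\Big(\bigoplus_{p=1}^{m}\mathbb{Q}[a]\{s_p\}\Big)\oplus\Big(\bigoplus_{q=1}^{n}\mathbb{Q}[a]/(a^{l_q})\{t_q\}\Big),$$ where $\{s\}$ shifts the $a$-grading by $s$, $m=\dim_{\mathbb{Q}}H_N^{\varepsilon,i,k}(B)<\infty$, $n$ is a finite non-negative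 integer, the $l_q$ are positive integers and $s_p,t_q\in\mathbb{Z}$. The number $n$ and the sequences $(s_p)_p$ and $((l_q,t_q))_q$, the latter two up to permutation, are determined by $B$ and $(\varepsilon,i,k)$: any two such decompositions have the same $m$ and $n$ and agree up to a permutation of the $s_p$ and a permutation of the $(l_q,t_q)$. -/

import Mathlib

open scoped Kronecker

/-! ### Divided differences of power sums -/

section PowerSums

variable {R : Type*} [CommRing R]

/-- `powQuot k x y = (x ^ k - y ^ k) / (x - y)`, as a polynomial in `x` and `y`. -/
def powQuot (k : ℕ) (x y : R) : R := ∑ i ∈ Finset.range k, x ^ i * y ^ (k - 1 - i)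

/-- The polynomial `p_{2,k}(X₁, X₂)` that expresses the power sum `x ^ k + y ^ k` through the
elementary symmetric polynomials `X₁ = x + y`, `X₂ = x * y`. -/
def powSum : ℕ → R → R → R
  | 0, _, _ => 2
  | 1, e₁, _ => e₁
  | k + 2, e₁, e₂ => e₁ * powSum (k + 1) e₁ e₂ - e₂ * powSum k e₁ e₂

/-- The quotient `(p_{2,k}(X₁, X₂) - p_{2,k}(Y₁, X₂)) / (X₁ - Y₁)`, as a polynomial. -/
def quotFst : ℕ → R → R → R → R
  | 0, _, _, _ => 0
  | 1, _, _, _ => 1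
  | k + 2, X₁, X₂, Y₁ =>
      powSum (k + 1) X₁ X₂ + Y₁ * quotFst (k + 1) X₁ X₂ Y₁ - X₂ * quotFst k X₁ X₂ Y₁

/-- The quotient `(p_{2,k}(Y₁, X₂) - p_{2,k}(Y₁, Y₂)) / (X₂ - Y₂)`, as a polynomial. -/
def quotSnd : ℕ → R → R → R → R
  | 0, _, _, _ => 0
  | 1, _, _, _ => 0
  | k + 2, X₂, Y₁, Y₂ =>
      Y₁ * quotSnd (k + 1) X₂ Y₁ Y₂ - powSum k Y₁ X₂ - Y₂ * quotSnd k X₂ Y₁ Y₂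

/-- The polynomial `(powQuot k y₁ x₂ - (U₁ + x₁ U₂)) / (x₁ - y₂)`, where `U₁`, `U₂` are the
quotients `quotFst`, `quotSnd` at `X₁ = x₁ + y₁`, `X₂ = x₁ y₁`, `Y₁ = x₂ + y₂`, `Y₂ = x₂ y₂`;
it appears in the matrices of the maps `χ⁰` and `χ¹`. -/
def quotChi : ℕ → R → R → R → R → R
  | 0, _, _, _, _ => 0
  | 1, _, _, _, _ => 0
  | k + 2, x₁, y₁, x₂, y₂ =>
      (x₂ + y₂) * quotChi (k + 1) x₁ y₁ x₂ y₂ - x₁ * y₁ * quotChi k x₁ y₁ x₂ y₂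
        + powQuot (k + 1) y₁ x₂ - x₁ * powQuot k x₁ y₂

theorem powQuot_mul (k : ℕ) (x y : R) : powQuot k x y * (x - y) = x ^ k - y ^ k :=
  (Commute.all x y).geom_sum₂_mul k

theorem powQuot_succ (k : ℕ) (x y : R) : powQuot (k + 1) x y = y * powQuot k x y + x ^ k := by
  have h := (Commute.all x y).geom_sum₂_succ_eq (n := k)
  simp only [powQuot, Nat.add_sub_cancel] at h ⊢
  rw [h]; ring

theorem powQuot_succ' (k : ℕ) (x y : R) : powQuot (k + 1) x y = x * powQuot k x y + y ^ k := by
  have h := powQuot_succ k x y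
  have h' := powQuot_mul k x y
  linear_combination h - h'

theorem powSum_add_mul (k : ℕ) (x y : R) : powSum k (x + y) (x * y) = x ^ k + y ^ k := by
  induction k using Nat.twoStepInduction with
  | zero => simp [powSum]; norm_num
  | one => simp [powSum]
  | more k h₀ h₁ => rw [powSum, h₀, h₁]; ring

theorem quotFst_mul (k : ℕ) (X₁ X₂ Y₁ : R) :
    quotFst k X₁ X₂ Y₁ * (X₁ - Y₁) = powSum k X₁ X₂ - powSum k Y₁ X₂ := by
  induction k using Nat.twoStepInduction with
  | zero => simp [powSum, quotFst]
  | one => simp [powSum, quotFst]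
  | more k h₀ h₁ => rw [powSum, powSum, quotFst]; linear_combination Y₁ * h₁ - X₂ * h₀

theorem quotSnd_mul (k : ℕ) (X₂ Y₁ Y₂ : R) :
    quotSnd k X₂ Y₁ Y₂ * (X₂ - Y₂) = powSum k Y₁ X₂ - powSum k Y₁ Y₂ := by
  induction k using Nat.twoStepInduction with
  | zero => simp [powSum, quotSnd]
  | one => simp [powSum, quotSnd]
  | more k h₀ h₁ => rw [powSum, powSum, quotSnd]; linear_combination Y₁ * h₁ - Y₂ * h₀

theorem quotChi_mul (k : ℕ) (x₁ y₁ x₂ y₂ : R) :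
    quotChi k x₁ y₁ x₂ y₂ * (x₁ - y₂) = powQuot k y₁ x₂
      - (quotFst k (x₁ + y₁) (x₁ * y₁) (x₂ + y₂)
        + x₁ * quotSnd k (x₁ * y₁) (x₂ + y₂) (x₂ * y₂)) := by
  induction k using Nat.twoStepInduction with
  | zero => simp [powQuot, quotFst, quotSnd, quotChi]
  | one => simp [powQuot, quotFst, quotSnd, quotChi]
  | more k h₀ h₁ =>
    have e₁ := powSum_add_mul (k + 1) x₁ y₁
    have e₂ := powSum_add_mul k x₂ y₂
    have e₃ := quotSnd_mul k (x₁ * y₁) (x₂ + y₂) (x₂ * y₂)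
    have e₄ := powQuot_mul k x₁ y₂
    have e₅ := powQuot_succ (k + 1) y₁ x₂
    have e₆ := powQuot_succ' k y₁ x₂
    rw [quotFst, quotSnd, quotChi]
    linear_combination (x₂ + y₂) * h₁ - x₁ * y₁ * h₀ - e₅ + e₁ - x₁ * e₂ + x₁ * e₃ - x₁ * e₄
      + x₁ * e₆

theorem quotChi_mul' (k : ℕ) (x₁ y₁ x₂ y₂ : R) :
    quotChi k x₁ y₁ x₂ y₂ * (y₁ - x₂) = quotFst k (x₁ + y₁) (x₁ * y₁) (x₂ + y₂)
        + x₂ * quotSnd k (x₁ * y₁) (x₂ + y₂) (x₂ * y₂) - powQuot k x₁ y₂ := by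
  induction k using Nat.twoStepInduction with
  | zero => simp [powQuot, quotFst, quotSnd, quotChi]
  | one => simp [powQuot, quotFst, quotSnd, quotChi]
  | more k h₀ h₁ =>
    have e₁ := powSum_add_mul (k + 1) x₁ y₁
    have e₂ := powSum_add_mul k x₂ y₂
    have e₃ := quotSnd_mul k (x₁ * y₁) (x₂ + y₂) (x₂ * y₂)
    have e₄ := powQuot_mul (k + 1) y₁ x₂
    have e₅ := powQuot_succ (k + 1) x₁ y₂
    have e₆ := powQuot_succ' k x₁ y₂
    rw [quotFst, quotSnd, quotChi]
    linear_combination (x₂ + y₂) * h₁ - x₁ * y₁ * h₀ + e₅ - e₁ + x₂ * e₂ - x₂ * e₃ + e₄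
      - x₂ * e₆

end PowerSums

/-! ### Matrix factorizations and complexes of matrix factorizations -/

/-- The sign `(-1) ^ ε` of a `ℤ/2`-degree. -/
def paritySign (R : Type) [CommRing R] (ε : ZMod 2) : R := if ε = 0 then 1 else -1

/-- The sign `(-1) ^ i` of a homological degree. -/
def degSign (R : Type) [CommRing R] (i : ℤ) : R := ((i.negOnePow : ℤ) : R)

/-- A finitely generated matrix factorization of `pot` over `R`, given on a homogeneous basis `ι`:
the `ℤ/2`-, `a`- and `x`-degrees of the basis elements, and the matrix of the differential (the
column `b'` of `dmf` holds the coordinates of `d b'`). -/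
structure MatFac (R : Type) [CommRing R] where
  ι : Type
  [fin : Fintype ι]
  [dec : DecidableEq ι]
  parity : ι → ZMod 2
  adeg : ι → ℤ
  xdeg : ι → ℤ
  pot : R
  dmf : Matrix ι ι R
  dmf_odd : ∀ b b', dmf b b' ≠ 0 → parity b = parity b' + 1
  dmf_sq : dmf * dmf = pot • (1 : Matrix ι ι R)

attribute [instance] MatFac.fin MatFac.dec

namespace MatFac

variable {R : Type} [CommRing R]

theorem dmf_mul_sign (M : MatFac R) :
    M.dmf * Matrix.diagonal (fun b => paritySign R (M.parity b))
      = -(Matrix.diagonal (fun b => paritySign R (M.parity b)) * M.dmf) := by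
  ext b b'
  rw [Matrix.mul_diagonal, Matrix.neg_apply, Matrix.diagonal_mul]
  by_cases h : M.dmf b b' = 0
  · simp [h]
  · rw [M.dmf_odd b b' h]
    have key : ∀ e : ZMod 2, paritySign R (e + 1) = -paritySign R e := by
      intro e
      have h : ∀ e : ZMod 2, e + 1 = 0 ↔ ¬ e = 0 := by decide
      by_cases he : e = 0
      · simp [paritySign, he]
      · rw [paritySign, if_pos ((h e).2 he), paritySign, if_neg he, neg_neg]
    rw [key]; ring

/-- The rank one Koszul matrix factorization `R --u--> R{1 - p, N + 1 - q} --v--> R` of `u * v`,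
where `(p, q)` is the bidegree of `u`. -/
abbrev koszul (N : ℕ) (u v : R) (p q : ℤ) : MatFac R where
  ι := Fin 2
  parity := ![0, 1]
  adeg := ![0, 1 - p]
  xdeg := ![0, N + 1 - q]
  pot := u * v
  dmf := !![0, v; u, 0]
  dmf_odd := by
    intro b b'
    fin_cases b <;> fin_cases b' <;> simp
    exact fun _ => by decide
  dmf_sq := by
    ext b b'
    fin_cases b <;> fin_cases b' <;> simp [Matrix.mul_apply, Fin.sum_univ_two, mul_comm]

/-- The tensor product over `R`: `d (m ⊗ m') = d m ⊗ m' + (-1) ^ |m| m ⊗ d m'`. -/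
abbrev tensor (M M' : MatFac R) : MatFac R where
  ι := M.ι × M'.ι
  parity b := M.parity b.1 + M'.parity b.2
  adeg b := M.adeg b.1 + M'.adeg b.2
  xdeg b := M.xdeg b.1 + M'.xdeg b.2
  pot := M.pot + M'.pot
  dmf := M.dmf ⊗ₖ (1 : Matrix M'.ι M'.ι R)
    + Matrix.diagonal (fun b => paritySign R (M.parity b)) ⊗ₖ M'.dmf
  dmf_odd := by
    rintro ⟨b, c⟩ ⟨b', c'⟩ h
    by_contra hne
    apply h
    rw [Matrix.add_apply, Matrix.kroneckerMap_apply, Matrix.kroneckerMap_apply]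
    have h₁ : M.dmf b b' * (1 : Matrix M'.ι M'.ι R) c c' = 0 := by
      by_cases hc : c = c'
      · by_cases hd : M.dmf b b' = 0
        · simp [hd]
        · exact absurd (by rw [hc, M.dmf_odd b b' hd]; ring) hne
      · simp [hc]
    have h₂ : Matrix.diagonal (fun b => paritySign R (M.parity b)) b b' * M'.dmf c c' = 0 := by
      by_cases hb : b = b'
      · by_cases hd : M'.dmf c c' = 0
        · simp [hd]
        · exact absurd (by rw [hb, M'.dmf_odd c c' hd]; ring) hne
      · simp [hb]
    rw [h₁, h₂, add_zero]
  dmf_sq := by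
    have hs : Matrix.diagonal (fun b => paritySign R (M.parity b))
        * Matrix.diagonal (fun b => paritySign R (M.parity b)) = 1 := by
      rw [Matrix.diagonal_mul_diagonal, ← Matrix.diagonal_one]
      congr 1; ext b
      by_cases h : M.parity b = 0 <;> simp [paritySign, h]
    rw [add_mul, mul_add, mul_add, ← Matrix.mul_kronecker_mul, ← Matrix.mul_kronecker_mul,
      ← Matrix.mul_kronecker_mul, ← Matrix.mul_kronecker_mul, M.dmf_sq, M'.dmf_sq, hs,
      dmf_mul_sign, one_mul, mul_one, one_mul, Matrix.smul_kronecker,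
      Matrix.kronecker_smul, Matrix.one_kronecker_one, add_smul]
    ext b b'
    simp [Matrix.kroneckerMap_apply]

/-- The shift `M⟨1⟩{p, q}`: the `ℤ/2`-degree is shifted by `1`, the `a`-degree by `p` and the
`x`-degree by `q`. -/
abbrev shiftOne (M : MatFac R) (p q : ℤ) : MatFac R :=
  { M with
    parity := fun b => M.parity b + 1
    adeg := fun b => M.adeg b + p
    xdeg := fun b => M.xdeg b + q
    dmf_odd := fun b b' h => by rw [M.dmf_odd b b' h] }

/-- The shift `M{p, q}`. -/
abbrev shift (M : MatFac R) (p q : ℤ) : MatFac R :=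
  { M with
    adeg := fun b => M.adeg b + p
    xdeg := fun b => M.xdeg b + q }

end MatFac

/-- A bounded complex of matrix factorizations of the same potential: `hdeg` is the homological
degree of the basis elements and `dchi` the matrix of the differential of the complex. -/
structure MFComplex (R : Type) [CommRing R] extends MatFac R where
  hdeg : ι → ℤ
  dchi : Matrix ι ι R
  dmf_hdeg : ∀ b b', dmf b b' ≠ 0 → hdeg b = hdeg b'
  dchi_hdeg : ∀ b b', dchi b b' ≠ 0 → hdeg b = hdeg b' + 1
  dchi_parity : ∀ b b', dchi b b' ≠ 0 → parity b = parity b'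
  dchi_sq : dchi * dchi = 0
  dmf_dchi : dmf * dchi = dchi * dmf

namespace MFComplex

variable {R : Type} [CommRing R]

/-- The complex `0 → M → 0` with `M` in homological degree `0`. -/
abbrev single (M : MatFac R) : MFComplex R where
  toMatFac := M
  hdeg _ := 0
  dchi := 0
  dmf_hdeg _ _ _ := rfl
  dchi_hdeg b b' h := absurd rfl h
  dchi_parity b b' h := absurd rfl h
  dchi_sq := by simp
  dmf_dchi := by simp

/-- The complex `0 → M --f--> M' → 0` with `M` in homological degree `i` and `M'` in degree
`i + 1`. -/
abbrev twoTerm (M M' : MatFac R) (i : ℤ) (f : Matrix M'.ι M.ι R) (hpot : M.pot = M'.pot)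
    (hpar : ∀ b b', f b b' ≠ 0 → M'.parity b = M.parity b') (hf : f * M.dmf = M'.dmf * f) :
    MFComplex R where
  ι := M.ι ⊕ M'.ι
  parity := Sum.elim M.parity M'.parity
  adeg := Sum.elim M.adeg M'.adeg
  xdeg := Sum.elim M.xdeg M'.xdeg
  pot := M.pot
  dmf := Matrix.fromBlocks M.dmf 0 0 M'.dmf
  dmf_odd := by
    rintro (b | b) (b' | b') h
    · exact M.dmf_odd b b' h
    · exact absurd rfl h
    · exact absurd rfl h
    · exact M'.dmf_odd b b' h
  dmf_sq := by
    rw [Matrix.fromBlocks_multiply, M.dmf_sq, M'.dmf_sq, ← hpot, ← Matrix.fromBlocks_one,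
      Matrix.fromBlocks_smul]
    simp
  hdeg := Sum.elim (fun _ => i) (fun _ => i + 1)
  dchi := Matrix.fromBlocks 0 0 f 0
  dmf_hdeg := by
    rintro (b | b) (b' | b') h
    · rfl
    · exact absurd rfl h
    · exact absurd rfl h
    · rfl
  dchi_hdeg := by
    rintro (b | b) (b' | b') h
    · exact absurd rfl h
    · exact absurd rfl h
    · rfl
    · exact absurd rfl h
  dchi_parity := by
    rintro (b | b) (b' | b') h
    · exact absurd rfl h
    · exact absurd rfl h
    · exact hpar b b' h
    · exact absurd rfl h
  dchi_sq := by rw [Matrix.fromBlocks_multiply]; simp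
  dmf_dchi := by rw [Matrix.fromBlocks_multiply, Matrix.fromBlocks_multiply]; simp [hf]

/-- The tensor product over `R` of complexes of matrix factorizations: the tensor product of the
underlying matrix factorizations with `dχ (c ⊗ c') = dχ c ⊗ c' + (-1) ^ i c ⊗ dχ c'` for `c` of
homological degree `i`. -/
abbrev tensor (M M' : MFComplex R) : MFComplex R where
  toMatFac := M.toMatFac.tensor M'.toMatFac
  hdeg b := M.hdeg b.1 + M'.hdeg b.2
  dchi := M.dchi ⊗ₖ (1 : Matrix M'.ι M'.ι R)
    + Matrix.diagonal (fun b => degSign R (M.hdeg b)) ⊗ₖ M'.dchi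
  dmf_hdeg := by
    rintro ⟨b, c⟩ ⟨b', c'⟩ h
    by_contra hne
    apply h
    change (_ ⊗ₖ _ + _ ⊗ₖ _ : Matrix (M.ι × M'.ι) (M.ι × M'.ι) R) _ _ = 0
    rw [Matrix.add_apply, Matrix.kroneckerMap_apply, Matrix.kroneckerMap_apply]
    have h₁ : M.dmf b b' * (1 : Matrix M'.ι M'.ι R) c c' = 0 := by
      by_cases hc : c = c'
      · by_cases hd : M.dmf b b' = 0
        · simp [hd]
        · exact absurd (by simp only [hc, M.dmf_hdeg b b' hd]) hne
      · simp [hc]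
    have h₂ : Matrix.diagonal (fun b => paritySign R (M.parity b)) b b' * M'.dmf c c' = 0 := by
      by_cases hb : b = b'
      · by_cases hd : M'.dmf c c' = 0
        · simp [hd]
        · exact absurd (by simp only [hb, M'.dmf_hdeg c c' hd]) hne
      · simp [hb]
    rw [h₁, h₂, add_zero]
  dchi_hdeg := by
    rintro ⟨b, c⟩ ⟨b', c'⟩ h
    by_contra hne
    apply h
    rw [Matrix.add_apply, Matrix.kroneckerMap_apply, Matrix.kroneckerMap_apply]
    have h₁ : M.dchi b b' * (1 : Matrix M'.ι M'.ι R) c c' = 0 := by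
      by_cases hc : c = c'
      · by_cases hd : M.dchi b b' = 0
        · simp [hd]
        · exact absurd (by simp only [hc, M.dchi_hdeg b b' hd]; ring) hne
      · simp [hc]
    have h₂ : Matrix.diagonal (fun b => degSign R (M.hdeg b)) b b' * M'.dchi c c' = 0 := by
      by_cases hb : b = b'
      · by_cases hd : M'.dchi c c' = 0
        · simp [hd]
        · exact absurd (by simp only [hb, M'.dchi_hdeg c c' hd]; ring) hne
      · simp [hb]
    rw [h₁, h₂, add_zero]
  dchi_parity := by
    rintro ⟨b, c⟩ ⟨b', c'⟩ h
    by_contra hne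
    apply h
    rw [Matrix.add_apply, Matrix.kroneckerMap_apply, Matrix.kroneckerMap_apply]
    have h₁ : M.dchi b b' * (1 : Matrix M'.ι M'.ι R) c c' = 0 := by
      by_cases hc : c = c'
      · by_cases hd : M.dchi b b' = 0
        · simp [hd]
        · exact absurd (by simp only [hc, M.dchi_parity b b' hd]) hne
      · simp [hc]
    have h₂ : Matrix.diagonal (fun b => degSign R (M.hdeg b)) b b' * M'.dchi c c' = 0 := by
      by_cases hb : b = b'
      · by_cases hd : M'.dchi c c' = 0
        · simp [hd]
        · exact absurd (by simp only [hb, M'.dchi_parity c c' hd]) hne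
      · simp [hb]
    rw [h₁, h₂, add_zero]
  dchi_sq := by
    have ht : M.dchi * Matrix.diagonal (fun b => degSign R (M.hdeg b))
        = -(Matrix.diagonal (fun b => degSign R (M.hdeg b)) * M.dchi) := by
      ext b b'
      rw [Matrix.mul_diagonal, Matrix.neg_apply, Matrix.diagonal_mul]
      by_cases h : M.dchi b b' = 0
      · simp [h]
      · rw [M.dchi_hdeg b b' h]; simp [degSign, Int.negOnePow_succ, mul_comm]
    change (M.dchi ⊗ₖ (1 : Matrix M'.ι M'.ι R)
        + Matrix.diagonal (fun b => degSign R (M.hdeg b)) ⊗ₖ M'.dchi)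
      * (M.dchi ⊗ₖ (1 : Matrix M'.ι M'.ι R)
        + Matrix.diagonal (fun b => degSign R (M.hdeg b)) ⊗ₖ M'.dchi)
      = (0 : Matrix (M.ι × M'.ι) (M.ι × M'.ι) R)
    rw [add_mul, mul_add, mul_add, ← Matrix.mul_kronecker_mul, ← Matrix.mul_kronecker_mul,
      ← Matrix.mul_kronecker_mul, ← Matrix.mul_kronecker_mul, M.dchi_sq, M'.dchi_sq, ht]
    ext b b'
    simp [Matrix.kroneckerMap_apply]
  dmf_dchi := by
    have h₁ : M.dmf * Matrix.diagonal (fun b => degSign R (M.hdeg b))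
        = Matrix.diagonal (fun b => degSign R (M.hdeg b)) * M.dmf := by
      ext b b'
      rw [Matrix.mul_diagonal, Matrix.diagonal_mul]
      by_cases h : M.dmf b b' = 0
      · simp [h]
      · rw [M.dmf_hdeg b b' h, mul_comm]
    have h₂ : Matrix.diagonal (fun b => paritySign R (M.parity b)) * M.dchi
        = M.dchi * Matrix.diagonal (fun b => paritySign R (M.parity b)) := by
      ext b b'
      rw [Matrix.mul_diagonal, Matrix.diagonal_mul]
      by_cases h : M.dchi b b' = 0
      · simp [h]
      · rw [M.dchi_parity b b' h, mul_comm]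
    have h₃ : Matrix.diagonal (fun b => paritySign R (M.parity b))
          * Matrix.diagonal (fun b => degSign R (M.hdeg b))
        = Matrix.diagonal (fun b => degSign R (M.hdeg b))
          * Matrix.diagonal (fun b => paritySign R (M.parity b)) := by
      rw [Matrix.diagonal_mul_diagonal, Matrix.diagonal_mul_diagonal]
      simp only [mul_comm]
    change (M.dmf ⊗ₖ (1 : Matrix M'.ι M'.ι R)
        + Matrix.diagonal (fun b => paritySign R (M.parity b)) ⊗ₖ M'.dmf)
      * (M.dchi ⊗ₖ (1 : Matrix M'.ι M'.ι R)
        + Matrix.diagonal (fun b => degSign R (M.hdeg b)) ⊗ₖ M'.dchi) =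
      (M.dchi ⊗ₖ (1 : Matrix M'.ι M'.ι R)
        + Matrix.diagonal (fun b => degSign R (M.hdeg b)) ⊗ₖ M'.dchi)
      * (M.dmf ⊗ₖ (1 : Matrix M'.ι M'.ι R)
        + Matrix.diagonal (fun b => paritySign R (M.parity b)) ⊗ₖ M'.dmf)
    simp only [add_mul, mul_add, ← Matrix.mul_kronecker_mul, one_mul, mul_one]
    rw [M.dmf_dchi, M'.dmf_dchi, h₁, h₂, h₃]
    abel

/-- The unit of the tensor product: `R` in degree zero with zero differentials. -/
abbrev unit (R : Type) [CommRing R] : MFComplex R :=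
  single
    { ι := Unit
      parity := fun _ => 0
      adeg := fun _ => 0
      xdeg := fun _ => 0
      pot := 0
      dmf := 0
      dmf_odd := fun _ _ h => absurd rfl h
      dmf_sq := by simp }

end MFComplex

/-! ### The pieces of a marked braid diagram

All pieces are oriented upwards; `x₁`, `y₁` are the variables at the top left and top right,
`y₂`, `x₂` those at the bottom left and bottom right. The potential is `α x ^ (N + 1)`. -/

section Pieces

variable {R : Type} [CommRing R]

/-- The matrix factorization of an arc from a point marked `y` to a point marked `x`. -/
abbrev arcMF (N : ℕ) (α x y : R) : MatFac R :=
  MatFac.koszul N (α * powQuot (N + 1) x y) (x - y) 2 (2 * N)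

/-- The matrix factorization of the oriented resolution `Γ₀`: two vertical arcs. -/
abbrev gammaZero (N : ℕ) (α x₁ y₁ x₂ y₂ : R) : MatFac R :=
  (arcMF N α x₁ y₂).tensor (arcMF N α y₁ x₂)

/-- The matrix factorization of the singular resolution `Γ₁` (the wide edge contracted to a vertex
with two incoming and two outgoing edges): the Koszul matrix factorization with rows
`(α U₁, X₁ - Y₁)`, `(α U₂, X₂ - Y₂)`, shifted by `{0, -1}`, where `X₁, X₂` and `Y₁, Y₂` are the
elementary symmetric polynomials in `x₁, y₁` and in `x₂, y₂`. -/
abbrev gammaOne (N : ℕ) (α x₁ y₁ x₂ y₂ : R) : MatFac R :=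
  ((MatFac.koszul N (α * quotFst (N + 1) (x₁ + y₁) (x₁ * y₁) (x₂ + y₂))
      ((x₁ + y₁) - (x₂ + y₂)) 2 (2 * N)).tensor
    (MatFac.koszul N (α * quotSnd (N + 1) (x₁ * y₁) (x₂ + y₂) (x₂ * y₂))
      (x₁ * y₁ - x₂ * y₂) 2 (2 * N - 2))).shift 0 (-1)

/-- A `4 × 4` matrix, read as a matrix in the basis `1, f, e, e ⊗ f` of the tensor product of two
rank one Koszul matrix factorizations with bases `1, e` and `1, f`. -/
def onPairs (T : Matrix (Fin 4) (Fin 4) R) : Matrix (Fin 2 × Fin 2) (Fin 2 × Fin 2) R :=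
  T.submatrix (finProdFinEquiv (m := 2) (n := 2)) (finProdFinEquiv (m := 2) (n := 2))

/-- The matrix of `χ⁰ : Γ₀ → Γ₁`, a morphism of bidegree `(0, 1)`:
`1 ↦ (x₂ - x₁) - α κ e ⊗ f`, `f ↦ x₂ e - f`, `e ↦ f - x₁ e`, `e ⊗ f ↦ -e ⊗ f`, where `κ` is the
polynomial `quotChi`. -/
def chiZero (N : ℕ) (α x₁ y₁ x₂ y₂ : R) : Matrix (Fin 2 × Fin 2) (Fin 2 × Fin 2) R :=
  onPairs !![x₂ - x₁, 0, 0, 0;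
    0, -1, 1, 0;
    0, x₂, -x₁, 0;
    -(α * quotChi (N + 1) x₁ y₁ x₂ y₂), 0, 0, -1]

/-- The matrix of `χ¹ : Γ₁ → Γ₀`, a morphism of bidegree `(0, 1)`:
`1 ↦ 1 - α κ e ⊗ f`, `f ↦ x₂ e + x₁ f`, `e ↦ e + f`, `e ⊗ f ↦ (x₁ - x₂) e ⊗ f`. -/
def chiOne (N : ℕ) (α x₁ y₁ x₂ y₂ : R) : Matrix (Fin 2 × Fin 2) (Fin 2 × Fin 2) R :=
  onPairs !![1, 0, 0, 0;
    0, x₁, 1, 0;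
    0, x₂, 1, 0;
    -(α * quotChi (N + 1) x₁ y₁ x₂ y₂), 0, 0, x₁ - x₂]

theorem onPairs_mul (T T' : Matrix (Fin 4) (Fin 4) R) :
    onPairs T * onPairs T' = onPairs (T * T') :=
  Matrix.submatrix_mul_equiv T T' _ (finProdFinEquiv (m := 2) (n := 2)) _

/-- The two morphisms compose to the multiplication by `x₂ - x₁`. -/
theorem chiOne_mul_chiZero (N : ℕ) (α x₁ y₁ x₂ y₂ : R) :
    chiOne N α x₁ y₁ x₂ y₂ * chiZero N α x₁ y₁ x₂ y₂ = (x₂ - x₁) • 1 := by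
  rw [chiOne, chiZero, onPairs_mul]
  have h : (1 : Matrix (Fin 2 × Fin 2) (Fin 2 × Fin 2) R) = onPairs 1 :=
    (Matrix.submatrix_one_equiv _).symm
  rw [h]
  change onPairs _ = onPairs ((x₂ - x₁) • 1)
  congr 1
  ext b c
  fin_cases b <;> fin_cases c <;> simp [Matrix.mul_apply, Fin.sum_univ_four] <;> ring

theorem chiZero_mul_chiOne (N : ℕ) (α x₁ y₁ x₂ y₂ : R) :
    chiZero N α x₁ y₁ x₂ y₂ * chiOne N α x₁ y₁ x₂ y₂ = (x₂ - x₁) • 1 := by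
  rw [chiOne, chiZero, onPairs_mul]
  have h : (1 : Matrix (Fin 2 × Fin 2) (Fin 2 × Fin 2) R) = onPairs 1 :=
    (Matrix.submatrix_one_equiv _).symm
  rw [h]
  change onPairs _ = onPairs ((x₂ - x₁) • 1)
  congr 1
  ext b c
  fin_cases b <;> fin_cases c <;> simp [Matrix.mul_apply, Fin.sum_univ_four] <;> ring

theorem gammaZero_pot (N : ℕ) (α x₁ y₁ x₂ y₂ : R) : (gammaZero N α x₁ y₁ x₂ y₂).pot
    = α * (x₁ ^ (N + 1) + y₁ ^ (N + 1)) - α * (x₂ ^ (N + 1) + y₂ ^ (N + 1)) := by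
  have h₁ := powQuot_mul (N + 1) x₁ y₂
  have h₂ := powQuot_mul (N + 1) y₁ x₂
  simp only
  linear_combination α * h₁ + α * h₂

theorem gammaOne_pot (N : ℕ) (α x₁ y₁ x₂ y₂ : R) : (gammaOne N α x₁ y₁ x₂ y₂).pot
    = α * (x₁ ^ (N + 1) + y₁ ^ (N + 1)) - α * (x₂ ^ (N + 1) + y₂ ^ (N + 1)) := by
  have h₁ := quotFst_mul (N + 1) (x₁ + y₁) (x₁ * y₁) (x₂ + y₂)
  have h₂ := quotSnd_mul (N + 1) (x₁ * y₁) (x₂ + y₂) (x₂ * y₂)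
  rw [powSum_add_mul] at h₁ h₂
  simp only
  linear_combination α * h₁ + α * h₂

theorem koszul_tensor_dmf (N : ℕ) (u v u' v' : R) (p q p' q' : ℤ) :
    ((MatFac.koszul N u v p q).tensor (MatFac.koszul N u' v' p' q')).dmf
      = onPairs !![0, v', v, 0; u', 0, 0, v; u, 0, 0, -v'; 0, u, -u', 0] := by
  ext ⟨b, c⟩ ⟨b', c'⟩
  fin_cases b <;> fin_cases c <;> fin_cases b' <;> fin_cases c' <;>
    simp [paritySign, onPairs, finProdFinEquiv]

theorem chiZero_mul (N : ℕ) (α x₁ y₁ x₂ y₂ : R) :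
    chiZero N α x₁ y₁ x₂ y₂ * (gammaZero N α x₁ y₁ x₂ y₂).dmf
      = (gammaOne N α x₁ y₁ x₂ y₂).dmf * chiZero N α x₁ y₁ x₂ y₂ := by
  have h₁ := quotChi_mul (N + 1) x₁ y₁ x₂ y₂
  have h₂ := quotChi_mul' (N + 1) x₁ y₁ x₂ y₂
  have e₀ : (gammaZero N α x₁ y₁ x₂ y₂).dmf = _ := koszul_tensor_dmf N _ _ _ _ _ _ _ _
  have e₁ : (gammaOne N α x₁ y₁ x₂ y₂).dmf = _ := koszul_tensor_dmf N _ _ _ _ _ _ _ _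
  rw [e₀, e₁, chiZero, onPairs_mul, onPairs_mul]
  congr 1
  ext b c
  fin_cases b <;> fin_cases c <;> simp [Matrix.mul_apply, Fin.sum_univ_four] <;>
    first
    | ring1
    | linear_combination α * h₁
    | linear_combination -α * h₁
    | linear_combination α * h₂
    | linear_combination -α * h₂
    | linear_combination α * x₁ * h₂ + α * x₂ * h₁
    | linear_combination -α * x₁ * h₂ - α * x₂ * h₁
    | linear_combination α * h₁ + α * h₂

theorem chiOne_mul (N : ℕ) (α x₁ y₁ x₂ y₂ : R) :
    chiOne N α x₁ y₁ x₂ y₂ * (gammaOne N α x₁ y₁ x₂ y₂).dmf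
      = (gammaZero N α x₁ y₁ x₂ y₂).dmf * chiOne N α x₁ y₁ x₂ y₂ := by
  have h₁ := quotChi_mul (N + 1) x₁ y₁ x₂ y₂
  have h₂ := quotChi_mul' (N + 1) x₁ y₁ x₂ y₂
  have e₀ : (gammaOne N α x₁ y₁ x₂ y₂).dmf = _ := koszul_tensor_dmf N _ _ _ _ _ _ _ _
  have e₁ : (gammaZero N α x₁ y₁ x₂ y₂).dmf = _ := koszul_tensor_dmf N _ _ _ _ _ _ _ _
  rw [e₀, e₁, chiOne, onPairs_mul, onPairs_mul]
  congr 1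
  ext b c
  fin_cases b <;> fin_cases c <;> simp [Matrix.mul_apply, Fin.sum_univ_four] <;>
    first
    | ring1
    | linear_combination α * h₁
    | linear_combination -α * h₁
    | linear_combination α * h₂
    | linear_combination -α * h₂
    | linear_combination α * x₁ * h₂ + α * x₂ * h₁
    | linear_combination -α * x₁ * h₂ - α * x₂ * h₁
    | linear_combination α * h₁ + α * h₂
    | linear_combination -α * h₁ - α * h₂

theorem chiZero_parity (N : ℕ) (α x₁ y₁ x₂ y₂ : R) (b b' : Fin 2 × Fin 2)
    (h : chiZero N α x₁ y₁ x₂ y₂ b b' ≠ 0) :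
    (gammaOne N α x₁ y₁ x₂ y₂).parity b = (gammaZero N α x₁ y₁ x₂ y₂).parity b' := by
  revert h
  obtain ⟨b, c⟩ := b
  obtain ⟨b', c'⟩ := b'
  fin_cases b <;> fin_cases c <;> fin_cases b' <;> fin_cases c' <;>
    first
    | exact fun h => absurd rfl h
    | exact fun _ => rfl

theorem chiOne_parity (N : ℕ) (α x₁ y₁ x₂ y₂ : R) (b b' : Fin 2 × Fin 2)
    (h : chiOne N α x₁ y₁ x₂ y₂ b b' ≠ 0) :
    (gammaZero N α x₁ y₁ x₂ y₂).parity b = (gammaOne N α x₁ y₁ x₂ y₂).parity b' := by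
  revert h
  obtain ⟨b, c⟩ := b
  obtain ⟨b', c'⟩ := b'
  fin_cases b <;> fin_cases c <;> fin_cases b' <;> fin_cases c' <;>
    first
    | exact fun h => absurd rfl h
    | exact fun _ => rfl

/-- The complex of an arc. -/
abbrev arcComplex (N : ℕ) (α x y : R) : MFComplex R := MFComplex.single (arcMF N α x y)

/-- The complex `Γ₁⟨1⟩{1, N} --χ¹--> Γ₀⟨1⟩{1, N - 1}` of a positive crossing, in homological
degrees `-1` and `0`. -/
abbrev posCrossing (N : ℕ) (α x₁ y₁ x₂ y₂ : R) : MFComplex R :=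
  MFComplex.twoTerm ((gammaOne N α x₁ y₁ x₂ y₂).shiftOne 1 N)
    ((gammaZero N α x₁ y₁ x₂ y₂).shiftOne 1 (N - 1)) (-1) (chiOne N α x₁ y₁ x₂ y₂)
    ((gammaOne_pot N α x₁ y₁ x₂ y₂).trans (gammaZero_pot N α x₁ y₁ x₂ y₂).symm)
    (fun b b' h => congrArg (· + 1) (chiOne_parity N α x₁ y₁ x₂ y₂ b b' h))
    (chiOne_mul N α x₁ y₁ x₂ y₂)

/-- The complex `Γ₀⟨1⟩{-1, -N + 1} --χ⁰--> Γ₁⟨1⟩{-1, -N}` of a negative crossing, in homological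
degrees `0` and `1`. -/
abbrev negCrossing (N : ℕ) (α x₁ y₁ x₂ y₂ : R) : MFComplex R :=
  MFComplex.twoTerm ((gammaZero N α x₁ y₁ x₂ y₂).shiftOne (-1) (-N + 1))
    ((gammaOne N α x₁ y₁ x₂ y₂).shiftOne (-1) (-N)) 0 (chiZero N α x₁ y₁ x₂ y₂)
    ((gammaZero_pot N α x₁ y₁ x₂ y₂).trans (gammaOne_pot N α x₁ y₁ x₂ y₂).symm)
    (fun b b' h => congrArg (· + 1) (chiZero_parity N α x₁ y₁ x₂ y₂ b b' h))
    (chiZero_mul N α x₁ y₁ x₂ y₂)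

end Pieces

/-! ### Closed braids and their complexes -/

/-- The letters `σ_i` and `σ_i⁻¹` of braid words on `n` strands, where `i : Fin (n - 1)` counts
the generators from `0` and `σ_i` is a positive crossing of the strands `i` and `i + 1`. -/
inductive BraidLetter (n : ℕ)
  | sigma (i : Fin (n - 1))
  | sigmaInv (i : Fin (n - 1))

/-- A closed braid diagram: the closure of a braid word, whose letters are read upwards. -/
structure ClosedBraid where
  strands : ℕ
  word : List (BraidLetter strands)

namespace ClosedBraid

variable (B : ClosedBraid)

/-- The marked points of the diagram. Cut the closed braid into horizontal slices, one for each
letter and a last one without a crossing that closes up the braid. Mark every strand at the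
bottom of every slice: `(t, s)` is the mark of the strand at position `s` at the bottom of the
slice `t`. The top of the slice `t` is the bottom of the slice `t + 1`, cyclically. -/
abbrev Mark : Type := Fin (B.word.length + 1) × Fin B.strands

variable (N : ℕ) {A : Type} [CommRing A] (α : A)

/-- The pieces into which the marked points cut the slice `t`. -/
noncomputable def slicePieces (t : Fin (B.word.length + 1)) :
    List (MFComplex (MvPolynomial B.Mark A)) :=
  let bot : Fin B.strands → MvPolynomial B.Mark A := fun s => MvPolynomial.X (t, s)
  let top : Fin B.strands → MvPolynomial B.Mark A := fun s => MvPolynomial.X (t + 1, s)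
  let c : MvPolynomial B.Mark A := MvPolynomial.C α
  let arcs : List (Fin B.strands) → List (MFComplex (MvPolynomial B.Mark A)) :=
    List.map fun s => arcComplex N c (top s) (bot s)
  match B.word[t.val]? with
  | none => arcs (List.finRange B.strands)
  | some (BraidLetter.sigma i) =>
      let l : Fin B.strands := ⟨i.val, by omega⟩
      let r : Fin B.strands := ⟨i.val + 1, by omega⟩
      posCrossing N c (top l) (top r) (bot r) (bot l) ::
        arcs ((List.finRange B.strands).filter fun s => s ≠ l ∧ s ≠ r)
  | some (BraidLetter.sigmaInv i) =>
      let l : Fin B.strands := ⟨i.val, by omega⟩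
      let r : Fin B.strands := ⟨i.val + 1, by omega⟩
      negCrossing N c (top l) (top r) (bot r) (bot l) ::
        arcs ((List.finRange B.strands).filter fun s => s ≠ l ∧ s ≠ r)

/-- The complex of matrix factorizations of the closed braid for the potential `α x ^ (N + 1)`
over the base ring `A`: the tensor product of the complexes of all pieces over the ring of
polynomials over `A` in the marks, so that common end points are identified. -/
noncomputable def complex : MFComplex (MvPolynomial B.Mark A) :=
  ((List.finRange (B.word.length + 1)).flatMap (B.slicePieces N α)).foldr
    MFComplex.tensor (MFComplex.unit _)

theorem foldr_tensor_pot {R : Type} [CommRing R] (L : List (MFComplex R)) :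
    (L.foldr MFComplex.tensor (MFComplex.unit R)).pot = (L.map fun M => M.pot).sum := by
  induction L with
  | nil => rfl
  | cons M L ih => rw [List.foldr_cons, List.map_cons, List.sum_cons, ← ih]

theorem sum_arcs_pot {R : Type} [CommRing R] {n : ℕ} (c : R) (top bot : Fin n → R)
    (L : List (Fin n)) :
    ((L.map fun s => arcComplex N c (top s) (bot s)).map fun M => M.pot).sum
      = (L.map fun s => c * top s ^ (N + 1) - c * bot s ^ (N + 1)).sum := by
  rw [List.map_map]
  congr 1
  refine List.map_congr_left fun s _ => ?_
  have h := powQuot_mul (N + 1) (top s) (bot s)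
  simp only [Function.comp]
  linear_combination c * h

theorem sum_filter_ne {R : Type} [CommRing R] {n : ℕ} (f : Fin n → R) (l r : Fin n) (h : l ≠ r) :
    f l + f r + (((List.finRange n).filter fun s => s ≠ l ∧ s ≠ r).map f).sum = ∑ s, f s := by
  have h₁ : (((List.finRange n).filter fun s => s ≠ l ∧ s ≠ r).map f).sum
      = ∑ s ∈ Finset.univ.filter (fun s => s ≠ l ∧ s ≠ r), f s := by
    rw [Finset.sum_filter, ← List.sum_ofFn, List.ofFn_eq_map]
    induction List.finRange n with
    | nil => rfl
    | cons s L ih =>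
      by_cases hs : s ≠ l ∧ s ≠ r
      · rw [List.filter_cons_of_pos (by simpa using hs)]
        simp only [List.map_cons, List.sum_cons, ih, if_pos hs]
      · rw [List.filter_cons_of_neg (by simpa using hs)]
        simp only [List.map_cons, List.sum_cons, ih, if_neg hs, zero_add]
  have h₂ : Finset.univ.filter (fun s => ¬ (s ≠ l ∧ s ≠ r)) = {l, r} := by
    ext s
    simp only [Finset.mem_filter, Finset.mem_univ, true_and, Finset.mem_insert,
      Finset.mem_singleton]
    tauto
  rw [h₁, ← Finset.sum_pair h, ← h₂, add_comm, Finset.sum_filter_add_sum_filter_not]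

/-- The potential of a closed braid vanishes, so that `d_mf` is a differential. -/
theorem complex_pot : (B.complex N α).pot = 0 := by
  have key : ∀ t, ((B.slicePieces N α t).map fun M => M.pot).sum
      = ∑ s, (MvPolynomial.C α * MvPolynomial.X (t + 1, s) ^ (N + 1)
        - MvPolynomial.C α * MvPolynomial.X (t, s) ^ (N + 1)) := by
    intro t
    unfold slicePieces
    dsimp only
    split
    · rw [sum_arcs_pot, ← List.sum_ofFn, List.ofFn_eq_map]
    · rename_i i _
      rw [List.map_cons, List.sum_cons, sum_arcs_pot, ← sum_filter_ne _
        (⟨i.val, by omega⟩ : Fin B.strands) (⟨i.val + 1, by omega⟩ : Fin B.strands) (by simp)]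
      congr 1
      refine (gammaOne_pot N _ _ _ _ _).trans ?_
      ring
    · rename_i i _
      rw [List.map_cons, List.sum_cons, sum_arcs_pot, ← sum_filter_ne _
        (⟨i.val, by omega⟩ : Fin B.strands) (⟨i.val + 1, by omega⟩ : Fin B.strands) (by simp)]
      congr 1
      refine (gammaZero_pot N _ _ _ _ _).trans ?_
      ring
  have hsum : ∀ L : List (Fin (B.word.length + 1)),
      ((L.flatMap (B.slicePieces N α)).map fun M => M.pot).sum
        = (L.map fun t => ((B.slicePieces N α t).map fun M => M.pot).sum).sum := by
    intro L
    induction L with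
    | nil => rfl
    | cons t L ih =>
      rw [List.flatMap_cons, List.map_append, List.sum_append, ih, List.map_cons, List.sum_cons]
  rw [complex, foldr_tensor_pot, hsum]
  simp only [key]
  rw [← List.ofFn_eq_map, List.sum_ofFn]
  simp only [Finset.sum_sub_distrib]
  rw [sub_eq_zero]
  exact Equiv.sum_comp (Equiv.addRight (1 : Fin (B.word.length + 1)))
    (fun t => ∑ s, MvPolynomial.C α * (MvPolynomial.X (t, s) : MvPolynomial B.Mark A) ^ (N + 1))

end ClosedBraid

/-! ### Homology -/

section Homology

variable {A C : Type} [CommRing A] [AddCommGroup C] [Module A C]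

/-- The homology `ker f / im f` of a differential `f`. -/
abbrev HomologyOf (f : C →ₗ[A] C) : Type :=
  LinearMap.ker f ⧸ (LinearMap.range f).submoduleOf (LinearMap.ker f)

/-- The endomorphism of the homology of `f` induced by an endomorphism that commutes with `f`. -/
def homologyMap (f g : C →ₗ[A] C) (h : f ∘ₗ g = g ∘ₗ f) : HomologyOf f →ₗ[A] HomologyOf f :=
  Submodule.mapQ _ _
    (g.restrict (p := LinearMap.ker f) (q := LinearMap.ker f) fun z hz => by
      rw [LinearMap.mem_ker] at hz ⊢
      rw [← LinearMap.comp_apply, h, LinearMap.comp_apply, hz, map_zero])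
    (by
      rintro ⟨z, hz⟩ ⟨y, hy⟩
      refine ⟨g y, ?_⟩
      have hc : f (g y) = g (f y) := LinearMap.congr_fun h y
      exact hc.trans (congrArg g hy))

/-- The part of the homology of `f` that consists of the classes of the cycles in `P`. -/
def homologyPart (S : Type) [CommRing S] [Algebra S A] [Module S C] [IsScalarTower S A C]
    (f : C →ₗ[A] C) (P : Submodule S C) : Submodule S (HomologyOf f) :=
  (P.comap ((LinearMap.ker f).subtype.restrictScalars S)).map
    ((Submodule.mkQ ((LinearMap.range f).submoduleOf (LinearMap.ker f))).restrictScalars S)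

end Homology

namespace MFComplex

variable {V A : Type} [CommRing A] (M : MFComplex (MvPolynomial V A))

/-- The differential `d_mf`, as an `A`-linear map. -/
noncomputable def dmfMap : (M.ι → MvPolynomial V A) →ₗ[A] (M.ι → MvPolynomial V A) :=
  M.dmf.mulVecLin.restrictScalars A

/-- The differential `d_χ`, as an `A`-linear map. -/
noncomputable def dchiMap : (M.ι → MvPolynomial V A) →ₗ[A] (M.ι → MvPolynomial V A) :=
  M.dchi.mulVecLin.restrictScalars A

theorem dmfMap_comp_dchiMap : M.dmfMap ∘ₗ M.dchiMap = M.dchiMap ∘ₗ M.dmfMap := by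
  refine LinearMap.ext fun z => ?_
  change M.dmf.mulVec (M.dchi.mulVec z) = M.dchi.mulVec (M.dmf.mulVec z)
  rw [Matrix.mulVec_mulVec, Matrix.mulVec_mulVec, M.dmf_dchi]

/-- The differential that `d_χ` induces on the homology of `d_mf`. -/
noncomputable def dchiHom : HomologyOf M.dmfMap →ₗ[A] HomologyOf M.dmfMap :=
  homologyMap M.dmfMap M.dchiMap M.dmfMap_comp_dchiMap

/-- The homology `H(H(M, d_mf), d_χ)`. -/
abbrev TotalHomology : Type := HomologyOf M.dchiHom

/-- The elements of `ℤ/2`-degree `ε`, homological degree `i` and `x`-degree `k`, where every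
variable has `x`-degree `2`. -/
noncomputable def xPart (ε : ZMod 2) (i k : ℤ) : Submodule A (M.ι → MvPolynomial V A) where
  carrier := {z | ∀ b m, (z b).coeff m ≠ 0 →
    M.parity b = ε ∧ M.hdeg b = i ∧ M.xdeg b + 2 * (m.degree : ℤ) = k}
  zero_mem' b m h := absurd (by simp) h
  add_mem' {y z} hy hz b m h := by
    by_cases hb : (y b).coeff m = 0
    · refine hz b m fun hc => h ?_
      simp [hb, hc]
    · exact hy b m hb
  smul_mem' c z hz b m h := hz b m fun hc => h (by simp [hc])

/-- The homogeneous component `H^{ε,i,k}` of the homology; over `A = ℚ[a]` it is the direct sum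
`H^{ε,i,⋆,k}` over all `a`-degrees. -/
noncomputable def homologyXPart (ε : ZMod 2) (i k : ℤ) : Submodule A M.TotalHomology :=
  homologyPart A M.dchiHom (homologyPart A M.dmfMap (M.xPart ε i k))

end MFComplex

section ADegree

open Polynomial

/-- For a complex over `ℚ[a]`: the elements of `ℤ/2`-degree `ε`, homological degree `i`,
`a`-degree `j` and `x`-degree `k`, where `a` has `a`-degree `2`. -/
noncomputable def MFComplex.axPart {V : Type} (M : MFComplex (MvPolynomial V ℚ[X])) (ε : ZMod 2) (i j k : ℤ) :
    Submodule ℚ (M.ι → MvPolynomial V ℚ[X]) where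
  carrier := {z | ∀ b m e, ((z b).coeff m).coeff e ≠ 0 →
    M.parity b = ε ∧ M.hdeg b = i ∧ M.adeg b + 2 * (e : ℤ) = j ∧
      M.xdeg b + 2 * (m.degree : ℤ) = k}
  zero_mem' b m e h := absurd (by simp) h
  add_mem' {y z} hy hz b m e h := by
    by_cases hb : ((y b).coeff m).coeff e = 0
    · refine hz b m e fun hc => h ?_
      simp [hb, hc]
    · exact hy b m e hb
  smul_mem' c z hz b m e h := hz b m e fun hc => h (by simp [hc])

/-- The homogeneous component `H^{ε,i,j,k}` of the homology of a complex over `ℚ[a]`. -/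
noncomputable def MFComplex.homologyAXPart {V : Type} (M : MFComplex (MvPolynomial V ℚ[X])) (ε : ZMod 2)
    (i j k : ℤ) : Submodule ℚ M.TotalHomology :=
  homologyPart ℚ M.dchiHom (homologyPart ℚ M.dmfMap (M.axPart ε i j k))

/-- `𝓗_N^{ε,i,⋆,k}(B)`, from the potential `a x ^ (N + 1)` over `ℚ[a]`. -/
noncomputable abbrev transverseHomology (N : ℕ) (B : ClosedBraid) (ε : ZMod 2) (i k : ℤ) :
    Submodule ℚ[X] (B.complex N (X : ℚ[X])).TotalHomology :=
  (B.complex N (X : ℚ[X])).homologyXPart ε i k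

/-- The component of `𝓗_N^{ε,i,⋆,k}(B)` of `a`-degree `j`. -/
noncomputable def transverseHomologyADeg (N : ℕ) (B : ClosedBraid) (ε : ZMod 2) (i k j : ℤ) :
    Set (transverseHomology N B ε i k) :=
  {h | h.val ∈ (B.complex N (X : ℚ[X])).homologyAXPart ε i j k}

/-- The component `H_N^{ε,i,k}(B)` of the `sl(N)` Khovanov–Rozansky homology, from the potential
`x ^ (N + 1)` over `ℚ`. -/
noncomputable abbrev slHomology (N : ℕ) (B : ClosedBraid) (ε : ZMod 2) (i k : ℤ) :
    Submodule ℚ (B.complex N (1 : ℚ)).TotalHomology :=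
  (B.complex N (1 : ℚ)).homologyXPart ε i k

/-- The polynomials of degree `j` in the shifted graded module `ℚ[a]{s}`, where `deg a = 2`. -/
def shiftedDeg (s j : ℤ) : Set ℚ[X] := {f | ∀ e, f.coeff e ≠ 0 → 2 * (e : ℤ) + s = j}

/-- The module `⨁_p ℚ[a]{s_p} ⊕ ⨁_q ℚ[a]/(a ^ l_q){t_q}`. -/
abbrev ModelModule (m : ℕ) {n : ℕ} (l : Fin n → ℕ) : Type :=
  (Fin m → ℚ[X]) × ((q : Fin n) → ℚ[X] ⧸ Ideal.span {(X : ℚ[X]) ^ l q})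

/-- The elements of degree `j` of `⨁_p ℚ[a]{s_p} ⊕ ⨁_q ℚ[a]/(a ^ l_q){t_q}`. -/
def modelDeg {m n : ℕ} (s : Fin m → ℤ) (l : Fin n → ℕ) (t : Fin n → ℤ) (j : ℤ) :
    Set (ModelModule m l) :=
  {y | (∀ p, y.1 p ∈ shiftedDeg (s p) j) ∧
    ∀ q, ∃ f ∈ shiftedDeg (t q) j, Ideal.Quotient.mk _ f = y.2 q}

/-- `𝓗_N^{ε,i,⋆,k}(B) ≅ ⨁_p ℚ[a]{s_p} ⊕ ⨁_q ℚ[a]/(a ^ l_q){t_q}` as graded `ℚ[a]`-modules, with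
all `l_q` positive. -/
def IsDecomposition (N : ℕ) (B : ClosedBraid) (ε : ZMod 2) (i k : ℤ) {m n : ℕ}
    (s : Fin m → ℤ) (l : Fin n → ℕ) (t : Fin n → ℤ) : Prop :=
  (∀ q, 0 < l q) ∧
    ∃ e : transverseHomology N B ε i k ≃ₗ[ℚ[X]] ModelModule m l,
      ∀ j, e '' transverseHomologyADeg N B ε i k j = modelDeg s l t j

end ADegree

/-! Evaluation at a = 1 turns the complex over ℚ[a] into the complex over ℚ
(`ClosedBraid.nonempty_baseChange`), and on the chain modules it is the quotient by the
non-zero-divisor a - 1. Taking homology commutes with such a quotient once a - 1 is also injective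
on the homology: in the long exact sequence of 0 → C → C → C/(a - 1) → 0 the connecting map then
vanishes (`IsReduction.homology`). This injectivity is automatic for graded modules, because az = z
with z ≠ 0 would force nonzero components in infinitely many degrees
(`ProjGrading.IsShiftedByX.injective_X_sub_one`). Both differentials are homogeneous
(`ClosedBraid.isHomog_complex`), so the homology of d_mf is again graded, and the same argument
applies a second time to the differential induced by d_χ.

For a fixed ℤ/2-degree, homological degree and x-degree only finitely many monomials in the marks
occur, so the component of the chain module, and with it that of the homology, is finitely generated
over ℚ[a] (`MFComplex.finite_xDegree`). A homogeneous polynomial in a is a monomial, which makes the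
structure theory elementary: a homogeneous generating family whose annihilation orders are minimal
has only trivial relations (`exists_homogBasis`). Modulo a - 1 every torsion summand dies and every
free summand leaves one copy of ℚ, so the free rank is the dimension of the reduction
(`nonempty_reduction_equiv`).

Uniqueness holds because the number of generators with prescribed degree and order is the dimension
of a subquotient defined without reference to generators (`HomogBasis.card_eq_finrank`).

Gradings are encoded by projections because linear maps that commute with a differential up to a
shift descend to homology. Two gradings are carried along: one without the a-degree, with
projections linear over ℚ[a], and a refinement by the a-degree, with projections linear over ℚ only.
-/

/-! ### Gradings given by projections -/

/-- A grading of the module `C` by `G`, given by the projections to the homogeneous components. -/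
structure ProjGrading (S G C : Type) [CommRing S] [AddCommGroup C] [Module S C] where
  proj : G → C →ₗ[S] C
  proj_self : ∀ g z, proj g (proj g z) = proj g z
  proj_ne : ∀ g h z, g ≠ h → proj g (proj h z) = 0
  exists_sum : ∀ z, ∃ s : Finset G, ∑ g ∈ s, proj g z = z

namespace ProjGrading

section Basic

variable {S G C : Type} [CommRing S] [AddCommGroup C] [Module S C] (gr : ProjGrading S G C)

/-- The homogeneous component of degree `g`. -/
def part (g : G) : Submodule S C := LinearMap.range (gr.proj g)

theorem mem_part {g : G} {z : C} : z ∈ gr.part g ↔ gr.proj g z = z :=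
  ⟨by rintro ⟨w, rfl⟩; exact gr.proj_self g w, fun h => ⟨z, h⟩⟩

theorem proj_mem (g : G) (z : C) : gr.proj g z ∈ gr.part g := ⟨z, rfl⟩

theorem proj_of_mem_ne {g h : G} {z : C} (hz : z ∈ gr.part h) (hgh : g ≠ h) :
    gr.proj g z = 0 := by
  rw [← gr.mem_part.1 hz, gr.proj_ne g h z hgh]

theorem eq_zero_of_proj {z : C} (h : ∀ g, gr.proj g z = 0) : z = 0 := by
  obtain ⟨s, hs⟩ := gr.exists_sum z
  rw [← hs]
  exact Finset.sum_eq_zero fun g _ => h g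

/-- Projections annihilate all components of other degrees, so a degree outside a finite
decomposition of z contributes nothing. This finiteness is what excludes nonzero solutions of az =
z. -/
theorem finite_support (z : C) : {g | gr.proj g z ≠ 0}.Finite := by
  obtain ⟨s, hs⟩ := gr.exists_sum z
  refine s.finite_toSet.subset fun g hg => ?_
  by_contra hgs
  refine hg ?_
  rw [← hs, map_sum]
  exact Finset.sum_eq_zero fun h hh => gr.proj_ne g h z fun e => hgs (e ▸ hh)

end Basic

/-- The grading of a free module for which the elements of a basis are homogeneous. -/
noncomputable def ofBasis {S G C I : Type} [CommRing S] [AddCommGroup C] [Module S C]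
    [DecidableEq G] (β : Module.Basis I S C) (deg : I → G) : ProjGrading S G C where
  proj g := β.constr S fun i => if deg i = g then β i else 0
  proj_self g z := by
    rw [← LinearMap.comp_apply]
    refine LinearMap.congr_fun (β.ext fun i => ?_) z
    by_cases h : deg i = g <;> simp [h]
  proj_ne g h z hgh := by
    rw [← LinearMap.comp_apply, ← LinearMap.zero_apply (σ₁₂ := RingHom.id S) (M := C) z]
    refine LinearMap.congr_fun (β.ext fun i => ?_) z
    by_cases hi : deg i = h
    · simp [hi, hgh.symm]
    · simp [hi]
  exists_sum z := by
    refine ⟨(β.repr z).support.image deg, ?_⟩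
    conv_rhs => rw [← β.linearCombination_repr z, Finsupp.linearCombination_apply, Finsupp.sum]
    simp only [Module.Basis.constr_apply, Finsupp.sum]
    rw [Finset.sum_comm]
    refine Finset.sum_congr rfl fun i hi => ?_
    rw [← Finset.smul_sum, Finset.sum_ite_eq, if_pos (Finset.mem_image_of_mem _ hi)]

/-! ### Homogeneous components in coordinates -/

section OfBasis

variable {S G C I : Type} [CommRing S] [AddCommGroup C] [Module S C]
    [DecidableEq G] (β : Module.Basis I S C) (deg : I → G)

theorem ofBasis_repr (g : G) (z : C) (i : I) :
    β.repr ((ofBasis β deg).proj g z) i = if deg i = g then β.repr z i else 0 := by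
  by_cases h : deg i = g
  · rw [if_pos h]
    change (β.coord i ∘ₗ (ofBasis β deg).proj g) z = β.coord i z
    refine LinearMap.congr_fun (β.ext fun j => ?_) z
    by_cases hj : deg j = g
    · simp [ofBasis, hj]
    · have : j ≠ i := fun e => hj (e ▸ h)
      simp [ofBasis, hj, this]
  · rw [if_neg h]
    change (β.coord i ∘ₗ (ofBasis β deg).proj g) z = (0 : C →ₗ[S] S) z
    refine LinearMap.congr_fun (β.ext fun j => ?_) z
    by_cases hj : deg j = g
    · have : j ≠ i := fun e => h (e ▸ hj)
      simp [ofBasis, hj, this]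
    · simp [ofBasis, hj]

theorem mem_ofBasis_part (g : G) (z : C) :
    z ∈ (ofBasis β deg).part g ↔ ∀ i, β.repr z i ≠ 0 → deg i = g := by
  rw [mem_part]
  constructor
  · intro h i hi
    by_contra hd
    rw [← h, ofBasis_repr, if_neg hd] at hi
    exact hi rfl
  · intro h
    refine β.repr.injective (Finsupp.ext fun i => ?_)
    rw [ofBasis_repr]
    by_cases hi : β.repr z i = 0
    · simp [hi]
    · rw [if_pos (h i hi)]

/-- By linearity it is enough to test basis vectors. The image of one of degree g lies entirely in
degree g + δ; for any other degree, right cancellation keeps the image away from g + δ. -/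
theorem ofBasis_homogeneous [Add G] [IsRightCancelAdd G] (δ : G) (f : C →ₗ[S] C)
    (hf : ∀ i j, β.repr (f (β i)) j ≠ 0 → deg j = deg i + δ) (g : G) (z : C) :
    (ofBasis β deg).proj (g + δ) (f z) = f ((ofBasis β deg).proj g z) := by
  change ((ofBasis β deg).proj (g + δ) ∘ₗ f) z = (f ∘ₗ (ofBasis β deg).proj g) z
  refine LinearMap.congr_fun (β.ext fun i => ?_) z
  refine β.repr.injective (Finsupp.ext fun j => ?_)
  rw [LinearMap.comp_apply, ofBasis_repr, LinearMap.comp_apply]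
  by_cases hi : deg i = g
  · have : (ofBasis β deg).proj g (β i) = β i := by simp [ofBasis, hi]
    rw [this]
    by_cases hj : β.repr (f (β i)) j = 0
    · simp [hj]
    · rw [if_pos (by rw [hf i j hj, hi])]
  · have : (ofBasis β deg).proj g (β i) = 0 := by simp [ofBasis, hi]
    rw [this]
    by_cases hj : β.repr (f (β i)) j = 0
    · simp [hj]
    · rw [if_neg (by rw [hf i j hj]; exact fun e => hi (add_right_cancel e))]
      simp

/-- The component sits inside the span of the finitely many basis vectors of its degree. -/
theorem ofBasis_part_noetherian [IsNoetherianRing S] (g : G) (hfin : {i | deg i = g}.Finite) :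
    IsNoetherian S ((ofBasis β deg).part g) := by
  have hfg : (Submodule.span S (β '' {i | deg i = g})).FG :=
    Submodule.fg_span (hfin.image _)
  have := isNoetherian_of_fg_of_noetherian _ hfg
  refine isNoetherian_of_le (t := Submodule.span S (β '' {i | deg i = g})) fun z hz => ?_
  rw [mem_ofBasis_part] at hz
  rw [β.mem_span_image]
  exact fun i hi => hz i (Finsupp.mem_support_iff.1 hi)

end OfBasis

end ProjGrading

/-! ### Gradings of homology -/

section HomologyGrading

variable {A S C : Type} [CommRing A] [CommRing S] [AddCommGroup C] [Module A C]
  [Algebra S A] [Module S C] [IsScalarTower S A C]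

/-- The class of a cycle. -/
def homologyClass (f : C →ₗ[A] C) : LinearMap.ker f →ₗ[A] HomologyOf f := Submodule.mkQ _

theorem homologyClass_surjective (f : C →ₗ[A] C) : Function.Surjective (homologyClass f) :=
  Submodule.mkQ_surjective _

theorem homologyClass_eq_zero (f : C →ₗ[A] C) (z : LinearMap.ker f) :
    homologyClass f z = 0 ↔ ∃ y, f y = z.val := by
  rw [homologyClass, Submodule.mkQ_apply, Submodule.Quotient.mk_eq_zero]
  exact Iff.rfl

theorem mem_homologyPart (f : C →ₗ[A] C) (P : Submodule S C) (x : HomologyOf f) :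
    x ∈ homologyPart S f P ↔ ∃ z : LinearMap.ker f, z.val ∈ P ∧ homologyClass f z = x :=
  Iff.rfl

/-- The map on homology that is induced by a linear map over a smaller ring of scalars which
preserves cycles and boundaries. -/
def homologyLift {C' A' : Type} [CommRing A'] [AddCommGroup C'] [Module A' C'] [Module S C']
    [Algebra S A'] [IsScalarTower S A' C'] (f : C →ₗ[A] C) (f' : C' →ₗ[A'] C')
    (p : C →ₗ[S] C')
    (hk : ∀ z, f z = 0 → f' (p z) = 0) (hr : ∀ y, ∃ y', f' y' = p (f y)) :
    HomologyOf f →ₗ[S] HomologyOf f' :=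
  (Submodule.liftQ (((LinearMap.range f).submoduleOf (LinearMap.ker f)).restrictScalars S)
    ((homologyClass f').restrictScalars S ∘ₗ
      ({ toFun := fun z => ⟨p z.val, LinearMap.mem_ker.2 (hk z.val z.2)⟩
         map_add' := fun y z => Subtype.ext (map_add p y.val z.val)
         map_smul' := fun c z => Subtype.ext (map_smul p c z.val) } :
        LinearMap.ker f →ₗ[S] LinearMap.ker f'))
    (by
      rintro z ⟨y, hy⟩
      obtain ⟨y', hy'⟩ := hr y
      exact (homologyClass_eq_zero f' _).2 ⟨y', hy'.trans (congrArg p hy)⟩)) ∘ₗ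
    (Submodule.Quotient.restrictScalarsEquiv S
      ((LinearMap.range f).submoduleOf (LinearMap.ker f))).symm.toLinearMap

theorem homologyLift_class {C' A' : Type} [CommRing A'] [AddCommGroup C'] [Module A' C']
    [Module S C'] [Algebra S A'] [IsScalarTower S A' C'] (f : C →ₗ[A] C) (f' : C' →ₗ[A'] C')
    (p : C →ₗ[S] C')
    (hk : ∀ z, f z = 0 → f' (p z) = 0) (hr : ∀ y, ∃ y', f' y' = p (f y)) (z : LinearMap.ker f) :
    homologyLift f f' p hk hr (homologyClass f z) = homologyClass f' ⟨p z.val, hk z.val z.2⟩ :=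
  rfl

/-- The cycles lying in `P` embed into `P`, and the part of the homology is their image; the
noetherian property passes to submodules and then to quotients. -/
theorem homologyPart_noetherian [IsNoetherianRing S] (f : C →ₗ[A] C) (P : Submodule S C)
    [IsNoetherian S P] : IsNoetherian S (homologyPart S f P) := by
  have : IsNoetherian S (P.comap ((LinearMap.ker f).subtype.restrictScalars S)) := by
    let φ : P.comap ((LinearMap.ker f).subtype.restrictScalars S) →ₗ[S] P :=
      ((LinearMap.ker f).subtype.restrictScalars S).restrict fun z hz => hz
    refine isNoetherian_of_injective φ fun y z h => ?_
    have h' : (φ y).val = (φ z).val := by rw [h]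
    exact Subtype.ext (Subtype.ext h')
  unfold homologyPart
  infer_instance

namespace ProjGrading

variable {G : Type} [AddGroup G]

/-- The grading of the homology of a homogeneous differential. -/
def homology (gr : ProjGrading S G C) (f : C →ₗ[A] C) (δ : G)
    (hf : ∀ g z, gr.proj (g + δ) (f z) = f (gr.proj g z)) : ProjGrading S G (HomologyOf f) where
  proj g := homologyLift f f (gr.proj g)
    (fun z hz => by rw [← hf, hz, map_zero])
    -- The degree g component of the boundary f y is the boundary of the degree g - δ component of
    -- y; this is where subtraction of degrees is needed.
    (fun y => ⟨gr.proj (g - δ) y, by rw [← hf, sub_add_cancel]⟩)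
  proj_self g x := by
    obtain ⟨z, rfl⟩ := homologyClass_surjective f x
    exact congrArg (homologyClass f) (Subtype.ext (gr.proj_self g z.val))
  proj_ne g h x hgh := by
    obtain ⟨z, rfl⟩ := homologyClass_surjective f x
    exact (congrArg (homologyClass f) (Subtype.ext (gr.proj_ne g h z.val hgh))).trans (map_zero _)
  exists_sum x := by
    obtain ⟨z, rfl⟩ := homologyClass_surjective f x
    obtain ⟨s, hs⟩ := gr.exists_sum z.val
    refine ⟨s, ?_⟩
    simp only [homologyLift_class]
    rw [← map_sum]
    refine congrArg (homologyClass f) (Subtype.ext ?_)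
    exact (map_sum (LinearMap.ker f).subtype _ s).trans hs

variable (gr : ProjGrading S G C) (f : C →ₗ[A] C) (δ : G)
    (hf : ∀ g z, gr.proj (g + δ) (f z) = f (gr.proj g z))

omit [Algebra S A] [IsScalarTower S A C] in
theorem proj_mem_ker (hf : ∀ g z, gr.proj (g + δ) (f z) = f (gr.proj g z)) (g : G) (z : C)
    (hz : z ∈ LinearMap.ker f) : gr.proj g z ∈ LinearMap.ker f := by
  rw [LinearMap.mem_ker] at hz ⊢
  rw [← hf, hz, map_zero]

/-- Projecting a cycle that represents a homogeneous class gives a homogeneous cycle in the same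
class. This reconciles the components defined through representatives with those of the induced
grading. -/
theorem homologyPart_part (g : G) :
    homologyPart S f (gr.part g) = (gr.homology f δ hf).part g := by
  ext x
  rw [mem_homologyPart]
  constructor
  · rintro ⟨z, hz, rfl⟩
    rw [mem_part]
    exact congrArg (homologyClass f) (Subtype.ext (gr.mem_part.1 hz))
  · rintro ⟨x, rfl⟩
    obtain ⟨z, rfl⟩ := homologyClass_surjective f x
    exact ⟨⟨gr.proj g z, gr.proj_mem_ker f δ hf g z z.2⟩, gr.proj_mem g z, rfl⟩

/-- The second homology can be graded only because the map induced by d_χ on the first one is still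
homogeneous. -/
theorem homology_homogeneous (d : C →ₗ[A] C) (h : f ∘ₗ d = d ∘ₗ f) (δ' : G)
    (hd : ∀ g z, gr.proj (g + δ') (d z) = d (gr.proj g z)) (g : G) (x : HomologyOf f) :
    (gr.homology f δ hf).proj (g + δ') (homologyMap f d h x)
      = homologyMap f d h ((gr.homology f δ hf).proj g x) := by
  obtain ⟨z, rfl⟩ := homologyClass_surjective f x
  exact congrArg (homologyClass f) (Subtype.ext (hd g z.val))

end ProjGrading

end HomologyGrading

/-! ### Graded `ℚ[a]`-modules -/

section PolynomialModule

open Polynomial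

/-- The variable `a` has degree `τ`. -/
def ProjGrading.IsShiftedByX {G C : Type} [Add G] [AddCommGroup C] [Module ℚ[X] C] [Module ℚ C]
    (gr : ProjGrading ℚ G C) (τ : G) : Prop :=
  ∀ g z, gr.proj (g + τ) ((X : ℚ[X]) • z) = (X : ℚ[X]) • gr.proj g z

theorem ProjGrading.IsShiftedByX.homology {G C : Type} [AddGroup G] [AddCommGroup C]
    [Module ℚ[X] C] [Module ℚ C] [IsScalarTower ℚ ℚ[X] C] {gr : ProjGrading ℚ G C} {τ : G}
    (h : gr.IsShiftedByX τ) (f : C →ₗ[ℚ[X]] C) (δ : G)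
    (hf : ∀ g z, gr.proj (g + δ) (f z) = f (gr.proj g z)) :
    (gr.homology f δ hf).IsShiftedByX τ := by
  intro g x
  obtain ⟨z, rfl⟩ := homologyClass_surjective f x
  exact congrArg (homologyClass f) (Subtype.ext (h g z.val))

/-- On a graded module `a - 1` acts injectively. -/
theorem ProjGrading.IsShiftedByX.injective_X_sub_one {G C : Type} [AddGroup G]
    [AddCommGroup C] [Module ℚ[X] C] [Module ℚ C] {gr : ProjGrading ℚ G C} {τ : G}
    (h : gr.IsShiftedByX τ) (hτ : ∀ n : ℕ, n • τ = 0 → n = 0) (z : C)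
    (hz : (X - 1 : ℚ[X]) • z = 0) : z = 0 := by
  rw [sub_smul, one_smul, sub_eq_zero] at hz
  refine gr.eq_zero_of_proj fun g => ?_
  by_contra hg
  -- From az = z, the component of z in any degree is a times the component τ below it. Hence a
  -- nonzero component propagates downwards forever.
  have hstep : ∀ n : ℕ, gr.proj (g - n • τ) z ≠ 0 := by
    intro n
    induction n with
    | zero => simpa using hg
    | succ n ih =>
      intro h0
      refine ih ?_
      have := h (g - (n + 1) • τ) z
      rw [h0, smul_zero, hz] at this
      rw [← this]
      congr 2
      rw [succ_nsmul', sub_eq_add_neg, sub_eq_add_neg, add_assoc, neg_add_rev, add_assoc,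
        neg_add_cancel, add_zero]
  -- As τ has infinite order, these degrees are pairwise distinct, against the finiteness of the
  -- support.
  have hinj : Function.Injective fun n : ℕ => g - n • τ := by
    intro m n hmn
    simp only [sub_right_inj] at hmn
    rcases le_total m n with hle | hle
    · obtain ⟨d, rfl⟩ := Nat.exists_eq_add_of_le hle
      rw [add_nsmul, left_eq_add] at hmn
      rw [hτ d hmn, add_zero]
    · obtain ⟨d, rfl⟩ := Nat.exists_eq_add_of_le hle
      rw [add_nsmul, add_eq_left] at hmn
      rw [hτ d hmn, add_zero]
  exact Set.infinite_of_injective_forall_mem hinj hstep (gr.finite_support z)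

end PolynomialModule

/-! ### Setting `a = 1` -/

section Reduction

open Polynomial

/-- `ρ` exhibits `C'` as the reduction of `C` modulo `a - 1`, where `a - 1` acts injectively
on `C`. -/
structure IsReduction {C C' : Type} [AddCommGroup C] [Module ℚ[X] C] [Module ℚ C]
    [AddCommGroup C'] [Module ℚ C'] (ρ : C →ₗ[ℚ] C') : Prop where
  surj : Function.Surjective ρ
  map_smul_eq_zero : ∀ w, ρ ((X - 1 : ℚ[X]) • w) = 0
  exists_smul : ∀ z, ρ z = 0 → ∃ w, z = (X - 1 : ℚ[X]) • w
  injective : ∀ z : C, (X - 1 : ℚ[X]) • z = 0 → z = 0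

variable {C C' : Type} [AddCommGroup C] [Module ℚ[X] C] [Module ℚ C] [IsScalarTower ℚ ℚ[X] C]
    [AddCommGroup C'] [Module ℚ C'] {ρ : C →ₗ[ℚ] C'}

/-- The map between the homologies that is induced by a chain map `ρ`. -/
noncomputable def reductionMap (ρ : C →ₗ[ℚ] C') (d : C →ₗ[ℚ[X]] C) (d' : C' →ₗ[ℚ] C')
    (h : ∀ z, ρ (d z) = d' (ρ z)) : HomologyOf d →ₗ[ℚ] HomologyOf d' :=
  homologyLift d d' ρ (fun z hz => by rw [← h, hz, map_zero]) fun y => ⟨ρ y, (h y).symm⟩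

theorem reductionMap_comm (d g : C →ₗ[ℚ[X]] C) (d' g' : C' →ₗ[ℚ] C')
    (h : ∀ z, ρ (d z) = d' (ρ z)) (hg : ∀ z, ρ (g z) = g' (ρ z))
    (hc : d ∘ₗ g = g ∘ₗ d) (hc' : d' ∘ₗ g' = g' ∘ₗ d') (x : HomologyOf d) :
    reductionMap ρ d d' h (homologyMap d g hc x)
      = homologyMap d' g' hc' (reductionMap ρ d d' h x) := by
  obtain ⟨z, rfl⟩ := homologyClass_surjective d x
  exact congrArg (homologyClass d') (Subtype.ext (hg z.val))

theorem reductionMap_proj {G : Type} [AddGroup G] (gr : ProjGrading ℚ[X] G C)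
    (gr' : ProjGrading ℚ G C') (hgr : ∀ g z, ρ (gr.proj g z) = gr'.proj g (ρ z))
    (d : C →ₗ[ℚ[X]] C) (d' : C' →ₗ[ℚ] C') (h : ∀ z, ρ (d z) = d' (ρ z)) (δ : G)
    (hd : ∀ g z, gr.proj (g + δ) (d z) = d (gr.proj g z))
    (hd' : ∀ g z, gr'.proj (g + δ) (d' z) = d' (gr'.proj g z)) (g : G) (x : HomologyOf d) :
    reductionMap ρ d d' h ((gr.homology d δ hd).proj g x)
      = (gr'.homology d' δ hd').proj g (reductionMap ρ d d' h x) := by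
  obtain ⟨z, rfl⟩ := homologyClass_surjective d x
  exact congrArg (homologyClass d') (Subtype.ext (hgr g z.val))

-- Every element of the reduction lifts, so homogeneity over ℚ is inherited from ℚ[a] and no
-- separate count of degrees is needed.
omit [IsScalarTower ℚ ℚ[X] C] in
theorem IsReduction.homogeneous {G : Type} [Add G] (hρ : IsReduction ρ)
    (gr : ProjGrading ℚ[X] G C)
    (gr' : ProjGrading ℚ G C') (hgr : ∀ g z, ρ (gr.proj g z) = gr'.proj g (ρ z))
    (d : C →ₗ[ℚ[X]] C) (d' : C' →ₗ[ℚ] C') (h : ∀ z, ρ (d z) = d' (ρ z)) (δ : G)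
    (hd : ∀ g z, gr.proj (g + δ) (d z) = d (gr.proj g z)) (g : G) (z : C') :
    gr'.proj (g + δ) (d' z) = d' (gr'.proj g z) := by
  obtain ⟨w, rfl⟩ := hρ.surj z
  rw [← h, ← hgr, hd, h, hgr]

/-- Taking homology commutes with the reduction modulo `a - 1` if `a - 1` acts injectively on the
homology. -/
theorem IsReduction.homology (hρ : IsReduction ρ) (d : C →ₗ[ℚ[X]] C) (d' : C' →ₗ[ℚ] C')
    (hd : ∀ z, d (d z) = 0) (h : ∀ z, ρ (d z) = d' (ρ z))
    (hinj : ∀ x : HomologyOf d, (X - 1 : ℚ[X]) • x = 0 → x = 0) :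
    IsReduction (reductionMap ρ d d' h) where
  surj x' := by
    obtain ⟨z', rfl⟩ := homologyClass_surjective d' x'
    obtain ⟨z, hz⟩ := hρ.surj z'.val
    -- The lift z is a cycle only modulo a - 1, with d z = (a - 1) w. The class of w is the value of
    -- the connecting map; a - 1 kills it, so w = d v by injectivity, and z - (a - 1) v is a cycle
    -- with the same reduction.
    obtain ⟨w, hw⟩ := hρ.exists_smul (d z) (by rw [h, hz]; exact z'.2)
    have hdw : d w = 0 := hρ.injective _ (by rw [← map_smul, ← hw, hd])
    obtain ⟨v, hv⟩ := (homologyClass_eq_zero d ⟨w, hdw⟩).1 (hinj _ (by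
      rw [← map_smul]
      exact (homologyClass_eq_zero d _).2 ⟨z, hw⟩))
    refine ⟨homologyClass d ⟨z - (X - 1 : ℚ[X]) • v, ?_⟩, ?_⟩
    · rw [LinearMap.mem_ker, map_sub, map_smul, hv, hw, sub_self]
    · refine congrArg (homologyClass d') (Subtype.ext ?_)
      exact (map_sub ρ _ _).trans (by rw [hρ.map_smul_eq_zero, sub_zero, hz])
  map_smul_eq_zero x := by
    obtain ⟨z, rfl⟩ := homologyClass_surjective d x
    rw [← map_smul]
    refine (congrArg (homologyClass d') (Subtype.ext ?_)).trans (map_zero _)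
    exact hρ.map_smul_eq_zero z.val
  exists_smul x hx := by
    obtain ⟨z, rfl⟩ := homologyClass_surjective d x
    obtain ⟨y', hy'⟩ := (homologyClass_eq_zero d' _).1 hx
    obtain ⟨y, rfl⟩ := hρ.surj y'
    have hz : d z.val = 0 := z.2
    have hy : d' (ρ y) = ρ z.val := hy'
    -- Once a lifted boundary is subtracted, the representative reduces to zero and hence is (a - 1)
    -- w. Injectivity on chains makes w a cycle, so the class itself is divisible by a - 1.
    obtain ⟨w, hw⟩ := hρ.exists_smul (z.val - d y) (by rw [map_sub, h, hy, sub_self])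
    have hdw : d w = 0 := hρ.injective _ (by rw [← map_smul, ← hw, map_sub, hd, hz, sub_zero])
    refine ⟨homologyClass d ⟨w, hdw⟩, ?_⟩
    rw [← map_smul, ← sub_eq_zero, ← map_sub]
    refine (homologyClass_eq_zero d _).2 ⟨y, ?_⟩
    change d y = z.val - (X - 1 : ℚ[X]) • w
    rw [← hw, sub_sub_cancel]
  injective := hinj

/-- The components of the reduction are the reductions of the components. -/
theorem IsReduction.nonempty_equiv_part {G : Type} (hρ : IsReduction ρ)
    (gr : ProjGrading ℚ[X] G C)
    (gr' : ProjGrading ℚ G C') (hgr : ∀ g z, ρ (gr.proj g z) = gr'.proj g (ρ z)) (g : G) :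
    Nonempty (gr'.part g ≃ₗ[ℚ] (gr.part g ⧸
      (Ideal.span {(X - 1 : ℚ[X])} • (⊤ : Submodule ℚ[X] (gr.part g))))) := by
  have hmem : ∀ z : gr.part g, ρ z.val ∈ gr'.part g := fun z => by
    rw [gr'.mem_part, ← hgr, gr.mem_part.1 z.2]
  let I := Ideal.span {(X - 1 : ℚ[X])} • (⊤ : Submodule ℚ[X] (gr.part g))
  let φ : gr.part g →ₗ[ℚ] gr'.part g :=
    { toFun := fun z => ⟨ρ z.val, hmem z⟩
      map_add' := fun y z => Subtype.ext (map_add ρ y.val z.val)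
      map_smul' := fun c z => Subtype.ext (map_smul ρ c z.val) }
  have hφ : Function.Surjective φ := by
    rintro ⟨z', hz'⟩
    obtain ⟨z, rfl⟩ := hρ.surj z'
    exact ⟨⟨gr.proj g z, gr.proj_mem g z⟩,
      Subtype.ext ((hgr g z).trans (gr'.mem_part.1 hz'))⟩
  have hker : I.restrictScalars ℚ = LinearMap.ker φ := by
    ext z
    change z ∈ Ideal.span {(X - 1 : ℚ[X])} • (⊤ : Submodule ℚ[X] (gr.part g)) ↔ _
    rw [Submodule.ideal_span_singleton_smul,
      Submodule.mem_smul_pointwise_iff_exists]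
    constructor
    · rintro ⟨w, -, hw⟩
      refine Subtype.ext ?_
      rw [← hw]
      exact hρ.map_smul_eq_zero w.val
    · intro hz
      obtain ⟨w, hw⟩ := hρ.exists_smul z.val (congrArg Subtype.val hz)
      -- The quotient w need not be homogeneous. Its degree g component also works, because the
      -- projection is ℚ[a]-linear and fixes z.
      refine ⟨⟨gr.proj g w, gr.proj_mem g w⟩, trivial, Subtype.ext ?_⟩
      change (X - 1 : ℚ[X]) • gr.proj g w = z.val
      rw [← map_smul, ← hw, gr.mem_part.1 z.2]
  exact ⟨((Submodule.Quotient.restrictScalarsEquiv ℚ I).symm ≪≫ₗ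
    Submodule.quotEquivOfEq _ _ hker ≪≫ₗ φ.quotKerEquivOfSurjective hφ).symm⟩

end Reduction

/-! ### Homogeneous bases of graded `ℚ[a]`-modules -/

section GradedStructure

open Polynomial

/-- The order of `z`: the least `n` with `a ^ n z = 0`. -/
noncomputable def xOrder {H : Type} [AddCommGroup H] [Module ℚ[X] H] (z : H) : ℕ∞ :=
  sInf ((fun n : ℕ => (n : ℕ∞)) '' {n | (X ^ n : ℚ[X]) • z = 0})

/-! ### Annihilation by powers of a -/

section Order

variable {H : Type} [AddCommGroup H] [Module ℚ[X] H]

/-- The annihilating exponents are closed upwards, and a nonempty set attains its infimum. If no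
power of a kills z, the infimum of the empty set is `⊤`, so order `⊤` marks the elements that are
not a-torsion. -/
theorem xOrder_le_iff (z : H) (n : ℕ) : xOrder z ≤ n ↔ (X ^ n : ℚ[X]) • z = 0 := by
  constructor
  · intro h
    have hne : ((fun n : ℕ => (n : ℕ∞)) '' {n | (X ^ n : ℚ[X]) • z = 0}).Nonempty := by
      by_contra hne
      rw [Set.not_nonempty_iff_eq_empty] at hne
      rw [xOrder, hne, sInf_empty, top_le_iff] at h
      exact ENat.natCast_ne_top n h
    obtain ⟨m, hm, hmz⟩ := csInf_mem hne
    have hmn : m ≤ n := by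
      have : (m : ℕ∞) ≤ n := hmz.le.trans h
      exact_mod_cast this
    obtain ⟨k, rfl⟩ := Nat.exists_eq_add_of_le' hmn
    have hm' : (X ^ m : ℚ[X]) • z = 0 := hm
    rw [pow_add, mul_smul, hm', smul_zero]
  · exact fun h => sInf_le ⟨n, h, rfl⟩

theorem xOrder_le_of (z w : H) (h : ∀ n : ℕ, (X ^ n : ℚ[X]) • w = 0 → (X ^ n : ℚ[X]) • z = 0) :
    xOrder z ≤ xOrder w := by
  induction hw : xOrder w using ENat.recTopCoe with
  | top => exact le_top
  | coe n => exact (xOrder_le_iff z n).2 (h n ((xOrder_le_iff w n).1 hw.le))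

theorem xOrder_zero : xOrder (0 : H) = 0 := by
  rw [← nonpos_iff_eq_zero]
  exact (xOrder_le_iff 0 0).2 (smul_zero _)

theorem xOrder_eq_zero (z : H) : xOrder z = 0 ↔ z = 0 := by
  constructor
  · intro h
    have := (xOrder_le_iff z 0).1 (by rw [h]; exact le_refl _)
    rwa [pow_zero, one_smul] at this
  · rintro rfl
    exact xOrder_zero

theorem xOrder_smul_le (f : ℚ[X]) (z : H) : xOrder (f • z) ≤ xOrder z :=
  xOrder_le_of _ _ fun n h => by rw [smul_comm, h, smul_zero]

theorem xOrder_C_mul (c : ℚ) (hc : c ≠ 0) (f : ℚ[X]) (z : H) :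
    xOrder ((C c * f) • z) = xOrder (f • z) := by
  refine le_antisymm (by rw [mul_smul]; exact xOrder_smul_le _ _) ?_
  have : f • z = C c⁻¹ • ((C c * f) • z) := by
    rw [← mul_smul, ← mul_assoc, ← C_mul, inv_mul_cancel₀ hc, C_1, one_mul]
  rw [this]
  exact xOrder_smul_le _ _

/-- A power of a that kills both summands kills the sum. This ultrametric inequality makes `orderLE`
and `orderLT` closed under addition. -/
theorem xOrder_add_le (u v : H) : xOrder (u + v) ≤ max (xOrder u) (xOrder v) := by
  rcases le_total (xOrder u) (xOrder v) with h | h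
  · rw [max_eq_right h]
    refine xOrder_le_of _ _ fun n hn => ?_
    rw [smul_add, hn, (xOrder_le_iff u n).1 (h.trans ((xOrder_le_iff v n).2 hn)), add_zero]
  · rw [max_eq_left h]
    refine xOrder_le_of _ _ fun n hn => ?_
    rw [smul_add, hn, (xOrder_le_iff v n).1 (h.trans ((xOrder_le_iff u n).2 hn)), add_zero]

/-- Division by a raises the order by at most one, which explains the bound `o + 1` in
`decomposables`. -/
theorem xOrder_le_X_smul (z : H) : xOrder z ≤ xOrder ((X : ℚ[X]) • z) + 1 := by
  induction hw : xOrder ((X : ℚ[X]) • z) using ENat.recTopCoe with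
  | top => simp
  | coe n =>
    have := (xOrder_le_iff _ n).1 hw.le
    rw [← mul_smul, ← pow_succ] at this
    exact_mod_cast (xOrder_le_iff z (n + 1)).2 this

end Order

/-- The component of degree `j` of a polynomial in the shifted graded module `ℚ[a]{d}`. -/
noncomputable def degPart (d j : ℤ) (f : ℚ[X]) : ℚ[X] :=
  (ProjGrading.ofBasis (Polynomial.basisMonomials ℚ) (fun e : ℕ => 2 * (e : ℤ) + d)).proj j f

theorem degPart_coeff (d j : ℤ) (f : ℚ[X]) (e : ℕ) :
    (degPart d j f).coeff e = if 2 * (e : ℤ) + d = j then f.coeff e else 0 :=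
  ProjGrading.ofBasis_repr (Polynomial.basisMonomials ℚ) (fun e : ℕ => 2 * (e : ℤ) + d) j f e

theorem degPart_mem (d j : ℤ) (f : ℚ[X]) : degPart d j f ∈ shiftedDeg d j := by
  intro e he
  rw [degPart_coeff] at he
  by_contra h
  exact he (if_neg h)

theorem degPart_of_mem {d j : ℤ} {f : ℚ[X]} (hf : f ∈ shiftedDeg d j) : degPart d j f = f := by
  ext e
  rw [degPart_coeff]
  by_cases h : f.coeff e = 0
  · simp [h]
  · rw [if_pos (hf e h)]

/-- The equation 2e + d = j has at most one solution e, so only one coefficient can be nonzero. That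
homogeneous coefficients are monomials is what replaces the Euclidean algorithm below. -/
theorem eq_C_mul_X_pow_of_mem {d j : ℤ} {f : ℚ[X]} (hf : f ∈ shiftedDeg d j) (h0 : f ≠ 0) :
    ∃ (e : ℕ) (c : ℚ), 2 * (e : ℤ) + d = j ∧ c ≠ 0 ∧ f = C c * X ^ e := by
  obtain ⟨e, he⟩ : ∃ e, f.coeff e ≠ 0 := by
    by_contra! h
    exact h0 (Polynomial.ext h)
  refine ⟨e, f.coeff e, hf e he, he, Polynomial.ext fun e' => ?_⟩
  rw [coeff_C_mul_X_pow]
  split_ifs with h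
  · rw [h]
  · by_contra h'
    have h₁ := hf e he
    have h₂ := hf e' h'
    omega

variable {H : Type} [AddCommGroup H] [Module ℚ[X] H] [Module ℚ H] [IsScalarTower ℚ ℚ[X] H]
  (gr : ProjGrading ℚ ℤ H)

/-- Multiplication by a ^ n moves y into degree 2n + d, and both sides are additive in f. Thus the
homogeneous components of a relation between homogeneous elements are obtained by truncating its
coefficients. -/
theorem ProjGrading.proj_smul (hX : gr.IsShiftedByX 2) {d : ℤ} {y : H} (hy : y ∈ gr.part d)
    (j : ℤ) (f : ℚ[X]) : gr.proj j (f • y) = degPart d j f • y := by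
  have hpow : ∀ n : ℕ, (X ^ n : ℚ[X]) • y ∈ gr.part (2 * (n : ℤ) + d) := by
    intro n
    induction n with
    | zero => simpa using hy
    | succ n ih =>
      rw [gr.mem_part] at ih ⊢
      have := hX (2 * (n : ℤ) + d) ((X ^ n : ℚ[X]) • y)
      rw [ih, ← mul_smul, ← pow_succ'] at this
      rw [← this]
      congr 2
      push_cast
      ring
  induction f using Polynomial.induction_on' with
  | add f g hf hg => rw [add_smul, map_add, hf, hg, ← add_smul, degPart, degPart, ← map_add]; rfl
  | monomial n c =>
    have hm : (monomial n c : ℚ[X]) = c • X ^ n := by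
      rw [← C_mul_X_pow_eq_monomial, smul_eq_C_mul]
    have hmem : (monomial n c : ℚ[X]) ∈ shiftedDeg d (2 * (n : ℤ) + d) := by
      intro e he
      rw [coeff_monomial] at he
      have : n = e := by
        by_contra h
        exact he (if_neg h)
      rw [this]
    by_cases h : 2 * (n : ℤ) + d = j
    · rw [← h, degPart_of_mem hmem, hm, smul_assoc, map_smul, gr.mem_part.1 (hpow n)]
    · have h0 : degPart d j (monomial n c) = 0 := by
        ext e
        rw [degPart_coeff, coeff_zero]
        split_ifs with he
        · rw [coeff_monomial, if_neg]
          rintro rfl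
          exact h he
        · rfl
      rw [h0, zero_smul, hm, smul_assoc, map_smul,
        gr.proj_of_mem_ne (hpow n) (fun e => h e.symm), smul_zero]

theorem ProjGrading.smul_mem_part (hX : gr.IsShiftedByX 2) {d j : ℤ} {y : H}
    (hy : y ∈ gr.part d) {f : ℚ[X]} (hf : f ∈ shiftedDeg d j) : f • y ∈ gr.part j := by
  rw [gr.mem_part, gr.proj_smul hX hy, degPart_of_mem hf]

/-- The monomials of f move y into distinct degrees, so they must kill it one by one. Hence the
annihilator of y is generated by a power of a or is zero. -/
theorem ProjGrading.smul_eq_zero_iff (hX : gr.IsShiftedByX 2) {d : ℤ} {y : H}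
    (hy : y ∈ gr.part d) (f : ℚ[X]) :
    f • y = 0 ↔ ∀ e : ℕ, (e : ℕ∞) < xOrder y → f.coeff e = 0 := by
  constructor
  · intro h e he
    by_contra hc
    have h₁ := gr.proj_smul hX hy (2 * (e : ℤ) + d) f
    rw [h, map_zero] at h₁
    have h₂ : (degPart d (2 * (e : ℤ) + d) f).coeff e = f.coeff e := by
      rw [degPart_coeff, if_pos rfl]
    obtain ⟨e', c, he', hc', hf⟩ := eq_C_mul_X_pow_of_mem
      (degPart_mem d (2 * (e : ℤ) + d) f) (fun h0 => hc (by rw [← h₂, h0, coeff_zero]))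
    have : e' = e := by omega
    subst this
    rw [hf] at h₁
    have h₃ := xOrder_C_mul c hc' (X ^ e') y
    rw [← h₁, xOrder_zero, eq_comm, xOrder_eq_zero, ← xOrder_le_iff] at h₃
    exact absurd he h₃.not_gt
  · intro h
    rw [f.as_sum_support, Finset.sum_smul]
    refine Finset.sum_eq_zero fun e he => ?_
    rw [← C_mul_X_pow_eq_monomial, mul_smul, (xOrder_le_iff y e).1, smul_zero]
    by_contra hlt
    exact (mem_support_iff.1 he) (h e (not_le.1 hlt))

/-- A family of homogeneous elements that decomposes the module into a direct sum of cyclic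
submodules. -/
structure HomogBasis {ι : Type} [Fintype ι] (y : ι → H) (deg : ι → ℤ) : Prop where
  mem : ∀ i, y i ∈ gr.part (deg i)
  span : ∀ z, ∃ f : ι → ℚ[X], ∑ i, f i • y i = z
  indep : ∀ f : ι → ℚ[X], ∑ i, f i • y i = 0 → ∀ i, f i • y i = 0

-- Each of finitely many generators is the sum of its finitely many nonzero components, which can
-- replace it.
omit [IsScalarTower ℚ ℚ[X] H] in
theorem exists_homogeneous_generators [Module.Finite ℚ[X] H] :
    ∃ (n : ℕ) (y : Fin n → H) (deg : Fin n → ℤ), (∀ i, y i ∈ gr.part (deg i)) ∧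
      Submodule.span ℚ[X] (Set.range y) = ⊤ := by
  classical
  obtain ⟨s, hs⟩ := (Module.Finite.fg_top : (⊤ : Submodule ℚ[X] H).FG)
  -- Each component is stored together with its degree, so that the degree survives the enumeration
  -- by `Fin`.
  let T : Finset (H × ℤ) := s.biUnion fun z =>
    (gr.finite_support z).toFinset.image fun g => (gr.proj g z, g)
  let φ : T ≃ Fin T.card := T.equivFin
  refine ⟨T.card, fun i => (φ.symm i).val.1, fun i => (φ.symm i).val.2, ?_, ?_⟩
  · intro i
    beta_reduce
    obtain ⟨z, -, hz⟩ := Finset.mem_biUnion.1 (φ.symm i).2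
    obtain ⟨g, -, hg⟩ := Finset.mem_image.1 hz
    rw [← hg]
    exact gr.proj_mem g z
  · rw [eq_top_iff, ← hs, Submodule.span_le]
    intro z hz
    obtain ⟨t, ht⟩ := gr.exists_sum z
    rw [← ht]
    refine Submodule.sum_mem _ fun g _ => ?_
    by_cases hg : gr.proj g z = 0
    · rw [hg]
      exact Submodule.zero_mem _
    · refine Submodule.subset_span ?_
      have hT : (gr.proj g z, g) ∈ T := Finset.mem_biUnion.2
        ⟨z, hz, Finset.mem_image.2 ⟨g, by simpa using hg, rfl⟩⟩
      exact ⟨φ ⟨_, hT⟩, by simp⟩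

/-- Every finitely generated graded `ℚ[a]`-module is a direct sum of cyclic graded modules. -/
theorem exists_homogBasis [Module.Finite ℚ[X] H] (hX : gr.IsShiftedByX 2) :
    ∃ (n : ℕ) (y : Fin n → H) (deg : Fin n → ℤ), HomogBasis gr y deg := by
  classical
  obtain ⟨n, y₀, deg, hy₀, hspan₀⟩ := exists_homogeneous_generators gr
  let P : Set (Fin n → H) :=
    {y | (∀ i, y i ∈ gr.part (deg i)) ∧ Submodule.span ℚ[X] (Set.range y) = ⊤}
  -- The product order on finite tuples in ℕ∞ is well-founded. Among the generating families with
  -- the fixed degrees, zero entries allowed, one with a minimal tuple of orders is chosen; a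
  -- nontrivial relation would permit a smaller tuple.
  obtain ⟨o, ⟨y, ⟨hy, hspan⟩, rfl⟩, hmin⟩ := (wellFounded_lt (α := Fin n → ℕ∞)).has_min
    ((fun y i => xOrder (y i)) '' P) ⟨_, y₀, ⟨hy₀, hspan₀⟩, rfl⟩
  refine ⟨n, y, deg, hy, fun z => ?_, fun f hf => ?_⟩
  · have hz : z ∈ Submodule.span ℚ[X] (Set.range y) := by rw [hspan]; trivial
    exact (Submodule.mem_span_range_iff_exists_fun ℚ[X]).1 hz
  by_contra! hne
  obtain ⟨i₀, hi₀⟩ := hne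
  obtain ⟨j, hj⟩ : ∃ j, gr.proj j (f i₀ • y i₀) ≠ 0 := by
    by_contra! h
    exact hi₀ (gr.eq_zero_of_proj h)
  -- The part of the relation in degree j, chosen so that the term at i₀ remains nonzero.
  let g : Fin n → ℚ[X] := fun i => degPart (deg i) j (f i)
  have hg : ∑ i, g i • y i = 0 := by
    have := congrArg (gr.proj j) hf
    rw [map_sum, map_zero] at this
    rw [← this]
    exact Finset.sum_congr rfl fun i _ => (gr.proj_smul hX (hy i) j (f i)).symm
  rw [gr.proj_smul hX (hy i₀)] at hj
  let T := Finset.univ.filter fun i => g i • y i ≠ 0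
  -- All terms have total degree j, so a generator of maximal degree carries the least power of a.
  -- This power divides every coefficient that matters.
  obtain ⟨i, hiT, hi⟩ := T.exists_max_image deg ⟨i₀, by simpa [T] using hj⟩
  have hrep : ∀ k, ∃ (e : ℕ) (c : ℚ), k ∈ T → 2 * (e : ℤ) + deg k = j ∧ c ≠ 0 ∧
      g k = C c * X ^ e := by
    intro k
    by_cases hk : k ∈ T
    · obtain ⟨e, c, h⟩ := eq_C_mul_X_pow_of_mem (degPart_mem (deg k) j (f k))
        (fun h0 => (Finset.mem_filter.1 hk).2 (by simp only [g, h0, zero_smul]))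
      exact ⟨e, c, fun _ => h⟩
    · exact ⟨0, 0, fun h => absurd h hk⟩
  choose e c hec using hrep
  obtain ⟨hei, hci, hgi⟩ := hec i hiT
  -- The relation divided by a ^ e i. On `T` the subtraction of exponents is exact, and the
  -- coefficient at i becomes a nonzero constant.
  let h : Fin n → ℚ[X] := fun k => if k ∈ T then C (c k) * X ^ (e k - e i) else 0
  have hle : ∀ k ∈ T, e i ≤ e k := fun k hk => by
    have h₁ := (hec k hk).1
    have h₂ := hi k hk
    omega
  have hh : ∀ k, (X ^ e i * h k) • y k = g k • y k := by
    intro k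
    by_cases hk : k ∈ T
    · simp only [h, if_pos hk]
      rw [(hec k hk).2.2]
      congr 1
      rw [mul_left_comm, ← pow_add, Nat.add_sub_cancel' (hle k hk)]
    · simp only [h, if_neg hk]
      rw [mul_zero, zero_smul]
      by_contra hne
      exact hk (by simpa [T] using fun h0 => hne h0.symm)
  -- The replacement for y i: it has the same degree and a ^ e i kills it. As its coefficient at i
  -- is a unit, the exchange preserves the span.
  let w := ∑ k, h k • y k
  have hw0 : (X ^ e i : ℚ[X]) • w = 0 := by
    rw [Finset.smul_sum, ← hg]
    exact Finset.sum_congr rfl fun k _ => by rw [← mul_smul, hh]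
  have hw : w ∈ gr.part (deg i) := by
    refine Submodule.sum_mem _ fun k _ => gr.smul_mem_part hX (hy k) ?_
    intro e' he'
    by_cases hk : k ∈ T
    · simp only [h, if_pos hk, coeff_C_mul_X_pow] at he'
      have : e' = e k - e i := by
        by_contra h
        exact he' (if_neg h)
      have h₁ := (hec k hk).1
      have h₂ := hle k hk
      omega
    · simp only [h, if_neg hk, coeff_zero] at he'
      exact absurd rfl he'
  have hhi : h i = C (c i) := by simp only [h, if_pos hiT, Nat.sub_self, pow_zero, mul_one]
  let y' := Function.update y i w
  have hy' : ∀ k, k ≠ i → y' k = y k := fun k hk => Function.update_of_ne hk _ _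
  have hyi : y' i = w := Function.update_self _ _ _
  refine hmin (fun k => xOrder (y' k)) ⟨y', ⟨fun k => ?_, ?_⟩, rfl⟩ ?_
  · by_cases hk : k = i
    · rw [hk, hyi]
      exact hw
    · rw [hy' k hk]
      exact hy k
  · rw [eq_top_iff, ← hspan, Submodule.span_le]
    have hmem : ∀ k, y' k ∈ Submodule.span ℚ[X] (Set.range y') := fun k =>
      Submodule.subset_span ⟨k, rfl⟩
    have hmem' : ∀ k, k ≠ i → y k ∈ Submodule.span ℚ[X] (Set.range y') := fun k hk =>
      hy' k hk ▸ hmem k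
    rintro _ ⟨k, rfl⟩
    by_cases hk : k = i
    · subst hk
      have hsum : C (c k) • y k = w - ∑ l ∈ Finset.univ.erase k, h l • y l := by
        rw [← hhi, eq_sub_iff_add_eq, Finset.add_sum_erase _ (fun l => h l • y l) (Finset.mem_univ k)]
      have : y k = C (c k)⁻¹ • (C (c k) • y k) := by
        rw [← mul_smul, ← C_mul, inv_mul_cancel₀ hci, C_1, one_smul]
      rw [this, hsum]
      refine Submodule.smul_mem _ _ (Submodule.sub_mem _ (hyi ▸ hmem k) ?_)
      exact Submodule.sum_mem _ fun l hl =>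
        Submodule.smul_mem _ _ (hmem' l (Finset.ne_of_mem_erase hl))
    · exact hmem' k hk
  -- The power a ^ e i kills w but not y i, since the term at i of the relation was nonzero.
  · have hlt : xOrder (y' i) < xOrder (y i) := by
      rw [hyi]
      refine ((xOrder_le_iff w (e i)).2 hw0).trans_lt ?_
      rw [← not_le, xOrder_le_iff]
      intro h0
      refine (Finset.mem_filter.1 hiT).2 ?_
      rw [hgi, mul_smul, h0, smul_zero]
    rw [Pi.lt_def]
    refine ⟨fun k => ?_, i, hlt⟩
    by_cases hk : k = i
    · rw [hk]
      exact hlt.le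
    · simp only [hy' k hk, le_refl]

end GradedStructure

/-! ### Graded decompositions of graded `ℚ[a]`-modules -/

section GradedDecomposition

open Polynomial

variable {H : Type} [AddCommGroup H] [Module ℚ[X] H] [Module ℚ H] [IsScalarTower ℚ ℚ[X] H]
  {gr : ProjGrading ℚ ℤ H}

omit [Module ℚ H] [IsScalarTower ℚ ℚ[X] H] in
theorem xOrder_eq_of_iff (z : H) (l : ℕ) (h : ∀ n : ℕ, (X ^ n : ℚ[X]) • z = 0 ↔ l ≤ n) :
    xOrder z = l := by
  refine le_antisymm ((xOrder_le_iff z l).2 ((h l).2 le_rfl)) ?_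
  induction hz : xOrder z using ENat.recTopCoe with
  | top => exact le_top
  | coe n => exact_mod_cast (h n).1 ((xOrder_le_iff z n).1 hz.le)

omit [Module ℚ H] [IsScalarTower ℚ ℚ[X] H] in
theorem xOrder_eq_top_of (z : H) (h : ∀ n : ℕ, (X ^ n : ℚ[X]) • z ≠ 0) : xOrder z = ⊤ := by
  induction hz : xOrder z using ENat.recTopCoe with
  | top => rfl
  | coe n => exact absurd ((xOrder_le_iff z n).1 hz.le) (h n)

-- Vanishing generators contribute nothing to a sum, so coefficients may be extended by zero. This
-- discards generators of order 0 and leaves only positive torsion exponents.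
omit [IsScalarTower ℚ ℚ[X] H] in
theorem HomogBasis.reindex {ι κ : Type} [Fintype ι] [Fintype κ] {y : ι → H} {deg : ι → ℤ}
    (hb : HomogBasis gr y deg) (φ : κ → ι) (hφ : Function.Injective φ)
    (h0 : ∀ i, i ∉ Set.range φ → y i = 0) :
    HomogBasis gr (fun k => y (φ k)) (fun k => deg (φ k)) where
  mem k := hb.mem (φ k)
  span z := by
    obtain ⟨f, hf⟩ := hb.span z
    refine ⟨fun k => f (φ k), ?_⟩
    rw [← hf]
    exact Fintype.sum_of_injective φ hφ _ _ (fun i hi => by rw [h0 i hi, smul_zero]) fun _ => rfl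
  indep f hf k := by
    have hext : ∀ k, Function.extend φ f 0 (φ k) = f k := fun k => hφ.extend_apply f 0 k
    have := hb.indep (Function.extend φ f 0) (by
      rw [← hf]
      refine (Fintype.sum_of_injective φ hφ _ _ (fun i hi => by rw [h0 i hi, smul_zero])
        fun k => ?_).symm
      rw [hext]) (φ k)
    rwa [hext] at this

/-- The linear map from the model module that is given by the images of the generators. -/
noncomputable def modelMap {m n : ℕ} (l : Fin n → ℕ) (y₁ : Fin m → H) (y₂ : Fin n → H)
    (h : ∀ q, (X ^ l q : ℚ[X]) • y₂ q = 0) : ModelModule m l →ₗ[ℚ[X]] H :=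
  LinearMap.coprod (∑ p, LinearMap.toSpanSingleton ℚ[X] H (y₁ p) ∘ₗ LinearMap.proj p)
    (∑ q, (Submodule.liftQ (Ideal.span {(X : ℚ[X]) ^ l q})
      (LinearMap.toSpanSingleton ℚ[X] H (y₂ q)) (by
        rw [Ideal.span, Submodule.span_le, Set.singleton_subset_iff]
        exact h q)) ∘ₗ LinearMap.proj q)

omit [Module ℚ H] [IsScalarTower ℚ ℚ[X] H] in
theorem modelMap_apply {m n : ℕ} (l : Fin n → ℕ) (y₁ : Fin m → H) (y₂ : Fin n → H)
    (h : ∀ q, (X ^ l q : ℚ[X]) • y₂ q = 0) (f : Fin m → ℚ[X]) (g : Fin n → ℚ[X]) :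
    modelMap l y₁ y₂ h (f, fun q => Ideal.Quotient.mk _ (g q))
      = ∑ p, f p • y₁ p + ∑ q, g q • y₂ q := by
  rw [modelMap, LinearMap.coprod_apply, LinearMap.sum_apply, LinearMap.sum_apply]
  rfl

theorem ModelModule.exists_rep {m n : ℕ} (l : Fin n → ℕ) (x : ModelModule m l) :
    ∃ g : Fin n → ℚ[X], x = (x.1, fun q => Ideal.Quotient.mk _ (g q)) := by
  choose g hg using fun q => Ideal.Quotient.mk_surjective (x.2 q)
  exact ⟨g, Prod.ext rfl (funext fun q => (hg q).symm)⟩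

/-- A homogeneous basis gives an isomorphism with a model module. -/
theorem HomogBasis.exists_equiv (hX : gr.IsShiftedByX 2) {m n : ℕ} {s : Fin m → ℤ}
    {t : Fin n → ℤ} {l : Fin n → ℕ} {y₁ : Fin m → H} {y₂ : Fin n → H}
    (hb : HomogBasis gr (Sum.elim y₁ y₂) (Sum.elim s t)) (h₁ : ∀ p, xOrder (y₁ p) = ⊤)
    (h₂ : ∀ q, xOrder (y₂ q) = l q) :
    ∃ e : H ≃ₗ[ℚ[X]] ModelModule m l, ∀ j, e '' {h | h ∈ gr.part j} = modelDeg s l t j := by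
  let Φ := modelMap l y₁ y₂ fun q => (xOrder_le_iff _ _).1 (h₂ q).le
  have hΦ := modelMap_apply l y₁ y₂ fun q => (xOrder_le_iff _ _).1 (h₂ q).le
  have hinj : Function.Injective Φ := by
    refine (injective_iff_map_eq_zero Φ).2 fun x hx => ?_
    obtain ⟨g, hg⟩ := ModelModule.exists_rep l x
    rw [hg] at hx ⊢
    -- Independence makes every term vanish separately. The order of each generator then forces a
    -- free coordinate to be zero and a torsion coordinate to be divisible by a ^ l q.
    have hind := hb.indep (Sum.elim x.1 g) (by
      rw [Fintype.sum_sum_type]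
      exact (hΦ x.1 g).symm.trans hx)
    refine Prod.ext (funext fun p => ?_) (funext fun q => ?_)
    · have := (gr.smul_eq_zero_iff hX (hb.mem (Sum.inl p)) _).1 (hind (Sum.inl p))
      refine Polynomial.ext fun e => this e ?_
      simp [h₁]
    · have := (gr.smul_eq_zero_iff hX (hb.mem (Sum.inr q)) _).1 (hind (Sum.inr q))
      refine Ideal.Quotient.eq_zero_iff_mem.2 (Ideal.mem_span_singleton.2 ?_)
      rw [X_pow_dvd_iff]
      intro e he
      refine this e ?_
      simp only [Sum.elim_inr, h₂]
      exact_mod_cast he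
  have hsurj : Function.Surjective Φ := by
    intro z
    obtain ⟨f, hf⟩ := hb.span z
    rw [Fintype.sum_sum_type] at hf
    exact ⟨_, (hΦ (fun p => f (Sum.inl p)) (fun q => f (Sum.inr q))).trans hf⟩
  -- Projection to degree j truncates the coefficients of an expansion; injectivity of Φ turns
  -- invariance under it into homogeneity of the coordinates.
  have key : ∀ j x, Φ x ∈ gr.part j ↔ x ∈ modelDeg s l t j := by
    intro j x
    constructor
    · intro hx
      obtain ⟨g, hg⟩ := ModelModule.exists_rep l x
      have hx' := gr.mem_part.1 hx
      have hΦx : Φ x = ∑ p, x.1 p • y₁ p + ∑ q, g q • y₂ q :=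
        (congrArg Φ hg).trans (hΦ x.1 g)
      rw [hΦx, map_add, map_sum, map_sum] at hx'
      have e₁ : ∀ p, gr.proj j (x.1 p • y₁ p) = degPart (s p) j (x.1 p) • y₁ p := fun p =>
        gr.proj_smul hX (hb.mem (Sum.inl p)) j _
      have e₂ : ∀ q, gr.proj j (g q • y₂ q) = degPart (t q) j (g q) • y₂ q := fun q =>
        gr.proj_smul hX (hb.mem (Sum.inr q)) j _
      simp only [e₁, e₂] at hx'
      rw [← hΦx, ← hΦ (fun p => degPart (s p) j (x.1 p)) (fun q => degPart (t q) j (g q))] at hx'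
      have hx'' := hinj hx'
      refine ⟨fun p => ?_, fun q => ⟨degPart (t q) j (g q), degPart_mem _ _ _, ?_⟩⟩
      · rw [← hx'']
        exact degPart_mem _ _ _
      · rw [← hx'']
    · rintro ⟨hx₁, hx₂⟩
      choose g hg hgx using hx₂
      have hx : x = (x.1, fun q => Ideal.Quotient.mk _ (g q)) :=
        Prod.ext rfl (funext fun q => (hgx q).symm)
      have hΦx : Φ x = ∑ p, x.1 p • y₁ p + ∑ q, g q • y₂ q :=
        (congrArg Φ hx).trans (hΦ x.1 g)
      rw [hΦx]
      exact Submodule.add_mem _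
        (Submodule.sum_mem _ fun p _ => gr.smul_mem_part hX (hb.mem (Sum.inl p)) (hx₁ p))
        (Submodule.sum_mem _ fun q _ => gr.smul_mem_part hX (hb.mem (Sum.inr q)) (hg q))
  refine ⟨(LinearEquiv.ofBijective Φ ⟨hinj, hsurj⟩).symm, fun j => ?_⟩
  ext x
  rw [← key]
  constructor
  · rintro ⟨z, hz, rfl⟩
    have : Φ ((LinearEquiv.ofBijective Φ ⟨hinj, hsurj⟩).symm z) = z :=
      (LinearEquiv.ofBijective Φ ⟨hinj, hsurj⟩).apply_symm_apply z
    rw [this]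
    exact hz
  · intro hx
    exact ⟨Φ x, hx, (LinearEquiv.ofBijective Φ ⟨hinj, hsurj⟩).symm_apply_apply x⟩

/-- The structure theorem for finitely generated graded `ℚ[a]`-modules. -/
theorem exists_graded_decomposition [Module.Finite ℚ[X] H] (hX : gr.IsShiftedByX 2) :
    ∃ (m n : ℕ) (s : Fin m → ℤ) (l : Fin n → ℕ) (t : Fin n → ℤ), (∀ q, 0 < l q) ∧
      ∃ e : H ≃ₗ[ℚ[X]] ModelModule m l, ∀ j, e '' {h | h ∈ gr.part j} = modelDeg s l t j := by
  classical
  obtain ⟨n, y, deg, hb⟩ := exists_homogBasis gr hX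
  let F := {i // xOrder (y i) = ⊤}
  let T := {i // xOrder (y i) ≠ ⊤ ∧ xOrder (y i) ≠ 0}
  let φ₁ : Fin (Fintype.card F) ≃ F := (Fintype.equivFin F).symm
  let φ₂ : Fin (Fintype.card T) ≃ T := (Fintype.equivFin T).symm
  let φ : Fin (Fintype.card F) ⊕ Fin (Fintype.card T) → Fin n :=
    Sum.elim (fun p => (φ₁ p).val) fun q => (φ₂ q).val
  have hφ : Function.Injective φ := by
    rintro (p | p) (q | q) h
    · exact congrArg Sum.inl (φ₁.injective (Subtype.ext h))
    · have h' : (φ₁ p).val = (φ₂ q).val := h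
      exact absurd (h' ▸ (φ₁ p).2) (φ₂ q).2.1
    · have h' : (φ₂ p).val = (φ₁ q).val := h
      exact absurd (h' ▸ (φ₁ q).2) (φ₂ p).2.1
    · exact congrArg Sum.inr (φ₂.injective (Subtype.ext h))
  have hb' := hb.reindex φ hφ fun i hi => by
    by_contra h0
    by_cases htop : xOrder (y i) = ⊤
    · exact hi ⟨Sum.inl (φ₁.symm ⟨i, htop⟩), by simp [φ]⟩
    · exact hi ⟨Sum.inr (φ₂.symm ⟨i, htop, fun h => h0 ((xOrder_eq_zero _).1 h)⟩), by simp [φ]⟩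
  have hl : ∀ q, ∃ l : ℕ, xOrder (y (φ₂ q).val) = l := fun q =>
    ⟨_, (ENat.natCast_toNat (φ₂ q).2.1).symm⟩
  choose l hl using hl
  refine ⟨_, _, fun p => deg (φ₁ p).val, l, fun q => deg (φ₂ q).val, fun q => ?_,
    HomogBasis.exists_equiv hX (y₁ := fun p => y (φ₁ p).val) (y₂ := fun q => y (φ₂ q).val) ?_
      (fun p => (φ₁ p).2) hl⟩
  · refine Nat.pos_of_ne_zero fun h => (φ₂ q).2.2 ?_
    rw [hl, h, Nat.cast_zero]
  · convert hb' using 1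
    · funext i
      rcases i with i | i <;> rfl
    · funext i
      rcases i with i | i <;> rfl

omit [IsScalarTower ℚ ℚ[X] H] in
/-- An isomorphism with a model module gives a homogeneous basis. -/
theorem exists_homogBasis_of_equiv {m n : ℕ} {s : Fin m → ℤ} {t : Fin n → ℤ} {l : Fin n → ℕ}
    (e : H ≃ₗ[ℚ[X]] ModelModule m l) (he : ∀ j, e '' {h | h ∈ gr.part j} = modelDeg s l t j) :
    ∃ (y₁ : Fin m → H) (y₂ : Fin n → H), HomogBasis gr (Sum.elim y₁ y₂) (Sum.elim s t) ∧
      (∀ p, xOrder (y₁ p) = ⊤) ∧ ∀ q, xOrder (y₂ q) = l q := by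
  classical
  let v₁ : Fin m → ModelModule m l := fun p => (Pi.single p 1, 0)
  let v₂ : Fin n → ModelModule m l := fun q => (0, Pi.single q (Ideal.Quotient.mk _ 1))
  have hv₁ : ∀ (f : ℚ[X]) p, f • v₁ p = (Pi.single p f, 0) := by
    intro f p
    refine Prod.ext ?_ (smul_zero _)
    change f • Pi.single p (1 : ℚ[X]) = Pi.single p f
    rw [← Pi.single_smul, smul_eq_mul, mul_one]
  have hv₂ : ∀ (f : ℚ[X]) q, f • v₂ q = (0, Pi.single q (Ideal.Quotient.mk _ f)) := by
    intro f q
    refine Prod.ext (smul_zero _) ?_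
    change f • (Pi.single q (Ideal.Quotient.mk _ 1) :
      (q : Fin n) → ℚ[X] ⧸ Ideal.span {(X : ℚ[X]) ^ l q}) = _
    rw [← Pi.single_smul]
    congr 1
    change Ideal.Quotient.mk (Ideal.span {(X : ℚ[X]) ^ l q}) (f * 1) = _
    rw [mul_one]
  have hsum : ∀ (f : Fin m ⊕ Fin n → ℚ[X]),
      ∑ i, f i • Sum.elim (fun p => e.symm (v₁ p)) (fun q => e.symm (v₂ q)) i
        = e.symm (fun p => f (Sum.inl p), fun q => Ideal.Quotient.mk _ (f (Sum.inr q))) := by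
    intro f
    rw [Fintype.sum_sum_type]
    simp only [Sum.elim_inl, Sum.elim_inr, ← map_smul, ← map_sum, ← map_add]
    congr 1
    simp only [hv₁, hv₂]
    refine Prod.ext ?_ ?_
    · rw [Prod.fst_add, Prod.fst_sum, Prod.fst_sum]
      simp only [Finset.sum_const_zero, add_zero]
      exact Finset.univ_sum_single _
    · rw [Prod.snd_add, Prod.snd_sum, Prod.snd_sum]
      simp only [Finset.sum_const_zero, zero_add]
      exact Finset.univ_sum_single _
  have hmem : ∀ j x, x ∈ modelDeg s l t j → e.symm x ∈ gr.part j := by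
    intro j x hx
    rw [← he] at hx
    obtain ⟨z, hz, rfl⟩ := hx
    rw [e.symm_apply_apply]
    exact hz
  have h0 : ∀ d j, (0 : ℚ[X]) ∈ shiftedDeg d j := fun d j e he => absurd (coeff_zero e) he
  have h1 : ∀ d, (1 : ℚ[X]) ∈ shiftedDeg d d := by
    intro d e he
    rw [coeff_one] at he
    have : e = 0 := by
      by_contra h
      exact he (if_neg h)
    simp [this]
  refine ⟨fun p => e.symm (v₁ p), fun q => e.symm (v₂ q), ⟨?_, ?_, ?_⟩, ?_, ?_⟩
  · rintro (p | q)
    · refine hmem _ _ ⟨fun p' => ?_, fun q => ⟨0, h0 _ _, map_zero _⟩⟩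
      by_cases hp : p' = p
      · subst hp
        simp only [v₁, Pi.single_eq_same, Sum.elim_inl]
        exact h1 _
      · simp only [v₁, Pi.single_eq_of_ne hp]
        exact h0 _ _
    · refine hmem _ _ ⟨fun p => h0 _ _, fun q' => ?_⟩
      by_cases hq : q' = q
      · subst hq
        exact ⟨1, h1 _, by simp only [v₂, Pi.single_eq_same]⟩
      · exact ⟨0, h0 _ _, by simp only [v₂, Pi.single_eq_of_ne hq, map_zero]⟩
  · intro z
    obtain ⟨g, hg⟩ := ModelModule.exists_rep l (e z)
    refine ⟨Sum.elim (e z).1 g, ?_⟩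
    rw [hsum]
    exact (congrArg e.symm hg.symm).trans (e.symm_apply_apply z)
  · intro f hf i
    rw [hsum, map_eq_zero_iff _ e.symm.injective, Prod.ext_iff] at hf
    rcases i with p | q
    · have : f (Sum.inl p) = 0 := congrFun hf.1 p
      rw [this, zero_smul]
    · have : Ideal.Quotient.mk _ (f (Sum.inr q)) = 0 := congrFun hf.2 q
      rw [Sum.elim_inr, ← map_smul, hv₂, this, Pi.single_zero]
      exact map_zero _
  · intro p
    refine xOrder_eq_top_of _ fun k hk => ?_
    rw [← map_smul, map_eq_zero_iff _ e.symm.injective, hv₁] at hk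
    have := congrFun (congrArg Prod.fst hk) p
    simp at this
  · intro q
    refine xOrder_eq_of_iff _ _ fun k => ?_
    rw [← map_smul, map_eq_zero_iff _ e.symm.injective, hv₂]
    have h₁ : ((0, Pi.single q (Ideal.Quotient.mk _ (X ^ k))) : ModelModule m l) = 0
        ↔ Ideal.Quotient.mk (Ideal.span {(X : ℚ[X]) ^ l q}) (X ^ k) = 0 := by
      rw [Prod.ext_iff]
      simp
    rw [h₁, Ideal.Quotient.eq_zero_iff_mem, Ideal.mem_span_singleton]
    exact pow_dvd_pow_iff X_ne_zero not_isUnit_X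

/-- The reduction modulo `a - 1` only sees the free part. -/
theorem nonempty_reduction_equiv {m n : ℕ} {l : Fin n → ℕ} (e : H ≃ₗ[ℚ[X]] ModelModule m l) :
    Nonempty ((H ⧸ (Ideal.span {(X - 1 : ℚ[X])} • (⊤ : Submodule ℚ[X] H)))
      ≃ₗ[ℚ] (Fin m → ℚ)) := by
  let I := Ideal.span {(X - 1 : ℚ[X])} • (⊤ : Submodule ℚ[X] H)
  -- The free coordinates are evaluated at a = 1 and the torsion coordinates are forgotten.
  let ψ : H →ₗ[ℚ] (Fin m → ℚ) :=
    { toFun := fun z p => ((e z).1 p).eval 1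
      map_add' := fun y z => funext fun p => by simp
      map_smul' := fun c z => funext fun p => by
        rw [← algebraMap_smul ℚ[X] c z, map_smul]
        simp }
  have hψ : Function.Surjective ψ := fun c =>
    ⟨e.symm (fun p => C (c p), 0), funext fun p => by simp [ψ]⟩
  have hker : I.restrictScalars ℚ = LinearMap.ker ψ := by
    ext z
    change z ∈ Ideal.span {(X - 1 : ℚ[X])} • (⊤ : Submodule ℚ[X] H) ↔ _
    rw [Submodule.ideal_span_singleton_smul, Submodule.mem_smul_pointwise_iff_exists]
    constructor
    · rintro ⟨w, -, rfl⟩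
      exact funext fun p => by simp [ψ]
    · intro hz
      have h₁ : ∀ p, ∃ f, (e z).1 p = (X - 1) * f := fun p => by
        have : ((e z).1 p).IsRoot 1 := congrFun hz p
        rwa [← dvd_iff_isRoot, C_1] at this
      choose f hf using h₁
      have h₂ : ∀ q, ∃ g : ℚ[X] ⧸ Ideal.span {(X : ℚ[X]) ^ l q},
          (e z).2 q = (X - 1 : ℚ[X]) • g := fun q => by
        obtain ⟨h, hh⟩ : (X - 1 : ℚ[X]) ∣ X ^ l q - 1 := sub_one_dvd_pow_sub_one X (l q)
        obtain ⟨g, hg⟩ := Ideal.Quotient.mk_surjective ((e z).2 q)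
        -- From (a - 1) h = a ^ l - 1 it follows that -h is the inverse of a - 1 modulo a ^ l, so
        -- torsion is divisible by a - 1.
        refine ⟨Ideal.Quotient.mk _ (-h * g), ?_⟩
        rw [← hg]
        change _ = Ideal.Quotient.mk (Ideal.span {(X : ℚ[X]) ^ l q}) ((X - 1) * (-h * g))
        rw [Ideal.Quotient.eq, Ideal.mem_span_singleton]
        exact ⟨g, by linear_combination -g * hh⟩
      choose g hg using h₂
      refine ⟨e.symm (f, g), trivial, e.injective ?_⟩
      rw [map_smul, e.apply_symm_apply]
      exact Prod.ext (funext fun p => (hf p).symm) (funext fun q => (hg q).symm)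
  exact ⟨(Submodule.Quotient.restrictScalarsEquiv ℚ I).symm ≪≫ₗ
    Submodule.quotEquivOfEq _ _ hker ≪≫ₗ ψ.quotKerEquivOfSurjective hψ⟩

end GradedDecomposition

/-! ### Uniqueness of graded decompositions -/

section GradedUniqueness

open Polynomial

variable {H : Type} [AddCommGroup H] [Module ℚ[X] H] [Module ℚ H] [IsScalarTower ℚ ℚ[X] H]

theorem xOrder_rat_smul_le (c : ℚ) (z : H) : xOrder (c • z) ≤ xOrder z := by
  rw [← algebraMap_smul ℚ[X] c z]
  exact xOrder_smul_le _ _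

variable (H) in
/-- The elements of order at most `o`. -/
def orderLE (o : ℕ∞) : Submodule ℚ H where
  carrier := {z | xOrder z ≤ o}
  zero_mem' := by simp [xOrder_zero]
  add_mem' {u v} hu hv := (xOrder_add_le u v).trans (max_le hu hv)
  smul_mem' c z hz := (xOrder_rat_smul_le c z).trans hz

variable (H) in
/-- The elements of order less than `o`. -/
def orderLT (o : ℕ∞) (ho : 0 < o) : Submodule ℚ H where
  carrier := {z | xOrder z < o}
  zero_mem' := by simpa [xOrder_zero] using ho
  add_mem' {u v} hu hv := (xOrder_add_le u v).trans_lt (max_lt hu hv)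
  smul_mem' c z hz := (xOrder_rat_smul_le c z).trans_lt hz

variable (gr : ProjGrading ℚ ℤ H)

/-- The elements of degree `d` and order at most `o` that are sums of an element of smaller order
and of a multiple by `a` of an element of order at most `o + 1`. -/
noncomputable def decomposables (d : ℤ) (o : ℕ∞) (ho : 0 < o) : Submodule ℚ H :=
  (gr.part d ⊓ orderLT H o ho) ⊔
    (gr.part (d - 2) ⊓ orderLE H (o + 1)).map
      ((LinearMap.lsmul ℚ[X] H (X : ℚ[X])).restrictScalars ℚ)

variable {gr} {ι : Type} [Fintype ι] {y : ι → H} {deg : ι → ℤ}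

theorem HomogBasis.exists_expansion (hb : HomogBasis gr y deg) (hX : gr.IsShiftedByX 2) {d : ℤ}
    {z : H} (hz : z ∈ gr.part d) :
    ∃ c : ι → ℚ[X], (∀ i, c i ∈ shiftedDeg (deg i) d) ∧ ∑ i, c i • y i = z := by
  obtain ⟨f, hf⟩ := hb.span z
  refine ⟨fun i => degPart (deg i) d (f i), fun i => degPart_mem _ _ _, ?_⟩
  rw [← gr.mem_part.1 hz, ← hf, map_sum]
  exact Finset.sum_congr rfl fun i _ => (gr.proj_smul hX (hb.mem i) d (f i)).symm

-- A power of a that kills the sum kills every term, by independence.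
omit [IsScalarTower ℚ ℚ[X] H] in
theorem HomogBasis.xOrder_term_le (hb : HomogBasis gr y deg) (c : ι → ℚ[X]) (i : ι) :
    xOrder (c i • y i) ≤ xOrder (∑ i, c i • y i) := by
  refine xOrder_le_of _ _ fun n hn => ?_
  rw [Finset.smul_sum] at hn
  simp only [← mul_smul] at hn ⊢
  exact hb.indep (fun i => X ^ n * c i) hn i

/-- The number of generators of degree `d` and order `o` in a homogeneous basis. -/
theorem HomogBasis.card_eq_finrank (hb : HomogBasis gr y deg) (hX : gr.IsShiftedByX 2) (d : ℤ)
    (o : ℕ∞) (ho : 0 < o) :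
    Nat.card {i // deg i = d ∧ xOrder (y i) = o} = Module.finrank ℚ
      ((gr.part d ⊓ orderLE H o).map (decomposables gr d o ho).mkQ) := by
  classical
  let S := {i // deg i = d ∧ xOrder (y i) = o}
  -- The generators of degree d and order o turn out to be a basis of the elements of degree d and
  -- order at most o modulo `decomposables`. The latter space depends on the graded module alone.
  let Ψ₀ : (S → ℚ) →ₗ[ℚ] H := Fintype.linearCombination ℚ fun i : S => y i.val
  let Ψ := (decomposables gr d o ho).mkQ ∘ₗ Ψ₀
  let V : (S → ℚ) → ι → ℚ[X] := fun v i => if h : deg i = d ∧ xOrder (y i) = o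
    then C (v ⟨i, h⟩) else 0
  have hV : ∀ v, Ψ₀ v = ∑ i, V v i • y i := by
    intro v
    rw [Fintype.linearCombination_apply]
    refine Fintype.sum_of_injective (fun i : S => i.val) Subtype.val_injective _ _ ?_ ?_
    · intro i hi
      have : ¬ (deg i = d ∧ xOrder (y i) = o) := fun h => hi ⟨⟨i, h⟩, rfl⟩
      simp only [V, dif_neg this, zero_smul]
    · intro i
      simp only [V, dif_pos i.2]
      exact (algebraMap_smul ℚ[X] (v i) (y i.val)).symm
  have hinj : Function.Injective Ψ := by
    refine (injective_iff_map_eq_zero Ψ).2 fun v hv => ?_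
    rw [LinearMap.comp_apply, Submodule.mkQ_apply, Submodule.Quotient.mk_eq_zero, decomposables,
      Submodule.mem_sup] at hv
    obtain ⟨u, ⟨hu, hu'⟩, _, ⟨w, ⟨hw, -⟩, rfl⟩, huw⟩ := hv
    obtain ⟨a, ha, rfl⟩ := hb.exists_expansion hX hu
    obtain ⟨b, hb', rfl⟩ := hb.exists_expansion hX hw
    funext i
    by_contra hvi
    -- The element w has degree d - 2, below the degree d of this generator, so it cannot involve
    -- it.
    have hb0 : b i.val = 0 := by
      by_contra h0
      obtain ⟨e, -, he, -⟩ := eq_C_mul_X_pow_of_mem (hb' i.val) h0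
      have := i.2.1
      omega
    have hrel := hb.indep (fun j => V v j - (a j + X * b j)) (by
      simp only [sub_smul, add_smul, Finset.sum_sub_distrib, Finset.sum_add_distrib, mul_smul]
      rw [← hV, ← huw, ← Finset.smul_sum]
      exact sub_self _) i.val
    rw [hb0, mul_zero, add_zero, sub_smul, sub_eq_zero] at hrel
    simp only [V, dif_pos i.2] at hrel
    -- The i-th term on the left has order exactly o, while on the right it is a term of an element
    -- of order less than o.
    have h₁ := xOrder_C_mul (v i) hvi 1 (y i.val)
    rw [mul_one, one_smul, hrel, i.2.2] at h₁
    have h₂ := hb.xOrder_term_le a i.val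
    rw [h₁] at h₂
    exact absurd hu' (not_lt.2 h₂)
  have hrange : LinearMap.range Ψ
      = (gr.part d ⊓ orderLE H o).map (decomposables gr d o ho).mkQ := by
    apply le_antisymm
    · rintro _ ⟨v, rfl⟩
      refine ⟨Ψ₀ v, ?_, rfl⟩
      rw [Fintype.linearCombination_apply]
      refine Submodule.sum_mem _ fun i _ => Submodule.smul_mem _ _ ⟨?_, ?_⟩
      · have := hb.mem i.val
        rwa [i.2.1] at this
      · exact i.2.2.le
    · rintro _ ⟨z, ⟨hz, hz'⟩, rfl⟩
      obtain ⟨c, hc, rfl⟩ := hb.exists_expansion hX hz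
      -- Only terms of exponent zero can survive modulo `decomposables`, which leaves the constant
      -- coefficients.
      refine ⟨fun i => (c i.val).coeff 0, ?_⟩
      rw [LinearMap.comp_apply, eq_comm, ← sub_eq_zero, ← map_sub, Submodule.mkQ_apply,
        Submodule.Quotient.mk_eq_zero, hV, ← Finset.sum_sub_distrib]
      refine Submodule.sum_mem _ fun i _ => ?_
      rw [← sub_smul]
      have hord : xOrder (c i • y i) ≤ o := (hb.xOrder_term_le c i).trans hz'
      by_cases h0 : c i = 0
      · have : V (fun i => (c i.val).coeff 0) i = 0 := by
          simp only [V, h0]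
          split_ifs <;> simp
        rw [this, h0, sub_self, zero_smul]
        exact Submodule.zero_mem _
      obtain ⟨e, r, he, hr, hce⟩ := eq_C_mul_X_pow_of_mem (hc i) h0
      by_cases hi : deg i = d ∧ xOrder (y i) = o
      · have he0 : e = 0 := by omega
        rw [he0, pow_zero, mul_one] at hce
        simp only [V, dif_pos hi, hce, coeff_C_zero, sub_self, zero_smul]
        exact Submodule.zero_mem _
      · simp only [V, dif_neg hi, sub_zero]
        -- With exponent zero the generator has degree d but order different from o, hence smaller.
        -- With positive exponent the term is a multiple of a.
        rcases e with _ | e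
        · rw [pow_zero, mul_one] at hce
          have hd : deg i = d := by simpa using he
          refine Submodule.mem_sup_left ⟨gr.smul_mem_part hX (hb.mem i) (hc i), ?_⟩
          refine lt_of_le_of_ne hord fun h => hi ⟨hd, ?_⟩
          rw [← h, hce]
          have := xOrder_C_mul r hr 1 (y i)
          rw [mul_one, one_smul] at this
          exact this.symm
        · have hXc : c i • y i = (X : ℚ[X]) • ((C r * X ^ e) • y i) := by
            rw [hce, ← mul_smul]
            congr 1
            ring
          refine Submodule.mem_sup_right ⟨(C r * X ^ e) • y i, ⟨?_, ?_⟩, hXc.symm⟩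
          · refine gr.smul_mem_part hX (hb.mem i) fun e' he' => ?_
            rw [coeff_C_mul_X_pow] at he'
            have : e' = e := by
              by_contra h
              exact he' (if_neg h)
            push_cast at he
            omega
          · rw [hXc] at hord
            exact (xOrder_le_X_smul _).trans (add_le_add_left hord 1)
  rw [← hrange, LinearMap.finrank_range_of_inj hinj, Module.finrank_fintype_fun_eq_card,
    Nat.card_eq_fintype_card]

/-- Finite fibres of equal size are in bijection, and the bijections glue over the common base. It
converts equal multiplicities into a permutation. -/
theorem exists_equiv_of_card_fiber {α β γ : Type} [Finite α] [Finite β] (f : α → γ) (g : β → γ)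
    (h : ∀ c, Nat.card {a // f a = c} = Nat.card {b // g b = c}) :
    ∃ σ : α ≃ β, ∀ a, g (σ a) = f a := by
  let E : ∀ c, {a // f a = c} ≃ {b // g b = c} := fun c => (Finite.card_eq.1 (h c)).some
  exact ⟨(Equiv.sigmaFiberEquiv f).symm.trans
    ((Equiv.sigmaCongrRight E).trans (Equiv.sigmaFiberEquiv g)), fun a => (E _ ⟨a, rfl⟩).2⟩

/-- Order `⊤` separates free generators from torsion ones, and the dimension does not involve the
decomposition `e`; comparing two decompositions is then immediate. -/
theorem card_free_generators (hX : gr.IsShiftedByX 2) {m n : ℕ} {s : Fin m → ℤ} {t : Fin n → ℤ}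
    {l : Fin n → ℕ} (e : H ≃ₗ[ℚ[X]] ModelModule m l)
    (he : ∀ j, e '' {h | h ∈ gr.part j} = modelDeg s l t j) (d : ℤ) :
    Nat.card {p // s p = d} = Module.finrank ℚ
      ((gr.part d ⊓ orderLE H ⊤).map (decomposables gr d ⊤ ENat.top_pos).mkQ) := by
  obtain ⟨y₁, y₂, hb, h₁, h₂⟩ := exists_homogBasis_of_equiv e he
  rw [← hb.card_eq_finrank hX]
  refine Nat.card_congr (Equiv.ofBijective
    (fun p => ⟨Sum.inl p.val, p.2, h₁ p.val⟩) ⟨fun p q h => ?_, ?_⟩)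
  · exact Subtype.ext (Sum.inl_injective (congrArg Subtype.val h))
  · rintro ⟨p | q, hp, ho⟩
    · exact ⟨⟨p, hp⟩, rfl⟩
    · rw [Sum.elim_inr, h₂] at ho
      exact absurd ho (ENat.natCast_ne_top _)

theorem card_torsion_generators (hX : gr.IsShiftedByX 2) {m n : ℕ} {s : Fin m → ℤ}
    {t : Fin n → ℤ} {l : Fin n → ℕ} (e : H ≃ₗ[ℚ[X]] ModelModule m l)
    (he : ∀ j, e '' {h | h ∈ gr.part j} = modelDeg s l t j) (k : ℕ) (hk : 0 < (k : ℕ∞)) (d : ℤ) :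
    Nat.card {q // (l q, t q) = (k, d)} = Module.finrank ℚ
      ((gr.part d ⊓ orderLE H k).map (decomposables gr d k hk).mkQ) := by
  obtain ⟨y₁, y₂, hb, h₁, h₂⟩ := exists_homogBasis_of_equiv e he
  rw [← hb.card_eq_finrank hX]
  refine Nat.card_congr (Equiv.ofBijective
    (fun q => ⟨Sum.inr q.val, (Prod.ext_iff.1 q.2).2, (h₂ q.val).trans
      (congrArg Nat.cast (Prod.ext_iff.1 q.2).1)⟩) ⟨fun p q h => ?_, ?_⟩)
  · exact Subtype.ext (Sum.inr_injective (congrArg Subtype.val h))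
  · rintro ⟨p | q, hp, ho⟩
    · rw [Sum.elim_inl, h₁] at ho
      exact absurd ho.symm (ENat.natCast_ne_top _)
    · rw [Sum.elim_inr, h₂] at ho
      exact ⟨⟨q, Prod.ext (by exact_mod_cast ho) hp⟩, rfl⟩

/-- A graded decomposition is unique up to permutation. -/
theorem graded_decomposition_unique (hX : gr.IsShiftedByX 2)
    {m n : ℕ} {s : Fin m → ℤ} {t : Fin n → ℤ} {l : Fin n → ℕ} (hl : ∀ q, 0 < l q)
    (e : H ≃ₗ[ℚ[X]] ModelModule m l) (he : ∀ j, e '' {h | h ∈ gr.part j} = modelDeg s l t j)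
    {m' n' : ℕ} {s' : Fin m' → ℤ} {t' : Fin n' → ℤ} {l' : Fin n' → ℕ} (hl' : ∀ q, 0 < l' q)
    (e' : H ≃ₗ[ℚ[X]] ModelModule m' l')
    (he' : ∀ j, e' '' {h | h ∈ gr.part j} = modelDeg s' l' t' j) :
    (∃ σ : Fin m' ≃ Fin m, ∀ p, s (σ p) = s' p) ∧
      ∃ τ : Fin n' ≃ Fin n, ∀ q, l (τ q) = l' q ∧ t (τ q) = t' q := by
  constructor
  · exact exists_equiv_of_card_fiber s' s fun d =>
      (card_free_generators hX e' he' d).trans (card_free_generators hX e he d).symm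
  · obtain ⟨τ, hτ⟩ := exists_equiv_of_card_fiber (fun q => (l' q, t' q)) (fun q => (l q, t q))
      fun ⟨k, d⟩ => by
        -- Order 0 lies outside the counting formula; positivity of the torsion exponents makes both
        -- fibres over it empty.
        rcases Nat.eq_zero_or_pos k with rfl | hk
        · have h₁ : IsEmpty {q // (l' q, t' q) = (0, d)} :=
            ⟨fun q => (hl' q.val).ne' (Prod.ext_iff.1 q.2).1⟩
          have h₂ : IsEmpty {q // (l q, t q) = (0, d)} :=
            ⟨fun q => (hl q.val).ne' (Prod.ext_iff.1 q.2).1⟩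
          rw [Nat.card_of_isEmpty, Nat.card_of_isEmpty]
        · have hk' : 0 < (k : ℕ∞) := by exact_mod_cast hk
          exact (card_torsion_generators hX e' he' k hk' d).trans
            (card_torsion_generators hX e he k hk' d).symm
    exact ⟨τ, fun q => Prod.ext_iff.1 (hτ q)⟩

end GradedUniqueness

/-! ### Bihomogeneous polynomials -/

section BiHom

open Polynomial

variable {V : Type}

/-- `f` is bihomogeneous of `a`-degree `p` and `x`-degree `q`. -/
def BiHom (p q : ℤ) (f : MvPolynomial V ℚ[X]) : Prop :=
  ∀ m e, (f.coeff m).coeff e ≠ 0 → 2 * (e : ℤ) = p ∧ 2 * (m.degree : ℤ) = q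

namespace BiHom

variable {p q p' q' : ℤ} {f g : MvPolynomial V ℚ[X]}

theorem congr (h : BiHom p q f) (hp : p = p') (hq : q = q') : BiHom p' q' f := by
  subst hp hq
  exact h

theorem zero (p q : ℤ) : BiHom p q (0 : MvPolynomial V ℚ[X]) := fun m e h =>
  absurd (by simp) h

theorem add (hf : BiHom p q f) (hg : BiHom p q g) : BiHom p q (f + g) := by
  intro m e h
  by_cases hm : (f.coeff m).coeff e = 0
  · refine hg m e fun hc => h ?_
    rw [MvPolynomial.coeff_add, coeff_add, hm, hc, add_zero]
  · exact hf m e hm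

theorem neg (hf : BiHom p q f) : BiHom p q (-f) := by
  intro m e h
  refine hf m e fun hc => h ?_
  rw [MvPolynomial.coeff_neg, coeff_neg, hc, neg_zero]

theorem sub (hf : BiHom p q f) (hg : BiHom p q g) : BiHom p q (f - g) := by
  rw [sub_eq_add_neg]
  exact hf.add hg.neg

theorem sum {ι : Type} (s : Finset ι) (F : ι → MvPolynomial V ℚ[X])
    (h : ∀ i ∈ s, BiHom p q (F i)) : BiHom p q (∑ i ∈ s, F i) := by
  classical
  induction s using Finset.induction_on with
  | empty => exact zero p q
  | insert i s hi ih =>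
    rw [Finset.sum_insert hi]
    exact (h i (Finset.mem_insert_self i s)).add
      (ih fun j hj => h j (Finset.mem_insert_of_mem hj))

theorem mul (hf : BiHom p q f) (hg : BiHom p' q' g) : BiHom (p + p') (q + q') (f * g) := by
  classical
  intro m e h
  rw [MvPolynomial.coeff_mul, finsetSum_coeff] at h
  obtain ⟨⟨m₁, m₂⟩, hm, h⟩ := Finset.exists_ne_zero_of_sum_ne_zero h
  rw [coeff_mul] at h
  obtain ⟨⟨e₁, e₂⟩, he, h⟩ := Finset.exists_ne_zero_of_sum_ne_zero h
  obtain ⟨h₁, h₂⟩ := hf m₁ e₁ (left_ne_zero_of_mul h)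
  obtain ⟨h₃, h₄⟩ := hg m₂ e₂ (right_ne_zero_of_mul h)
  rw [Finset.HasAntidiagonal.mem_antidiagonal] at hm he
  simp only at hm he
  rw [← hm, ← he, map_add]
  push_cast
  constructor <;> linarith

theorem one : BiHom 0 0 (1 : MvPolynomial V ℚ[X]) := by
  classical
  intro m e h
  rw [MvPolynomial.coeff_one] at h
  split_ifs at h with hm
  · rw [coeff_one] at h
    split_ifs at h with he
    · simp [← hm, he]
    · exact absurd rfl h
  · exact absurd (coeff_zero e) h

theorem C_X : BiHom 2 0 (MvPolynomial.C X : MvPolynomial V ℚ[X]) := by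
  classical
  intro m e h
  rw [MvPolynomial.coeff_C] at h
  split_ifs at h with hm
  · rw [coeff_X] at h
    split_ifs at h with he
    · simp [← hm, ← he]
    · exact absurd rfl h
  · exact absurd (coeff_zero e) h

theorem var (v : V) : BiHom 0 2 (MvPolynomial.X v : MvPolynomial V ℚ[X]) := by
  classical
  intro m e h
  rw [MvPolynomial.coeff_X] at h
  split_ifs at h with hm
  · rw [coeff_one] at h
    split_ifs at h with he
    · simp [← hm, he]
    · exact absurd rfl h
  · exact absurd (coeff_zero e) h

theorem pow (hf : BiHom p q f) (n : ℕ) : BiHom (n * p) (n * q) (f ^ n) := by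
  induction n with
  | zero => simpa using one
  | succ n ih =>
    rw [pow_succ]
    exact (ih.mul hf).congr (by push_cast; ring) (by push_cast; ring)

variable {x y : MvPolynomial V ℚ[X]}

theorem powQuot (hx : BiHom 0 2 x) (hy : BiHom 0 2 y) (k : ℕ) :
    BiHom 0 (2 * k - 2) (powQuot k x y) := by
  refine sum _ _ fun i hi => ((hx.pow i).mul (hy.pow (k - 1 - i))).congr (by ring) ?_
  have := Finset.mem_range.1 hi
  omega

theorem powSum (hx : BiHom 0 2 x) (hy : BiHom 0 4 y) (k : ℕ) :
    BiHom 0 (2 * k) (powSum k x y) := by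
  induction k using Nat.twoStepInduction with
  | zero =>
    have h := ((one (V := V)).add one).congr (q' := 2 * ((0 : ℕ) : ℤ)) rfl (by simp)
    rwa [one_add_one_eq_two] at h
  | one => exact hx.congr rfl (by simp)
  | more k h₀ h₁ =>
    rw [_root_.powSum]
    exact ((hx.mul h₁).congr (by ring) (by push_cast; ring)).sub
      ((hy.mul h₀).congr (by ring) (by push_cast; ring))

/-- The degree 2k - 2 is negative at k = 0. This is harmless, as the zero polynomial has every
bidegree, and it lets the recursion run uniformly. -/
theorem quotFst {X₁ X₂ Y₁ : MvPolynomial V ℚ[X]} (h₁ : BiHom 0 2 X₁) (h₂ : BiHom 0 4 X₂)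
    (h₃ : BiHom 0 2 Y₁) (k : ℕ) : BiHom 0 (2 * k - 2) (quotFst k X₁ X₂ Y₁) := by
  induction k using Nat.twoStepInduction with
  | zero => exact zero _ _
  | one => exact one.congr rfl (by simp)
  | more k i₀ i₁ =>
    rw [_root_.quotFst]
    exact (((h₁.powSum h₂ (k + 1)).congr rfl (by push_cast; ring)).add
      ((h₃.mul i₁).congr (by ring) (by push_cast; ring))).sub
      ((h₂.mul i₀).congr (by ring) (by push_cast; ring))

theorem quotSnd {X₂ Y₁ Y₂ : MvPolynomial V ℚ[X]} (h₁ : BiHom 0 4 X₂) (h₂ : BiHom 0 2 Y₁)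
    (h₃ : BiHom 0 4 Y₂) (k : ℕ) : BiHom 0 (2 * k - 4) (quotSnd k X₂ Y₁ Y₂) := by
  induction k using Nat.twoStepInduction with
  | zero => exact zero _ _
  | one => exact zero _ _
  | more k i₀ i₁ =>
    rw [_root_.quotSnd]
    exact (((h₂.mul i₁).congr (by ring) (by push_cast; ring)).sub
      ((h₂.powSum h₁ k).congr rfl (by push_cast; ring))).sub
      ((h₃.mul i₀).congr (by ring) (by push_cast; ring))

theorem quotChi {x₁ y₁ x₂ y₂ : MvPolynomial V ℚ[X]} (h₁ : BiHom 0 2 x₁) (h₂ : BiHom 0 2 y₁)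
    (h₃ : BiHom 0 2 x₂) (h₄ : BiHom 0 2 y₂) (k : ℕ) :
    BiHom 0 (2 * k - 4) (quotChi k x₁ y₁ x₂ y₂) := by
  induction k using Nat.twoStepInduction with
  | zero => exact zero _ _
  | one => exact zero _ _
  | more k i₀ i₁ =>
    rw [_root_.quotChi]
    exact (((((h₃.add h₄).mul i₁).congr (by ring) (by push_cast; ring)).sub
      (((h₁.mul h₂).mul i₀).congr (by ring) (by push_cast; ring))).add
      ((h₂.powQuot h₃ (k + 1)).congr (by ring) (by push_cast; ring))).sub
      ((h₁.mul (h₁.powQuot h₄ k)).congr (by ring) (by push_cast; ring))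

theorem paritySign (ε : ZMod 2) : BiHom 0 0 (paritySign (MvPolynomial V ℚ[X]) ε) := by
  rw [_root_.paritySign]
  split_ifs
  · exact one
  · exact one.neg

theorem degSign (i : ℤ) : BiHom 0 0 (degSign (MvPolynomial V ℚ[X]) i) := by
  rw [_root_.degSign]
  rcases Int.even_or_odd i with h | h
  · rw [Int.negOnePow_even i h]
    simpa using one
  · rw [Int.negOnePow_odd i h]
    simpa using one.neg

end BiHom

/-! ### Homogeneity of the differentials -/

/-- The differential of the matrix factorization has bidegree `(1, N + 1)`. -/
def MatFac.IsHomog (N : ℕ) (M : MatFac (MvPolynomial V ℚ[X])) : Prop :=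
  ∀ b b', BiHom (M.adeg b' + 1 - M.adeg b) (M.xdeg b' + (N + 1) - M.xdeg b) (M.dmf b b')

/-- The matrix `f` defines a map of bidegree `(p, q)`. -/
def IsHomogMatrix {ι ι' : Type} (adeg xdeg : ι → ℤ) (adeg' xdeg' : ι' → ℤ) (p q : ℤ)
    (f : Matrix ι' ι (MvPolynomial V ℚ[X])) : Prop :=
  ∀ b b', BiHom (adeg b' + p - adeg' b) (xdeg b' + q - xdeg' b) (f b b')

/-- The sign diagonal has bidegree zero. Leaving it arbitrary treats d_mf, signed by parity, and
d_χ, signed by homological degree, at once. -/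
theorem IsHomogMatrix.tensor {ι ι' : Type} [DecidableEq ι] [DecidableEq ι'] {a x : ι → ℤ}
    {a' x' : ι' → ℤ} {p q : ℤ}
    {f : Matrix ι ι (MvPolynomial V ℚ[X])} {f' : Matrix ι' ι' (MvPolynomial V ℚ[X])}
    (h : IsHomogMatrix a x a x p q f) (h' : IsHomogMatrix a' x' a' x' p q f')
    (s : ι → MvPolynomial V ℚ[X]) (hs : ∀ b, BiHom 0 0 (s b)) :
    IsHomogMatrix (fun b : ι × ι' => a b.1 + a' b.2) (fun b => x b.1 + x' b.2)
      (fun b : ι × ι' => a b.1 + a' b.2) (fun b => x b.1 + x' b.2) p q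
      (f ⊗ₖ (1 : Matrix ι' ι' (MvPolynomial V ℚ[X])) + Matrix.diagonal s ⊗ₖ f') := by
  rintro ⟨b, c⟩ ⟨b', c'⟩
  rw [Matrix.add_apply, Matrix.kroneckerMap_apply, Matrix.kroneckerMap_apply]
  refine BiHom.add ?_ ?_
  · by_cases hc : c = c'
    · subst hc
      rw [Matrix.one_apply_eq]
      exact ((h b b').mul BiHom.one).congr (by ring) (by ring)
    · rw [Matrix.one_apply_ne hc, mul_zero]
      exact BiHom.zero _ _
  · by_cases hb : b = b'
    · subst hb
      rw [Matrix.diagonal_apply_eq]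
      exact ((hs b).mul (h' c c')).congr (by ring) (by ring)
    · rw [Matrix.diagonal_apply_ne _ hb, zero_mul]
      exact BiHom.zero _ _

theorem MatFac.IsHomog.tensor {N : ℕ} {M M' : MatFac (MvPolynomial V ℚ[X])} (h : M.IsHomog N)
    (h' : M'.IsHomog N) : (M.tensor M').IsHomog N :=
  IsHomogMatrix.tensor (p := 1) (q := N + 1) h h' _ fun _ => BiHom.paritySign _

theorem MatFac.IsHomog.shift {N : ℕ} {M : MatFac (MvPolynomial V ℚ[X])} (h : M.IsHomog N)
    (p q : ℤ) : (M.shift p q).IsHomog N := fun b b' =>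
  (h b b').congr (by simp only; ring) (by simp only; ring)

theorem MatFac.IsHomog.shiftOne {N : ℕ} {M : MatFac (MvPolynomial V ℚ[X])} (h : M.IsHomog N)
    (p q : ℤ) : (M.shiftOne p q).IsHomog N := fun b b' =>
  (h b b').congr (by simp only; ring) (by simp only; ring)

/-- The bidegrees of u and v add up to (2, 2N + 2), and the shift of the second basis element splits
this evenly between the two maps. -/
theorem MatFac.isHomog_koszul (N : ℕ) {u v : MvPolynomial V ℚ[X]} {p q : ℤ} (hu : BiHom p q u)
    (hv : BiHom (2 - p) (2 * N + 2 - q) v) : (MatFac.koszul N u v p q).IsHomog N := by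
  intro b b'
  fin_cases b <;> fin_cases b'
  · exact BiHom.zero _ _
  · exact hv.congr (by simp; ring) (by simp; ring)
  · exact hu.congr (by simp) (by simp)
  · exact BiHom.zero _ _

/-- The two differentials have bidegrees `(1, N + 1)` and `(0, 0)`. -/
structure MFComplex.IsHomog (N : ℕ) (M : MFComplex (MvPolynomial V ℚ[X])) : Prop where
  dmf : M.toMatFac.IsHomog N
  dchi : IsHomogMatrix M.adeg M.xdeg M.adeg M.xdeg 0 0 M.dchi

theorem MFComplex.IsHomog.tensor {N : ℕ} {M M' : MFComplex (MvPolynomial V ℚ[X])}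
    (h : M.IsHomog N) (h' : M'.IsHomog N) : (M.tensor M').IsHomog N where
  dmf := h.dmf.tensor h'.dmf
  dchi := h.dchi.tensor h'.dchi _ fun _ => BiHom.degSign _

theorem MFComplex.isHomog_single {N : ℕ} {M : MatFac (MvPolynomial V ℚ[X])} (h : M.IsHomog N) :
    (MFComplex.single M).IsHomog N where
  dmf := h
  dchi _ _ := BiHom.zero _ _

theorem MFComplex.isHomog_unit (N : ℕ) : (MFComplex.unit (MvPolynomial V ℚ[X])).IsHomog N :=
  MFComplex.isHomog_single fun _ _ => BiHom.zero _ _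

theorem MFComplex.isHomog_twoTerm {N : ℕ} {M M' : MatFac (MvPolynomial V ℚ[X])} (h : M.IsHomog N)
    (h' : M'.IsHomog N) (i : ℤ) (f : Matrix M'.ι M.ι (MvPolynomial V ℚ[X]))
    (hf : IsHomogMatrix M.adeg M.xdeg M'.adeg M'.xdeg 0 0 f) (h₁ h₂ h₃) :
    (MFComplex.twoTerm M M' i f h₁ h₂ h₃).IsHomog N where
  dmf := by
    rintro (b | b) (b' | b')
    · exact h b b'
    · exact BiHom.zero _ _
    · exact BiHom.zero _ _
    · exact h' b b'
  dchi := by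
    rintro (b | b) (b' | b')
    · exact BiHom.zero _ _
    · exact BiHom.zero _ _
    · exact hf b b'
    · exact BiHom.zero _ _

/-! ### Homogeneity of arcs and crossings -/

section Pieces

variable (N : ℕ) {x y x₁ y₁ x₂ y₂ : MvPolynomial V ℚ[X]}

theorem isHomog_arcMF (hx : BiHom 0 2 x) (hy : BiHom 0 2 y) :
    (arcMF N (MvPolynomial.C X) x y).IsHomog N :=
  MatFac.isHomog_koszul N
    ((BiHom.C_X.mul (hx.powQuot hy (N + 1))).congr (by ring) (by push_cast; ring))
    ((hx.sub hy).congr (by ring) (by ring))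

theorem isHomog_gammaZero (h₁ : BiHom 0 2 x₁) (h₂ : BiHom 0 2 y₁) (h₃ : BiHom 0 2 x₂)
    (h₄ : BiHom 0 2 y₂) : (gammaZero N (MvPolynomial.C X) x₁ y₁ x₂ y₂).IsHomog N :=
  (isHomog_arcMF N h₁ h₄).tensor (isHomog_arcMF N h₂ h₃)

theorem isHomog_gammaOne (h₁ : BiHom 0 2 x₁) (h₂ : BiHom 0 2 y₁) (h₃ : BiHom 0 2 x₂)
    (h₄ : BiHom 0 2 y₂) : (gammaOne N (MvPolynomial.C X) x₁ y₁ x₂ y₂).IsHomog N := by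
  refine MatFac.IsHomog.shift (MatFac.IsHomog.tensor ?_ ?_) _ _
  · exact MatFac.isHomog_koszul N
      ((BiHom.C_X.mul (BiHom.quotFst (h₁.add h₂) (h₁.mul h₂) (h₃.add h₄) (N + 1))).congr
        (by ring) (by push_cast; ring))
      (((h₁.add h₂).sub (h₃.add h₄)).congr (by ring) (by ring))
  · exact MatFac.isHomog_koszul N
      ((BiHom.C_X.mul (BiHom.quotSnd (h₁.mul h₂) (h₃.add h₄) (h₃.mul h₄) (N + 1))).congr
        (by ring) (by push_cast; ring))
      (((h₁.mul h₂).sub (h₃.mul h₄)).congr (by ring) (by ring))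

theorem isHomog_chiZero (h₁ : BiHom 0 2 x₁) (h₂ : BiHom 0 2 y₁) (h₃ : BiHom 0 2 x₂)
    (h₄ : BiHom 0 2 y₂) : IsHomogMatrix
      (gammaZero N (MvPolynomial.C X) x₁ y₁ x₂ y₂).adeg
      (gammaZero N (MvPolynomial.C X) x₁ y₁ x₂ y₂).xdeg
      (gammaOne N (MvPolynomial.C X) x₁ y₁ x₂ y₂).adeg
      (gammaOne N (MvPolynomial.C X) x₁ y₁ x₂ y₂).xdeg 0 1
      (chiZero N (MvPolynomial.C X) x₁ y₁ x₂ y₂) := by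
  have hk := (BiHom.C_X.mul (BiHom.quotChi h₁ h₂ h₃ h₄ (N + 1))).neg
  rintro ⟨b, c⟩ ⟨b', c'⟩
  fin_cases b <;> fin_cases c <;> fin_cases b' <;> fin_cases c' <;>
    first
    | exact BiHom.zero _ _
    | exact BiHom.one.congr (by simp) (by simp; try ring)
    | exact BiHom.one.neg.congr (by simp) (by simp; try ring)
    | exact (h₃.sub h₁).congr (by simp) (by simp; try ring)
    | exact h₃.congr (by simp) (by simp; try ring)
    | exact h₁.neg.congr (by simp) (by simp; try ring)
    | exact hk.congr (by simp) (by simp; try ring)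

theorem isHomog_chiOne (h₁ : BiHom 0 2 x₁) (h₂ : BiHom 0 2 y₁) (h₃ : BiHom 0 2 x₂)
    (h₄ : BiHom 0 2 y₂) : IsHomogMatrix
      (gammaOne N (MvPolynomial.C X) x₁ y₁ x₂ y₂).adeg
      (gammaOne N (MvPolynomial.C X) x₁ y₁ x₂ y₂).xdeg
      (gammaZero N (MvPolynomial.C X) x₁ y₁ x₂ y₂).adeg
      (gammaZero N (MvPolynomial.C X) x₁ y₁ x₂ y₂).xdeg 0 1
      (chiOne N (MvPolynomial.C X) x₁ y₁ x₂ y₂) := by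
  have hk := (BiHom.C_X.mul (BiHom.quotChi h₁ h₂ h₃ h₄ (N + 1))).neg
  rintro ⟨b, c⟩ ⟨b', c'⟩
  fin_cases b <;> fin_cases c <;> fin_cases b' <;> fin_cases c' <;>
    first
    | exact BiHom.zero _ _
    | exact BiHom.one.congr (by simp) (by simp; try ring)
    | exact (h₁.sub h₃).congr (by simp) (by simp; try ring)
    | exact h₃.congr (by simp) (by simp; try ring)
    | exact h₁.congr (by simp) (by simp; try ring)
    | exact hk.congr (by simp) (by simp; try ring)

/-- The x-shifts of the two terms differ by one, which absorbs the x-degree 1 of χ¹. -/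
theorem isHomog_posCrossing (h₁ : BiHom 0 2 x₁) (h₂ : BiHom 0 2 y₁) (h₃ : BiHom 0 2 x₂)
    (h₄ : BiHom 0 2 y₂) : (posCrossing N (MvPolynomial.C X) x₁ y₁ x₂ y₂).IsHomog N :=
  MFComplex.isHomog_twoTerm ((isHomog_gammaOne N h₁ h₂ h₃ h₄).shiftOne _ _)
    ((isHomog_gammaZero N h₁ h₂ h₃ h₄).shiftOne _ _) _ _
    (fun b b' => (isHomog_chiOne N h₁ h₂ h₃ h₄ b b').congr (by ring) (by ring)) _ _ _

theorem isHomog_negCrossing (h₁ : BiHom 0 2 x₁) (h₂ : BiHom 0 2 y₁) (h₃ : BiHom 0 2 x₂)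
    (h₄ : BiHom 0 2 y₂) : (negCrossing N (MvPolynomial.C X) x₁ y₁ x₂ y₂).IsHomog N :=
  MFComplex.isHomog_twoTerm ((isHomog_gammaZero N h₁ h₂ h₃ h₄).shiftOne _ _)
    ((isHomog_gammaOne N h₁ h₂ h₃ h₄).shiftOne _ _) _ _
    (fun b b' => (isHomog_chiZero N h₁ h₂ h₃ h₄ b b').congr (by ring) (by ring)) _ _ _

end Pieces

theorem ClosedBraid.isHomog_complex (B : ClosedBraid) (N : ℕ) :
    (B.complex N (X : ℚ[X])).IsHomog N := by
  have harcs : ∀ (t : Fin (B.word.length + 1)) (L : List (Fin B.strands)),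
      ∀ M ∈ L.map fun s => arcComplex N (MvPolynomial.C (X : ℚ[X]))
        (MvPolynomial.X (t + 1, s) : MvPolynomial B.Mark ℚ[X]) (MvPolynomial.X (t, s)),
      M.IsHomog N := by
    intro t L M hM
    obtain ⟨s, -, rfl⟩ := List.mem_map.1 hM
    exact MFComplex.isHomog_single (isHomog_arcMF N (BiHom.var _) (BiHom.var _))
  have hpieces : ∀ t, ∀ M ∈ B.slicePieces N (X : ℚ[X]) t, M.IsHomog N := by
    intro t M hM
    unfold slicePieces at hM
    dsimp only at hM
    split at hM
    · exact harcs t _ M hM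
    · rcases List.mem_cons.1 hM with rfl | hM
      · exact isHomog_posCrossing N (BiHom.var _) (BiHom.var _) (BiHom.var _) (BiHom.var _)
      · exact harcs t _ M hM
    · rcases List.mem_cons.1 hM with rfl | hM
      · exact isHomog_negCrossing N (BiHom.var _) (BiHom.var _) (BiHom.var _) (BiHom.var _)
      · exact harcs t _ M hM
  have hfold : ∀ L : List (MFComplex (MvPolynomial B.Mark ℚ[X])), (∀ M ∈ L, M.IsHomog N) →
      (L.foldr MFComplex.tensor (MFComplex.unit _)).IsHomog N := by
    intro L
    induction L with
    | nil => exact fun _ => MFComplex.isHomog_unit N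
    | cons M L ih =>
      intro h
      exact (h M List.mem_cons_self).tensor (ih fun M' hM' => h M' (List.mem_cons_of_mem _ hM'))
  refine hfold _ fun M hM => ?_
  obtain ⟨t, -, ht⟩ := List.mem_flatMap.1 hM
  exact hpieces t M ht

end BiHom

/-! ### Change of the base ring -/

section BaseChange

variable {R R' : Type} [CommRing R] [CommRing R'] (φ : R →+* R')

theorem map_powQuot (k : ℕ) (x y : R) : φ (powQuot k x y) = powQuot k (φ x) (φ y) := by
  simp [powQuot]

theorem map_powSum (k : ℕ) (x y : R) : φ (powSum k x y) = powSum k (φ x) (φ y) := by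
  induction k using Nat.twoStepInduction with
  | zero => exact map_ofNat φ 2
  | one => simp [powSum]
  | more k h₀ h₁ => simp [powSum, h₀, h₁]

theorem map_quotFst (k : ℕ) (x y z : R) :
    φ (quotFst k x y z) = quotFst k (φ x) (φ y) (φ z) := by
  induction k using Nat.twoStepInduction with
  | zero => simp [quotFst]
  | one => simp [quotFst]
  | more k h₀ h₁ => simp [quotFst, h₀, h₁, map_powSum]

theorem map_quotSnd (k : ℕ) (x y z : R) :
    φ (quotSnd k x y z) = quotSnd k (φ x) (φ y) (φ z) := by
  induction k using Nat.twoStepInduction with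
  | zero => simp [quotSnd]
  | one => simp [quotSnd]
  | more k h₀ h₁ => simp [quotSnd, h₀, h₁, map_powSum]

theorem map_quotChi (k : ℕ) (x y z w : R) :
    φ (quotChi k x y z w) = quotChi k (φ x) (φ y) (φ z) (φ w) := by
  induction k using Nat.twoStepInduction with
  | zero => simp [quotChi]
  | one => simp [quotChi]
  | more k h₀ h₁ => simp [quotChi, h₀, h₁, map_powQuot]

theorem map_paritySign (ε : ZMod 2) : φ (paritySign R ε) = paritySign R' ε := by
  unfold paritySign
  split_ifs <;> simp

theorem map_degSign (i : ℤ) : φ (degSign R i) = degSign R' i := by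
  simp [degSign]

/-- `M'` arises from `M` by applying `φ` to the coefficients. -/
structure MatFac.BaseChange (M : MatFac R) (M' : MatFac R') where
  e : M.ι ≃ M'.ι
  parity : ∀ b, M'.parity (e b) = M.parity b
  xdeg : ∀ b, M'.xdeg (e b) = M.xdeg b
  dmf : ∀ b b', M'.dmf (e b) (e b') = φ (M.dmf b b')

/-- `M'` arises from `M` by applying `φ` to the coefficients. -/
structure MFComplex.BaseChange (M : MFComplex R) (M' : MFComplex R') extends
    MatFac.BaseChange φ M.toMatFac M'.toMatFac where
  hdeg : ∀ b, M'.hdeg (e b) = M.hdeg b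
  dchi : ∀ b b', M'.dchi (e b) (e b') = φ (M.dchi b b')

variable {φ}

def MatFac.BaseChange.koszul (N : ℕ) {u v : R} {u' v' : R'} (hu : φ u = u') (hv : φ v = v')
    (p q : ℤ) : MatFac.BaseChange φ (MatFac.koszul N u v p q) (MatFac.koszul N u' v' p q) where
  e := Equiv.refl _
  parity _ := rfl
  xdeg _ := rfl
  dmf b b' := by
    subst hu hv
    fin_cases b <;> fin_cases b' <;> simp

theorem map_tensor_entry {ι ι' κ κ' : Type} [DecidableEq ι] [DecidableEq ι'] [DecidableEq κ]
    [DecidableEq κ'] (e : ι ≃ ι') (e' : κ ≃ κ') {f : Matrix ι ι R} {f' : Matrix ι' ι' R'}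
    (hf : ∀ b b', f' (e b) (e b') = φ (f b b')) {g : Matrix κ κ R} {g' : Matrix κ' κ' R'}
    (hg : ∀ b b', g' (e' b) (e' b') = φ (g b b')) {s : ι → R} {s' : ι' → R'}
    (hs : ∀ b, s' (e b) = φ (s b)) (b b' : ι × κ) :
    (f' ⊗ₖ (1 : Matrix κ' κ' R') + Matrix.diagonal s' ⊗ₖ g') (e b.1, e' b.2) (e b'.1, e' b'.2)
      = φ ((f ⊗ₖ (1 : Matrix κ κ R) + Matrix.diagonal s ⊗ₖ g) b b') := by
  simp only [Matrix.add_apply, Matrix.kroneckerMap_apply, map_add, map_mul, hf, hg,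
    Matrix.one_apply, Matrix.diagonal_apply, e.injective.eq_iff, e'.injective.eq_iff]
  split_ifs <;> simp [hs]

def MatFac.BaseChange.tensor {M₁ M₂ : MatFac R} {M₁' M₂' : MatFac R'}
    (h₁ : MatFac.BaseChange φ M₁ M₁') (h₂ : MatFac.BaseChange φ M₂ M₂') :
    MatFac.BaseChange φ (M₁.tensor M₂) (M₁'.tensor M₂') where
  e := h₁.e.prodCongr h₂.e
  parity b := congrArg₂ (· + ·) (h₁.parity b.1) (h₂.parity b.2)
  xdeg b := congrArg₂ (· + ·) (h₁.xdeg b.1) (h₂.xdeg b.2)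
  dmf b b' := map_tensor_entry h₁.e h₂.e h₁.dmf h₂.dmf
    (fun b => by rw [h₁.parity, map_paritySign]) b b'

def MatFac.BaseChange.shift {M : MatFac R} {M' : MatFac R'} (h : MatFac.BaseChange φ M M')
    (p q : ℤ) : MatFac.BaseChange φ (M.shift p q) (M'.shift p q) where
  e := h.e
  parity := h.parity
  xdeg b := congrArg (· + q) (h.xdeg b)
  dmf := h.dmf

def MatFac.BaseChange.shiftOne {M : MatFac R} {M' : MatFac R'} (h : MatFac.BaseChange φ M M')
    (p q : ℤ) : MatFac.BaseChange φ (M.shiftOne p q) (M'.shiftOne p q) where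
  e := h.e
  parity b := congrArg (· + 1) (h.parity b)
  xdeg b := congrArg (· + q) (h.xdeg b)
  dmf := h.dmf

def MFComplex.BaseChange.tensor {M₁ M₂ : MFComplex R} {M₁' M₂' : MFComplex R'}
    (h₁ : MFComplex.BaseChange φ M₁ M₁') (h₂ : MFComplex.BaseChange φ M₂ M₂') :
    MFComplex.BaseChange φ (M₁.tensor M₂) (M₁'.tensor M₂') where
  toBaseChange := h₁.toBaseChange.tensor h₂.toBaseChange
  hdeg b := congrArg₂ (· + ·) (h₁.hdeg b.1) (h₂.hdeg b.2)
  dchi b b' := map_tensor_entry h₁.e h₂.e h₁.dchi h₂.dchi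
    (fun b => by rw [h₁.hdeg, map_degSign]) b b'

def MFComplex.BaseChange.single {M : MatFac R} {M' : MatFac R'} (h : MatFac.BaseChange φ M M') :
    MFComplex.BaseChange φ (MFComplex.single M) (MFComplex.single M') where
  toBaseChange := h
  hdeg _ := rfl
  dchi _ _ := (map_zero φ).symm

def MFComplex.BaseChange.unit : MFComplex.BaseChange φ (MFComplex.unit R) (MFComplex.unit R') :=
  MFComplex.BaseChange.single
    { e := Equiv.refl _
      parity := fun _ => rfl
      xdeg := fun _ => rfl
      dmf := fun _ _ => (map_zero φ).symm }

def MFComplex.BaseChange.twoTerm {M₁ M₂ : MatFac R} {M₁' M₂' : MatFac R'}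
    (h₁ : MatFac.BaseChange φ M₁ M₁') (h₂ : MatFac.BaseChange φ M₂ M₂') (i : ℤ)
    {f : Matrix M₂.ι M₁.ι R} {f' : Matrix M₂'.ι M₁'.ι R'}
    (hf : ∀ b b', f' (h₂.e b) (h₁.e b') = φ (f b b')) (a₁ a₂ a₃ a₁' a₂' a₃') :
    MFComplex.BaseChange φ (MFComplex.twoTerm M₁ M₂ i f a₁ a₂ a₃)
      (MFComplex.twoTerm M₁' M₂' i f' a₁' a₂' a₃') where
  e := h₁.e.sumCongr h₂.e
  parity b := by
    rcases b with b | b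
    · exact h₁.parity b
    · exact h₂.parity b
  xdeg b := by
    rcases b with b | b
    · exact h₁.xdeg b
    · exact h₂.xdeg b
  dmf b b' := by
    rcases b with b | b <;> rcases b' with b' | b'
    · exact h₁.dmf b b'
    · exact (map_zero φ).symm
    · exact (map_zero φ).symm
    · exact h₂.dmf b b'
  hdeg b := by
    rcases b with b | b <;> rfl
  dchi b b' := by
    rcases b with b | b <;> rcases b' with b' | b'
    · exact (map_zero φ).symm
    · exact (map_zero φ).symm
    · exact hf b b'
    · exact (map_zero φ).symm

/-! ### Base change of arcs and crossings -/

section Pieces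

variable (φ) (N : ℕ) (α x y x₁ y₁ x₂ y₂ : R)

def MatFac.BaseChange.arcMF :
    MatFac.BaseChange φ (arcMF N α x y) (arcMF N (φ α) (φ x) (φ y)) :=
  MatFac.BaseChange.koszul N (by rw [map_mul, map_powQuot]) (map_sub _ _ _) _ _

def MatFac.BaseChange.gammaZero : MatFac.BaseChange φ (gammaZero N α x₁ y₁ x₂ y₂)
    (gammaZero N (φ α) (φ x₁) (φ y₁) (φ x₂) (φ y₂)) :=
  (MatFac.BaseChange.arcMF φ N α x₁ y₂).tensor (MatFac.BaseChange.arcMF φ N α y₁ x₂)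

def MatFac.BaseChange.gammaOne : MatFac.BaseChange φ (gammaOne N α x₁ y₁ x₂ y₂)
    (gammaOne N (φ α) (φ x₁) (φ y₁) (φ x₂) (φ y₂)) :=
  MatFac.BaseChange.shift (MatFac.BaseChange.tensor
    (MatFac.BaseChange.koszul N (by simp [map_quotFst]) (by simp) _ _)
    (MatFac.BaseChange.koszul N (by simp [map_quotSnd]) (by simp) _ _)) _ _

theorem map_chiZero (b b' : Fin 2 × Fin 2) :
    chiZero N (φ α) (φ x₁) (φ y₁) (φ x₂) (φ y₂) b b' = φ (chiZero N α x₁ y₁ x₂ y₂ b b') := by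
  have h : ∀ i j : Fin 4,
      (!![φ x₂ - φ x₁, 0, 0, 0; 0, -1, 1, 0; 0, φ x₂, -φ x₁, 0;
        -(φ α * quotChi (N + 1) (φ x₁) (φ y₁) (φ x₂) (φ y₂)), 0, 0, -1]
          : Matrix (Fin 4) (Fin 4) R') i j
      = φ ((!![x₂ - x₁, 0, 0, 0; 0, -1, 1, 0; 0, x₂, -x₁, 0;
        -(α * quotChi (N + 1) x₁ y₁ x₂ y₂), 0, 0, -1] : Matrix (Fin 4) (Fin 4) R) i j) := by
    intro i j
    fin_cases i <;> fin_cases j <;> simp [map_quotChi]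
  exact h _ _

theorem map_chiOne (b b' : Fin 2 × Fin 2) :
    chiOne N (φ α) (φ x₁) (φ y₁) (φ x₂) (φ y₂) b b' = φ (chiOne N α x₁ y₁ x₂ y₂ b b') := by
  have h : ∀ i j : Fin 4,
      (!![1, 0, 0, 0; 0, φ x₁, 1, 0; 0, φ x₂, 1, 0;
        -(φ α * quotChi (N + 1) (φ x₁) (φ y₁) (φ x₂) (φ y₂)), 0, 0, φ x₁ - φ x₂]
          : Matrix (Fin 4) (Fin 4) R') i j
      = φ ((!![1, 0, 0, 0; 0, x₁, 1, 0; 0, x₂, 1, 0;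
        -(α * quotChi (N + 1) x₁ y₁ x₂ y₂), 0, 0, x₁ - x₂] : Matrix (Fin 4) (Fin 4) R) i j) := by
    intro i j
    fin_cases i <;> fin_cases j <;> simp [map_quotChi]
  exact h _ _

def MFComplex.BaseChange.posCrossing : MFComplex.BaseChange φ (posCrossing N α x₁ y₁ x₂ y₂)
    (posCrossing N (φ α) (φ x₁) (φ y₁) (φ x₂) (φ y₂)) :=
  MFComplex.BaseChange.twoTerm
    (MatFac.BaseChange.shiftOne (MatFac.BaseChange.gammaOne φ N α x₁ y₁ x₂ y₂) _ _)
    (MatFac.BaseChange.shiftOne (MatFac.BaseChange.gammaZero φ N α x₁ y₁ x₂ y₂) _ _) _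
    (fun b b' => map_chiOne φ N α x₁ y₁ x₂ y₂ b b') _ _ _ _ _ _

def MFComplex.BaseChange.negCrossing : MFComplex.BaseChange φ (negCrossing N α x₁ y₁ x₂ y₂)
    (negCrossing N (φ α) (φ x₁) (φ y₁) (φ x₂) (φ y₂)) :=
  MFComplex.BaseChange.twoTerm
    (MatFac.BaseChange.shiftOne (MatFac.BaseChange.gammaZero φ N α x₁ y₁ x₂ y₂) _ _)
    (MatFac.BaseChange.shiftOne (MatFac.BaseChange.gammaOne φ N α x₁ y₁ x₂ y₂) _ _) _
    (fun b b' => map_chiZero φ N α x₁ y₁ x₂ y₂ b b') _ _ _ _ _ _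

end Pieces

/-- Both complexes follow one recipe whose coefficients are integral polynomial expressions in α and
the marks, so each piece over `A` maps to its counterpart and tensor products preserve the matching.
-/
theorem ClosedBraid.nonempty_baseChange (B : ClosedBraid) (N : ℕ) {A A' : Type} [CommRing A]
    [CommRing A'] (ψ : A →+* A') (α : A) :
    Nonempty (MFComplex.BaseChange (MvPolynomial.map ψ) (B.complex N α) (B.complex N (ψ α))) := by
  let P : MFComplex (MvPolynomial B.Mark A) → MFComplex (MvPolynomial B.Mark A') → Prop :=
    fun M M' => Nonempty (MFComplex.BaseChange (MvPolynomial.map ψ) M M')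
  have harcs : ∀ (t : Fin (B.word.length + 1)) (L : List (Fin B.strands)), List.Forall₂ P
      (L.map fun s => arcComplex N (MvPolynomial.C α)
        (MvPolynomial.X (t + 1, s) : MvPolynomial B.Mark A) (MvPolynomial.X (t, s)))
      (L.map fun s => arcComplex N (MvPolynomial.C (ψ α))
        (MvPolynomial.X (t + 1, s) : MvPolynomial B.Mark A') (MvPolynomial.X (t, s))) := by
    intro t L
    induction L with
    | nil => exact List.Forall₂.nil
    | cons s L ih =>
      refine List.Forall₂.cons ?_ ih
      have h := MFComplex.BaseChange.single
        (MatFac.BaseChange.arcMF (MvPolynomial.map ψ) N (MvPolynomial.C α)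
        (MvPolynomial.X (t + 1, s) : MvPolynomial B.Mark A) (MvPolynomial.X (t, s)))
      rw [MvPolynomial.map_C, MvPolynomial.map_X, MvPolynomial.map_X] at h
      exact ⟨h⟩
  have hpieces : ∀ t, List.Forall₂ P (B.slicePieces N α t) (B.slicePieces N (ψ α) t) := by
    intro t
    unfold slicePieces
    dsimp only
    split
    · exact harcs t _
    · refine List.Forall₂.cons ?_ (harcs t _)
      have h := fun s₁ s₂ s₃ s₄ : B.Mark => Nonempty.intro
        (MFComplex.BaseChange.posCrossing (MvPolynomial.map ψ) N (MvPolynomial.C α) (MvPolynomial.X s₁)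
          (MvPolynomial.X s₂) (MvPolynomial.X s₃) (MvPolynomial.X s₄))
      simp only [MvPolynomial.map_C, MvPolynomial.map_X] at h
      exact h _ _ _ _
    · refine List.Forall₂.cons ?_ (harcs t _)
      have h := fun s₁ s₂ s₃ s₄ : B.Mark => Nonempty.intro
        (MFComplex.BaseChange.negCrossing (MvPolynomial.map ψ) N (MvPolynomial.C α) (MvPolynomial.X s₁)
          (MvPolynomial.X s₂) (MvPolynomial.X s₃) (MvPolynomial.X s₄))
      simp only [MvPolynomial.map_C, MvPolynomial.map_X] at h
      exact h _ _ _ _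
  have hflat : ∀ L : List (Fin (B.word.length + 1)), List.Forall₂ P
      (L.flatMap (B.slicePieces N α)) (L.flatMap (B.slicePieces N (ψ α))) := by
    intro L
    induction L with
    | nil => exact List.Forall₂.nil
    | cons t L ih => exact List.rel_append (hpieces t) ih
  have hfold : ∀ L L', List.Forall₂ P L L' →
      P (L.foldr MFComplex.tensor (MFComplex.unit _))
        (L'.foldr MFComplex.tensor (MFComplex.unit _)) := by
    intro L L' h
    induction h with
    | nil => exact ⟨MFComplex.BaseChange.unit⟩
    | cons h _ ih =>
      obtain ⟨h⟩ := h
      obtain ⟨ih⟩ := ih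
      exact ⟨h.tensor ih⟩
  exact hfold _ _ (hflat _)

end BaseChange

/-! ### Refined gradings -/

section Refinement

open Polynomial

variable {A S G C : Type} [CommRing A] [CommRing S] [AddCommGroup C] [Module A C]
  [Algebra S A] [Module S C] [IsScalarTower S A C]

/-- The grading `gra` by `G × ℤ` refines the grading `grx` by `G`. -/
structure ProjGrading.Refines (gra : ProjGrading S (G × ℤ) C) (grx : ProjGrading A G C) :
    Prop where
  proj_proj : ∀ g j z, grx.proj g (gra.proj (g, j) z) = gra.proj (g, j) z
  comm : ∀ g h z, grx.proj g (gra.proj h z) = gra.proj h (grx.proj g z)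

namespace ProjGrading.Refines

variable {gra : ProjGrading S (G × ℤ) C} {grx : ProjGrading A G C}

theorem homology [AddGroup G] (h : gra.Refines grx) (f : C →ₗ[A] C) (δ : G) (δ' : G × ℤ)
    (hx : ∀ g z, grx.proj (g + δ) (f z) = f (grx.proj g z))
    (ha : ∀ g z, gra.proj (g + δ') (f z) = f (gra.proj g z)) :
    (gra.homology f δ' ha).Refines (grx.homology f δ hx) where
  proj_proj g j x := by
    obtain ⟨z, rfl⟩ := homologyClass_surjective f x
    exact congrArg (homologyClass f) (Subtype.ext (h.proj_proj g j z.val))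
  comm g k x := by
    obtain ⟨z, rfl⟩ := homologyClass_surjective f x
    exact congrArg (homologyClass f) (Subtype.ext (h.comm g k z.val))

-- A fine component lies in the coarse component named by its first index, and coarse projections to
-- different degrees annihilate each other.
omit [Algebra S A] [IsScalarTower S A C] in
theorem proj_eq_zero (h : gra.Refines grx) {g : G} {z : C} (hz : z ∈ grx.part g) {k : G × ℤ}
    (hk : k.1 ≠ g) : gra.proj k z = 0 := by
  have h₁ : gra.proj k z = grx.proj g (gra.proj k z) := by
    rw [h.comm, grx.mem_part.1 hz]
  rw [h₁, ← h.proj_proj k.1 k.2 z, grx.proj_ne _ _ _ (Ne.symm hk)]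

/-- The grading that a refinement induces on a component. -/
def onPart (h : gra.Refines grx) (g : G) : ProjGrading S ℤ (grx.part g) where
  proj j :=
    { toFun := fun z => ⟨gra.proj (g, j) z.val, grx.mem_part.2 (h.proj_proj g j z.val)⟩
      map_add' := fun y z => Subtype.ext (map_add (gra.proj (g, j)) y.val z.val)
      map_smul' := fun c z => Subtype.ext (map_smul (gra.proj (g, j)) c z.val) }
  proj_self j z := Subtype.ext (gra.proj_self (g, j) z.val)
  proj_ne j k z hjk := Subtype.ext
    (gra.proj_ne (g, j) (g, k) z.val fun e => hjk (Prod.ext_iff.1 e).2)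
  exists_sum z := by
    classical
    obtain ⟨s, hs⟩ := gra.exists_sum z.val
    -- Only the indices over g see an element of this component, and they are distinguished by their
    -- last entry.
    refine ⟨(s.filter fun k => k.1 = g).image Prod.snd, Subtype.ext ?_⟩
    refine (map_sum (grx.part g).subtype _ _).trans ?_
    change ∑ j ∈ _, gra.proj (g, j) z.val = z.val
    rw [Finset.sum_image]
    · have hfil := Finset.sum_filter_of_ne (s := s) (f := fun k => gra.proj k z.val)
        (p := fun k => k.1 = g) fun k _ hk => by
          by_contra hne
          exact hk (h.proj_eq_zero z.2 hne)
      refine Eq.trans (Finset.sum_congr rfl fun k hk => ?_) (hfil.trans hs)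
      have hkg : (g, k.2) = k := Prod.ext (Finset.mem_filter.1 hk).2.symm rfl
      rw [hkg]
    · intro k hk k' hk' e
      refine Prod.ext ?_ e
      rw [(Finset.mem_filter.1 hk).2, (Finset.mem_filter.1 hk').2]

theorem mem_onPart (h : gra.Refines grx) (g : G) (j : ℤ) (z : grx.part g) :
    z ∈ (h.onPart g).part j ↔ z.val ∈ gra.part (g, j) := by
  rw [mem_part, mem_part, Subtype.ext_iff]
  rfl

end ProjGrading.Refines

/-- The comparison of a graded `ℚ[a]`-module with its reduction modulo `a - 1`, for a component
that is finitely generated over `ℚ[a]`. -/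
theorem graded_reduction_structure {T T' : Type} [AddCommGroup T] [Module ℚ[X] T] [Module ℚ T]
    [IsScalarTower ℚ ℚ[X] T] [AddCommGroup T'] [Module ℚ T'] {ρ : T →ₗ[ℚ] T'}
    (hρ : IsReduction ρ) [AddGroup G] {grx : ProjGrading ℚ[X] G T}
    {gra : ProjGrading ℚ (G × ℤ) T}
    {grx' : ProjGrading ℚ G T'} (hgr : ∀ g z, ρ (grx.proj g z) = grx'.proj g (ρ z))
    (href : gra.Refines grx) (hX : gra.IsShiftedByX (0, 2)) (g : G)
    [IsNoetherian ℚ[X] (grx.part g)] {P : Submodule ℚ[X] T} (hP : P = grx.part g)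
    {P' : Submodule ℚ T'} (hP' : P' = grx'.part g) {Q : ℤ → Submodule ℚ T}
    (hQ : ∀ j, Q j = gra.part (g, j)) :
    Nonempty (P' ≃ₗ[ℚ] (P ⧸ (Ideal.span {(X - 1 : ℚ[X])} • (⊤ : Submodule ℚ[X] P)))) ∧
    FiniteDimensional ℚ P' ∧
    ∃ (n : ℕ) (s : Fin (Module.finrank ℚ P') → ℤ) (l : Fin n → ℕ) (t : Fin n → ℤ),
      ((∀ q, 0 < l q) ∧ ∃ e : P ≃ₗ[ℚ[X]] ModelModule (Module.finrank ℚ P') l,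
        ∀ j, e '' {h : P | h.val ∈ Q j} = modelDeg s l t j) ∧
      ∀ (m' n' : ℕ) (s' : Fin m' → ℤ) (l' : Fin n' → ℕ) (t' : Fin n' → ℤ),
        ((∀ q, 0 < l' q) ∧ ∃ e : P ≃ₗ[ℚ[X]] ModelModule m' l',
          ∀ j, e '' {h : P | h.val ∈ Q j} = modelDeg s' l' t' j) →
        (∃ σ : Fin m' ≃ Fin (Module.finrank ℚ P'), ∀ p, s (σ p) = s' p) ∧
        ∃ τ : Fin n' ≃ Fin n, ∀ q, l (τ q) = l' q ∧ t (τ q) = t' q := by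
  subst hP hP'
  have hX' : (href.onPart g).IsShiftedByX 2 := by
    intro j z
    refine Subtype.ext ((congrArg (fun k => gra.proj k _) ?_).trans (hX (g, j) z.val))
    simp
  have hQ' : ∀ j, {h : grx.part g | h.val ∈ Q j} = {h | h ∈ (href.onPart g).part j} := by
    intro j
    ext h
    rw [hQ]
    exact (href.mem_onPart g j h).symm
  simp only [hQ']
  obtain ⟨E⟩ := hρ.nonempty_equiv_part grx grx' hgr g
  obtain ⟨m, n, s, l, t, hl, e, he⟩ := exists_graded_decomposition hX'
  obtain ⟨F⟩ := nonempty_reduction_equiv e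
  -- The free rank and the dimension over ℚ both measure the quotient by a - 1.
  have hm : m = Module.finrank ℚ (grx'.part g) := by
    rw [(E.trans F).finrank_eq, Module.finrank_fintype_fun_eq_card, Fintype.card_fin]
  subst hm
  refine ⟨⟨E⟩, Module.Finite.equiv (E.trans F).symm, n, s, l, t, ⟨hl, e, he⟩, ?_⟩
  rintro m' n' s' l' t' ⟨hl', e', he'⟩
  exact graded_decomposition_unique hX' hl e he hl' e' he'

end Refinement

/-! ### The gradings of the complex of a closed braid -/

namespace MFComplex

/-! ### The grading without the a-degree -/

section XGrading

variable {V A : Type} [CommRing A] (M : MFComplex (MvPolynomial V A))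

/-- The basis of monomials. -/
noncomputable def xBasis : Module.Basis (Σ _ : M.ι, V →₀ ℕ) A (M.ι → MvPolynomial V A) :=
  Pi.basis fun _ => MvPolynomial.basisMonomials V A

theorem xBasis_repr (z : M.ι → MvPolynomial V A) (I : Σ _ : M.ι, V →₀ ℕ) :
    M.xBasis.repr z I = (z I.1).coeff I.2 := rfl

theorem xBasis_apply (I : Σ _ : M.ι, V →₀ ℕ) :
    M.xBasis I = Pi.single I.1 (MvPolynomial.monomial I.2 1) := by
  rw [xBasis, Pi.basis_apply, MvPolynomial.coe_basisMonomials]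

/-- The `ℤ/2`-degree, the homological degree and the `x`-degree of a monomial. -/
noncomputable def xDegree (I : Σ _ : M.ι, V →₀ ℕ) : ZMod 2 × ℤ × ℤ :=
  (M.parity I.1, M.hdeg I.1, M.xdeg I.1 + 2 * (I.2.degree : ℤ))

noncomputable def xGrading : ProjGrading A (ZMod 2 × ℤ × ℤ) (M.ι → MvPolynomial V A) :=
  ProjGrading.ofBasis M.xBasis M.xDegree

theorem xGrading_coeff (g : ZMod 2 × ℤ × ℤ) (z : M.ι → MvPolynomial V A) (b : M.ι)
    (m : V →₀ ℕ) :
    (M.xGrading.proj g z b).coeff m = if M.xDegree ⟨b, m⟩ = g then (z b).coeff m else 0 :=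
  ProjGrading.ofBasis_repr M.xBasis M.xDegree g z ⟨b, m⟩

theorem xPart_eq (ε : ZMod 2) (i k : ℤ) : M.xPart ε i k = M.xGrading.part (ε, i, k) := by
  ext z
  rw [xGrading, ProjGrading.mem_ofBasis_part]
  constructor
  · rintro h ⟨b, m⟩ hz
    obtain ⟨h₁, h₂, h₃⟩ := h b m hz
    exact Prod.ext h₁ (Prod.ext h₂ h₃)
  · intro h b m hz
    have := h ⟨b, m⟩ hz
    simp only [xDegree, Prod.mk.injEq] at this
    exact this

/-- A fixed x-degree bounds the total exponent, and there are finitely many variables. Powers of a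
belong to the coefficients here, so the finiteness is over ℚ[a] and not over ℚ. -/
theorem finite_xDegree [Finite V] (g : ZMod 2 × ℤ × ℤ) : {I | M.xDegree I = g}.Finite := by
  refine Set.Finite.subset (Set.finite_iUnion fun b : M.ι =>
    (Finsupp.finite_of_degree_le (σ := V) (g.2.2 - M.xdeg b).toNat).image (Sigma.mk b)) ?_
  rintro ⟨b, m⟩ h
  refine Set.mem_iUnion.2 ⟨b, m, ?_, rfl⟩
  have h' : M.xDegree ⟨b, m⟩ = g := h
  have h₃ : M.xdeg b + 2 * (m.degree : ℤ) = g.2.2 := by rw [← h']; rfl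
  change m.degree ≤ _
  omega

theorem noetherian_xGrading_part [Finite V] [IsNoetherianRing A] (g : ZMod 2 × ℤ × ℤ) :
    IsNoetherian A (M.xGrading.part g) :=
  ProjGrading.ofBasis_part_noetherian _ _ g (M.finite_xDegree g)

theorem mulVec_single_apply (D : Matrix M.ι M.ι (MvPolynomial V A)) (b b' : M.ι)
    (f : MvPolynomial V A) : D.mulVec (Pi.single b f) b' = D b' b * f := by
  rw [Matrix.mulVec_single]
  rfl

end XGrading

/-! ### The refinement by the a-degree -/

section AXGrading

open Polynomial

variable {V : Type} (M : MFComplex (MvPolynomial V ℚ[X]))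

/-- The basis of monomials over `ℚ`. -/
noncomputable def axBasis :
    Module.Basis (ℕ × Σ _ : M.ι, V →₀ ℕ) ℚ (M.ι → MvPolynomial V ℚ[X]) :=
  (Polynomial.basisMonomials ℚ).smulTower M.xBasis

theorem axBasis_repr (z : M.ι → MvPolynomial V ℚ[X]) (I : ℕ × Σ _ : M.ι, V →₀ ℕ) :
    M.axBasis.repr z I = ((z I.2.1).coeff I.2.2).coeff I.1 := by
  rw [axBasis, Module.Basis.smulTower_repr]
  rfl

theorem axBasis_apply (I : ℕ × Σ _ : M.ι, V →₀ ℕ) :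
    M.axBasis I = Pi.single I.2.1 (MvPolynomial.monomial I.2.2 (X ^ I.1)) := by
  rw [axBasis, Module.Basis.smulTower_apply, xBasis_apply, Polynomial.coe_basisMonomials,
    ← Pi.single_smul, MvPolynomial.smul_monomial, smul_eq_mul, mul_one]
  beta_reduce
  rw [Polynomial.monomial_one_right_eq_X_pow]

/-- The degree of a monomial, with the `a`-degree as last entry. -/
noncomputable def axDegree (I : ℕ × Σ _ : M.ι, V →₀ ℕ) : (ZMod 2 × ℤ × ℤ) × ℤ :=
  (M.xDegree I.2, M.adeg I.2.1 + 2 * (I.1 : ℤ))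

noncomputable def axGrading :
    ProjGrading ℚ ((ZMod 2 × ℤ × ℤ) × ℤ) (M.ι → MvPolynomial V ℚ[X]) :=
  ProjGrading.ofBasis M.axBasis M.axDegree

theorem axGrading_coeff (g : (ZMod 2 × ℤ × ℤ) × ℤ) (z : M.ι → MvPolynomial V ℚ[X]) (b : M.ι)
    (m : V →₀ ℕ) (e : ℕ) : ((M.axGrading.proj g z b).coeff m).coeff e
      = if M.axDegree (e, ⟨b, m⟩) = g then ((z b).coeff m).coeff e else 0 := by
  have h := ProjGrading.ofBasis_repr M.axBasis M.axDegree g z (e, ⟨b, m⟩)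
  rwa [axBasis_repr, axBasis_repr] at h

theorem axPart_eq (ε : ZMod 2) (i j k : ℤ) :
    M.axPart ε i j k = M.axGrading.part ((ε, i, k), j) := by
  ext z
  rw [axGrading, ProjGrading.mem_ofBasis_part]
  constructor
  · rintro h ⟨e, b, m⟩ hz
    rw [axBasis_repr] at hz
    obtain ⟨h₁, h₂, h₃, h₄⟩ := h b m e hz
    exact Prod.ext (Prod.ext h₁ (Prod.ext h₂ h₄)) h₃
  · intro h b m e hz
    have := h (e, ⟨b, m⟩) (by rwa [axBasis_repr])
    simp only [axDegree, xDegree, Prod.mk.injEq] at this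
    exact ⟨this.1.1, this.1.2.1, this.2, this.1.2.2⟩

theorem axGrading_refines : M.axGrading.Refines M.xGrading where
  proj_proj g j z := by
    funext b
    refine MvPolynomial.ext _ _ fun m => Polynomial.ext fun e => ?_
    rw [xGrading_coeff]
    split_ifs with h
    · rfl
    · rw [axGrading_coeff, if_neg fun h' => h (Prod.ext_iff.1 h').1, coeff_zero]
  comm g k z := by
    funext b
    refine MvPolynomial.ext _ _ fun m => Polynomial.ext fun e => ?_
    rw [xGrading_coeff, axGrading_coeff, xGrading_coeff]
    split_ifs with h₁ h₂ h₂
    · rw [axGrading_coeff, if_pos h₂]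
    · rw [axGrading_coeff, if_neg h₂]
    · rfl
    · rfl

theorem axGrading_shifted : M.axGrading.IsShiftedByX (0, 2) := by
  intro g z
  refine ProjGrading.ofBasis_homogeneous M.axBasis M.axDegree (0, 2)
    ((LinearMap.lsmul ℚ[X] (M.ι → MvPolynomial V ℚ[X]) X).restrictScalars ℚ) ?_ g z
  classical
  rintro ⟨e, b, m⟩ J hJ
  have h : ((LinearMap.lsmul ℚ[X] (M.ι → MvPolynomial V ℚ[X]) X).restrictScalars ℚ)
      (M.axBasis (e, ⟨b, m⟩)) = M.axBasis (e + 1, ⟨b, m⟩) := by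
    rw [axBasis_apply, axBasis_apply]
    change (X : ℚ[X]) • Pi.single b _ = _
    rw [← Pi.single_smul, MvPolynomial.smul_monomial, smul_eq_mul, ← pow_succ']
  rw [h, Module.Basis.repr_self, Finsupp.single_apply] at hJ
  have hJ' : (e + 1, (⟨b, m⟩ : Σ _ : M.ι, V →₀ ℕ)) = J := by
    by_contra hne
    exact hJ (if_neg hne)
  rw [← hJ']
  refine Prod.ext ?_ ?_
  · simp [axDegree]
  · simp only [axDegree, Prod.mk_add_mk]
    push_cast
    ring

theorem biHom_monomial (m : V →₀ ℕ) (e : ℕ) :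
    BiHom (2 * e) (2 * m.degree) (MvPolynomial.monomial m (X ^ e : ℚ[X])) := by
  classical
  intro m' e' h
  rw [MvPolynomial.coeff_monomial] at h
  split_ifs at h with hm
  · rw [coeff_X_pow] at h
    split_ifs at h with he
    · exact ⟨by rw [he], by rw [hm]⟩
    · exact absurd rfl h
  · exact absurd (coeff_zero _) h

variable (D : Matrix M.ι M.ι (MvPolynomial V ℚ[X])) {π : ZMod 2} {η p q : ℤ}

/-- A bihomogeneous entry times a monomial has a known bidegree, which fixes the exponents of every
monomial that occurs. -/
theorem degree_of_coeff_ne_zero (hD : IsHomogMatrix M.adeg M.xdeg M.adeg M.xdeg p q D)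
    (hD' : ∀ b b', D b b' ≠ 0 → M.parity b = M.parity b' + π ∧ M.hdeg b = M.hdeg b' + η)
    {b b' : M.ι} {m m' : V →₀ ℕ} {e e' : ℕ}
    (h : ((D b' b * MvPolynomial.monomial m (X ^ e)).coeff m').coeff e' ≠ 0) :
    M.axDegree (e', ⟨b', m'⟩) = M.axDegree (e, ⟨b, m⟩) + ((π, η, q), p) := by
  obtain ⟨h₁, h₂⟩ := hD' b' b fun h0 => h (by rw [h0, zero_mul]; simp)
  obtain ⟨h₃, h₄⟩ := (hD b' b).mul (biHom_monomial m e) m' e' h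
  refine Prod.ext (Prod.ext h₁ (Prod.ext h₂ ?_)) ?_
  · change M.xdeg b' + 2 * (m'.degree : ℤ) = M.xdeg b + 2 * (m.degree : ℤ) + q
    linarith
  · change M.adeg b' + 2 * (e' : ℤ) = M.adeg b + 2 * (e : ℤ) + p
    linarith

theorem axGrading_mulVec (hD : IsHomogMatrix M.adeg M.xdeg M.adeg M.xdeg p q D)
    (hD' : ∀ b b', D b b' ≠ 0 → M.parity b = M.parity b' + π ∧ M.hdeg b = M.hdeg b' + η)
    (g : (ZMod 2 × ℤ × ℤ) × ℤ) (z : M.ι → MvPolynomial V ℚ[X]) :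
    M.axGrading.proj (g + ((π, η, q), p)) (D.mulVec z) = D.mulVec (M.axGrading.proj g z) := by
  refine ProjGrading.ofBasis_homogeneous M.axBasis M.axDegree ((π, η, q), p)
    (D.mulVecLin.restrictScalars ℚ) ?_ g z
  rintro ⟨e, b, m⟩ ⟨e', b', m'⟩ h
  rw [axBasis_repr, axBasis_apply] at h
  change ((D.mulVec (Pi.single b _) b').coeff m').coeff e' ≠ 0 at h
  rw [mulVec_single_apply] at h
  exact M.degree_of_coeff_ne_zero D hD hD' h

theorem xGrading_mulVec (hD : IsHomogMatrix M.adeg M.xdeg M.adeg M.xdeg p q D)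
    (hD' : ∀ b b', D b b' ≠ 0 → M.parity b = M.parity b' + π ∧ M.hdeg b = M.hdeg b' + η)
    (g : ZMod 2 × ℤ × ℤ) (z : M.ι → MvPolynomial V ℚ[X]) :
    M.xGrading.proj (g + (π, η, q)) (D.mulVec z) = D.mulVec (M.xGrading.proj g z) := by
  refine ProjGrading.ofBasis_homogeneous M.xBasis M.xDegree (π, η, q)
    (D.mulVecLin.restrictScalars ℚ[X]) ?_ g z
  rintro ⟨b, m⟩ ⟨b', m'⟩ h
  rw [xBasis_repr, xBasis_apply] at h
  change (D.mulVec (Pi.single b _) b').coeff m' ≠ 0 at h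
  rw [mulVec_single_apply] at h
  -- A nonzero coefficient in ℚ[a] has a nonzero rational coefficient, so the degree count over ℚ
  -- applies, with input exponent zero.
  obtain ⟨e', he'⟩ : ∃ e', ((D b' b * MvPolynomial.monomial m 1).coeff m').coeff e' ≠ 0 := by
    by_contra! hc
    exact h (Polynomial.ext hc)
  rw [← pow_zero (X : ℚ[X])] at he'
  exact (Prod.ext_iff.1 (M.degree_of_coeff_ne_zero D hD hD' he')).1

end AXGrading

/-! ### Evaluation at a = 1 on chains -/

section Reduction

open Polynomial

variable {V : Type} {M : MFComplex (MvPolynomial V ℚ[X])} {M' : MFComplex (MvPolynomial V ℚ)}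

/-- The reduction modulo `a - 1` of the underlying module of a complex. -/
noncomputable def BaseChange.reduce
    (h : MFComplex.BaseChange (MvPolynomial.map (evalRingHom (1 : ℚ))) M M') :
    (M.ι → MvPolynomial V ℚ[X]) →ₗ[ℚ] (M'.ι → MvPolynomial V ℚ) where
  toFun z b' := MvPolynomial.map (evalRingHom (1 : ℚ)) (z (h.e.symm b'))
  map_add' y z := funext fun b' => by simp
  map_smul' c z := funext fun b' => MvPolynomial.ext _ _ fun m => by
    simp [MvPolynomial.coeff_map]

variable (h : MFComplex.BaseChange (MvPolynomial.map (evalRingHom (1 : ℚ))) M M')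

theorem BaseChange.reduce_apply (z : M.ι → MvPolynomial V ℚ[X]) (b : M.ι) :
    h.reduce z (h.e b) = MvPolynomial.map (evalRingHom (1 : ℚ)) (z b) := by
  simp [BaseChange.reduce]

theorem BaseChange.ext_reduce {y z : M'.ι → MvPolynomial V ℚ}
    (hyz : ∀ b, y (h.e b) = z (h.e b)) : y = z := by
  funext b'
  rw [← h.e.apply_symm_apply b']
  exact hyz _

/-- Rational coefficients lift as constants, and a polynomial in a vanishing at 1 is divisible by a
- 1, which is applied to each coefficient. -/
theorem BaseChange.reduce_isReduction : IsReduction h.reduce where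
  surj z' := by
    refine ⟨fun b => MvPolynomial.map C (z' (h.e b)), h.ext_reduce fun b => ?_⟩
    rw [h.reduce_apply, MvPolynomial.map_map]
    have : (evalRingHom (1 : ℚ)).comp C = RingHom.id ℚ := RingHom.ext fun c => by simp
    rw [this, MvPolynomial.map_id]
  map_smul_eq_zero w := h.ext_reduce fun b => MvPolynomial.ext _ _ fun m => by
    rw [h.reduce_apply]
    simp [MvPolynomial.coeff_map]
  exists_smul z hz := by
    have hdvd : ∀ b, MvPolynomial.C (X - 1 : ℚ[X]) ∣ z b := by
      intro b
      rw [MvPolynomial.C_dvd_iff_dvd_coeff]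
      intro m
      have h₁ := congrArg (MvPolynomial.coeff m) (congrFun hz (h.e b))
      rw [h.reduce_apply, MvPolynomial.coeff_map] at h₁
      have h₂ : ((z b).coeff m).IsRoot 1 := by simpa using h₁
      rwa [← dvd_iff_isRoot, C_1] at h₂
    choose w hw using hdvd
    refine ⟨w, funext fun b => ?_⟩
    rw [hw, Pi.smul_apply, MvPolynomial.smul_eq_C_mul]
  injective z hz := M.axGrading_shifted.injective_X_sub_one
    (fun n hn => by simpa [Prod.ext_iff] using hn) z hz

theorem BaseChange.reduce_mulVec {D : Matrix M.ι M.ι (MvPolynomial V ℚ[X])}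
    {D' : Matrix M'.ι M'.ι (MvPolynomial V ℚ)}
    (hD : ∀ b b', D' (h.e b) (h.e b') = MvPolynomial.map (evalRingHom (1 : ℚ)) (D b b'))
    (z : M.ι → MvPolynomial V ℚ[X]) : h.reduce (D.mulVec z) = D'.mulVec (h.reduce z) := by
  refine h.ext_reduce fun b => ?_
  rw [h.reduce_apply, Matrix.mulVec, Matrix.mulVec, dotProduct, dotProduct, map_sum,
    ← h.e.sum_comp]
  simp only [map_mul, hD, h.reduce_apply]

theorem BaseChange.reduce_xGrading (g : ZMod 2 × ℤ × ℤ) (z : M.ι → MvPolynomial V ℚ[X]) :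
    h.reduce (M.xGrading.proj g z) = M'.xGrading.proj g (h.reduce z) := by
  refine h.ext_reduce fun b => MvPolynomial.ext _ _ fun m => ?_
  have hdeg : M'.xDegree ⟨h.e b, m⟩ = M.xDegree ⟨b, m⟩ :=
    Prod.ext (h.parity b) (Prod.ext (h.hdeg b) (congrArg (· + 2 * (m.degree : ℤ)) (h.xdeg b)))
  rw [xGrading_coeff, h.reduce_apply, h.reduce_apply, MvPolynomial.coeff_map,
    MvPolynomial.coeff_map, xGrading_coeff, hdeg]
  split_ifs
  · rfl
  · exact map_zero _

end Reduction

/-! ### Passage through both homologies -/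

section TotalHomology

open Polynomial

variable {V : Type} {M : MFComplex (MvPolynomial V ℚ[X])} {M' : MFComplex (MvPolynomial V ℚ)}

set_option maxHeartbeats 1000000 in
theorem homology_structure [Finite V] {N : ℕ} (hM : M.IsHomog N) (hpot : M.pot = 0)
    (h : MFComplex.BaseChange (MvPolynomial.map (evalRingHom (1 : ℚ))) M M') (ε : ZMod 2)
    (i k : ℤ) :
    Nonempty (M'.homologyXPart ε i k ≃ₗ[ℚ] (M.homologyXPart ε i k ⧸
      (Ideal.span {(X - 1 : ℚ[X])} • (⊤ : Submodule ℚ[X] (M.homologyXPart ε i k))))) ∧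
    FiniteDimensional ℚ (M'.homologyXPart ε i k) ∧
    ∃ (n : ℕ) (s : Fin (Module.finrank ℚ (M'.homologyXPart ε i k)) → ℤ) (l : Fin n → ℕ)
      (t : Fin n → ℤ),
      ((∀ q, 0 < l q) ∧ ∃ e : M.homologyXPart ε i k ≃ₗ[ℚ[X]]
          ModelModule (Module.finrank ℚ (M'.homologyXPart ε i k)) l,
        ∀ j, e '' {x : M.homologyXPart ε i k | x.val ∈ M.homologyAXPart ε i j k}
          = modelDeg s l t j) ∧
      ∀ (m' n' : ℕ) (s' : Fin m' → ℤ) (l' : Fin n' → ℕ) (t' : Fin n' → ℤ),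
        ((∀ q, 0 < l' q) ∧ ∃ e : M.homologyXPart ε i k ≃ₗ[ℚ[X]] ModelModule m' l',
          ∀ j, e '' {x : M.homologyXPart ε i k | x.val ∈ M.homologyAXPart ε i j k}
            = modelDeg s' l' t' j) →
        (∃ σ : Fin m' ≃ Fin (Module.finrank ℚ (M'.homologyXPart ε i k)), ∀ p, s (σ p) = s' p) ∧
        ∃ τ : Fin n' ≃ Fin n, ∀ q, l (τ q) = l' q ∧ t (τ q) = t' q := by
  have hτ : ∀ n : ℕ, n • (((0, 2) : (ZMod 2 × ℤ × ℤ) × ℤ)) = 0 → n = 0 := fun n hn => by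
    simpa [Prod.ext_iff] using hn
  have hmf := fun b b' (h0 : M.dmf b b' ≠ 0) => And.intro (M.dmf_odd b b' h0)
    ((M.dmf_hdeg b b' h0).trans (add_zero _).symm)
  have hchi := fun b b' (h0 : M.dchi b b' ≠ 0) => And.intro
    ((M.dchi_parity b b' h0).trans (add_zero _).symm) (M.dchi_hdeg b b' h0)
  have hmfx : ∀ g z, M.xGrading.proj (g + (1, 0, (N : ℤ) + 1)) (M.dmfMap z)
      = M.dmfMap (M.xGrading.proj g z) := M.xGrading_mulVec M.dmf hM.dmf hmf
  have hmfa : ∀ g z, M.axGrading.proj (g + ((1, 0, (N : ℤ) + 1), 1)) (M.dmfMap z)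
      = M.dmfMap (M.axGrading.proj g z) := M.axGrading_mulVec M.dmf hM.dmf hmf
  have hchix : ∀ g z, M.xGrading.proj (g + (0, 1, 0)) (M.dchiMap z)
      = M.dchiMap (M.xGrading.proj g z) := M.xGrading_mulVec M.dchi hM.dchi hchi
  have hchia : ∀ g z, M.axGrading.proj (g + ((0, 1, 0), 0)) (M.dchiMap z)
      = M.dchiMap (M.axGrading.proj g z) := M.axGrading_mulVec M.dchi hM.dchi hchi
  have hρ := h.reduce_isReduction
  have hmfr : ∀ z, h.reduce (M.dmfMap z) = M'.dmfMap (h.reduce z) := h.reduce_mulVec h.dmf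
  have hchir : ∀ z, h.reduce (M.dchiMap z) = M'.dchiMap (h.reduce z) := h.reduce_mulVec h.dchi
  have hmfx' := hρ.homogeneous _ _ h.reduce_xGrading _ _ hmfr _ hmfx
  have hchix' := hρ.homogeneous _ _ h.reduce_xGrading _ _ hchir _ hchix
  have hmfsq : ∀ z, M.dmfMap (M.dmfMap z) = 0 := fun z => by
    change M.dmf.mulVec (M.dmf.mulVec z) = 0
    rw [Matrix.mulVec_mulVec, M.dmf_sq, hpot, zero_smul, Matrix.zero_mulVec]
  have hchisq : ∀ x, M.dchiHom (M.dchiHom x) = 0 := fun x => by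
    obtain ⟨z, rfl⟩ := homologyClass_surjective M.dmfMap x
    refine (congrArg (homologyClass M.dmfMap) (Subtype.ext ?_)).trans (map_zero _)
    change M.dchi.mulVec (M.dchi.mulVec z.val) = 0
    rw [Matrix.mulVec_mulVec, M.dchi_sq, Matrix.zero_mulVec]
  -- First passage: the a-grading descends to the homology of d_mf and makes a - 1 injective there,
  -- so the reduction descends as well.
  have hX₁ := M.axGrading_shifted.homology M.dmfMap _ hmfa
  have hρ₁ := hρ.homology M.dmfMap M'.dmfMap hmfsq hmfr (hX₁.injective_X_sub_one hτ)
  have href₁ := M.axGrading_refines.homology M.dmfMap _ _ hmfx hmfa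
  have hgr₁ := reductionMap_proj _ _ h.reduce_xGrading M.dmfMap M'.dmfMap hmfr _ hmfx hmfx'
  have hx₁ : ∀ g x, (M.xGrading.homology M.dmfMap _ hmfx).proj (g + (0, 1, 0)) (M.dchiHom x)
      = M.dchiHom ((M.xGrading.homology M.dmfMap _ hmfx).proj g x) :=
    M.xGrading.homology_homogeneous M.dmfMap _ hmfx M.dchiMap M.dmfMap_comp_dchiMap _ hchix
  have ha₁ : ∀ g x, (M.axGrading.homology M.dmfMap _ hmfa).proj (g + ((0, 1, 0), 0)) (M.dchiHom x)
      = M.dchiHom ((M.axGrading.homology M.dmfMap _ hmfa).proj g x) :=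
    M.axGrading.homology_homogeneous M.dmfMap _ hmfa M.dchiMap M.dmfMap_comp_dchiMap _ hchia
  have hx₁' : ∀ g x, (M'.xGrading.homology M'.dmfMap _ hmfx').proj (g + (0, 1, 0)) (M'.dchiHom x)
      = M'.dchiHom ((M'.xGrading.homology M'.dmfMap _ hmfx').proj g x) :=
    M'.xGrading.homology_homogeneous M'.dmfMap _ hmfx' M'.dchiMap M'.dmfMap_comp_dchiMap _ hchix'
  have hr₁ : ∀ x, reductionMap h.reduce M.dmfMap M'.dmfMap hmfr (M.dchiHom x)
      = M'.dchiHom (reductionMap h.reduce M.dmfMap M'.dmfMap hmfr x) :=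
    reductionMap_comm M.dmfMap M.dchiMap M'.dmfMap M'.dchiMap hmfr hchir
      M.dmfMap_comp_dchiMap M'.dmfMap_comp_dchiMap
  -- Second passage: the data just obtained on the first homology have the same form as those on
  -- chains.
  have hX₂ := hX₁.homology M.dchiHom _ ha₁
  have hρ₂ := hρ₁.homology M.dchiHom M'.dchiHom hchisq hr₁ (hX₂.injective_X_sub_one hτ)
  have href₂ := href₁.homology M.dchiHom _ _ hx₁ ha₁
  have hgr₂ := reductionMap_proj _ _ hgr₁ M.dchiHom M'.dchiHom hr₁ _ hx₁ hx₁'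
  have hP : M.homologyXPart ε i k = ((M.xGrading.homology M.dmfMap _ hmfx).homology
      M.dchiHom _ hx₁).part (ε, i, k) := by
    rw [homologyXPart, xPart_eq, ProjGrading.homologyPart_part _ _ _ hmfx,
      ProjGrading.homologyPart_part _ _ _ hx₁]
  have hP' : M'.homologyXPart ε i k = ((M'.xGrading.homology M'.dmfMap _ hmfx').homology
      M'.dchiHom _ hx₁').part (ε, i, k) := by
    rw [homologyXPart, xPart_eq, ProjGrading.homologyPart_part _ _ _ hmfx',
      ProjGrading.homologyPart_part _ _ _ hx₁']
  have hQ : ∀ j, M.homologyAXPart ε i j k = ((M.axGrading.homology M.dmfMap _ hmfa).homology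
      M.dchiHom _ ha₁).part ((ε, i, k), j) := fun j => by
    rw [homologyAXPart, axPart_eq, ProjGrading.homologyPart_part _ _ _ hmfa,
      ProjGrading.homologyPart_part _ _ _ ha₁]
  -- Finite generation starts from the component of the chain module and survives both subquotients.
  have hN : IsNoetherian ℚ[X] (M.homologyXPart ε i k) := by
    have h₀ : IsNoetherian ℚ[X] (M.xPart ε i k) := by
      rw [xPart_eq]
      exact M.noetherian_xGrading_part _
    have h₁ := homologyPart_noetherian M.dmfMap (M.xPart ε i k)
    exact homologyPart_noetherian M.dchiHom (homologyPart ℚ[X] M.dmfMap (M.xPart ε i k))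
  rw [hP] at hN
  exact graded_reduction_structure hρ₂ hgr₂ href₂ hX₂ (ε, i, k) hP hP' hQ

end TotalHomology

end MFComplex

set_option maxHeartbeats 1000000 in
theorem theorem1p8 (N : ℕ) (B : ClosedBraid) (ε : ZMod 2) (i k : ℤ) :
    Nonempty (slHomology N B ε i k ≃ₗ[ℚ]
      (transverseHomology N B ε i k ⧸
        (Ideal.span {(Polynomial.X - 1 : Polynomial ℚ)} •
          (⊤ : Submodule (Polynomial ℚ) (transverseHomology N B ε i k))))) ∧
    FiniteDimensional ℚ (slHomology N B ε i k) ∧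
    ∃ (n : ℕ) (s : Fin (Module.finrank ℚ (slHomology N B ε i k)) → ℤ)
      (l : Fin n → ℕ) (t : Fin n → ℤ),
      IsDecomposition N B ε i k s l t ∧
      ∀ (m' n' : ℕ) (s' : Fin m' → ℤ) (l' : Fin n' → ℕ) (t' : Fin n' → ℤ),
        IsDecomposition N B ε i k s' l' t' →
        (∃ σ : Fin m' ≃ Fin (Module.finrank ℚ (slHomology N B ε i k)),
          ∀ p, s (σ p) = s' p) ∧
        ∃ τ : Fin n' ≃ Fin n, ∀ q, l (τ q) = l' q ∧ t (τ q) = t' q := by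
  obtain ⟨h⟩ := B.nonempty_baseChange N (Polynomial.evalRingHom (1 : ℚ)) Polynomial.X
  -- Evaluation sends the parameter a of the potential to 1, which identifies the target with the
  -- complex over ℚ.
  rw [Polynomial.coe_evalRingHom, Polynomial.eval_X] at h
  have key := MFComplex.homology_structure (B.isHomog_complex N) (B.complex_pot N Polynomial.X)
    h ε i k
  unfold IsDecomposition transverseHomologyADeg
  exact key
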